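/- **Theorem (existence and uniqueness of the numerical solution).** Let $d\in\{2,3\}$ and let $\Omega\subset\mathbb R^d$ be a bounded polygonal or polyhedral domain, i.e. the interior of a (possibly nonconvex) $d$-dimensional polytope. Let $\rho>0$, let $\mathbf b\in[W^{1,\infty}(\Omega)]^d$, represented by a field that is continuous on $\overline\Omega$ (when $\Omega$ is Lipschitz such a representative always exists), and let $c,f\in L^1(\Omega)$ (for instance $c\in L^\infty(\Omega)$, $f\in L^2(\Omega)$) be such that $c+\tfrac12\nabla\cdot\mathbf b\ge c_0$ almost everywhere in $\Omega$ for a constant $c_0>0$. Let $\mathcal T_h$ be a finite partition of $\Omega$ into convex or nonconvex polytopes, and $\mathcal E_h$ the set of its edges ($d=2$) or faces ($d=3$), where the boundary of each element is a union of members of $\mathcal E_h$ and the relative interior of a member of $\mathcal E_h$ meets no other member. Assume that each $e\in\mathcal E_h$ not contained in $\partial\Omega$ belongs to an element none of whose other edges/faces lies in the same hyperplane as $e$. (This holds in particular if distinct edges/faces of an element always lie in distinct hyperplanes.) Let $k\ge q\ge0$ be integers. Let $V_h$ be the space of all $v=\{v_0,v_b\}$ with $v_0|_T\in P_k(T)$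 for each $T\in\mathcal T_h$ and $v_b|_e\in P_q(e)$, single-valued, for each $e\in\mathcal E_h$. Let $V_h^0$ be the subspace of those $v\in V_h$ with $v_b=0$ on $\partial\Omega$. For an element $T$ with $N$ edges/faces in $\mathcal E_h$ and outward unit normal $\mathbf n$, put $r=k-1+N$ if $T$ is convex and $r=k-1+2N$ if it is not, and define $\nabla_w v|_T\in[P_r(T)]^d$ and $\nabla_w\cdot(\mathbf b v)|_T\in P_r(T)$ by $$(\nabla_w v,\boldsymbol\varphi)_T=-(v_0,\nabla\cdot\boldsymbol\varphi)_T+\langle v_b,\boldsymbol\varphi\cdot\mathbf n\rangle_{\partial T}\quad\forall\boldsymbol\varphi\in[P_r(T)]^d,$$ $$(\nabla_w\cdot(\mathbf b v),w)_T=-(\mathbf b v_0,\nabla w)_T+\langle(\mathbf b\cdot\mathbf n)v_b,w\rangle_{\partial T}\quad\forall w\in P_r(T).$$ With $\partial T^+=\{x\in\partial T:\mathbf b\cdot\mathbf n>0\}$ let $$a(u,v)=\sum_{T\in\mathcal T_h}\Big(\rho(\nabla_wu,\nabla_wv)_T+(\nabla_w\cdot(\mathbf bu),v_0)_T+\langle\mathbf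 b\cdot\mathbf n\,(u_0-u_b),v_0-v_b\rangle_{\partial T^+}+(cu_0,v_0)_T\Big).$$ Then there is exactly one $u_h\in V_h^0$ such that $a(u_h,v)=(f,v_0)$ for all $v=\{v_0,v_b\}\in V_h^0$. -/

import Mathlib

open MeasureTheory Set Filter Topology
open scoped ContDiff

noncomputable section

/-- Euclidean space `ℝ^d`. -/
abbrev Euc (d : ℕ) : Type := EuclideanSpace ℝ (Fin d)

/-! ### Weak derivatives and `W^{1,∞}` -/

/-- `g'` is the weak partial derivative `∂_i g` on the open set `Ω`. -/
structure IsWeakPartial {d : ℕ} (Ω : Set (Euc d)) (i : Fin d) (g g' : Euc d → ℝ) : Prop where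
  locallyIntegrableOn : LocallyIntegrableOn g Ω
  locallyIntegrableOn_deriv : LocallyIntegrableOn g' Ω
  integral_eq : ∀ φ : Euc d → ℝ, ContDiff ℝ ∞ φ → HasCompactSupport φ → tsupport φ ⊆ Ω →
    ∫ x in Ω, g x * fderiv ℝ φ x (EuclideanSpace.single i 1) = -∫ x in Ω, g' x * φ x

/-- `g ∈ W^{1,∞}(Ω)`: `g` and its weak first partial derivatives are in `L^∞(Ω)`. -/
def MemWOneInfty {d : ℕ} (Ω : Set (Euc d)) (g : Euc d → ℝ) : Prop :=
  MemLp g ⊤ (volume.restrict Ω) ∧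
    ∀ i : Fin d, ∃ g' : Euc d → ℝ, MemLp g' ⊤ (volume.restrict Ω) ∧ IsWeakPartial Ω i g g'

open Classical in
/-- A representative of the weak partial derivative `∂_i g` on `Ω` (weak derivatives are unique
almost everywhere; the value is `0` if there is none). -/
def weakPartial {d : ℕ} (Ω : Set (Euc d)) (i : Fin d) (g : Euc d → ℝ) : Euc d → ℝ :=
  if h : ∃ g' : Euc d → ℝ, IsWeakPartial Ω i g g' then h.choose else 0

/-- The divergence `∇ · b` on `Ω`, in the weak sense. -/
def divergence {d : ℕ} (Ω : Set (Euc d)) (b : Euc d → Euc d) (x : Euc d) : ℝ :=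
  ∑ i : Fin d, weakPartial Ω i (fun y => b y i) x

/-! ### Polytopes and polytopal partitions -/

/-- `P` is an `m`-dimensional polytope, not necessarily convex: a compact set that spans an
`m`-dimensional affine subspace, is the closure of its (connected) relative interior, and whose
relative boundary is covered by finitely many proper affine subspaces of its affine span. -/
structure IsPolytope {d : ℕ} (m : ℕ) (P : Set (Euc d)) : Prop where
  isCompact : IsCompact P
  finrank_direction : Module.finrank ℝ (affineSpan ℝ P).direction = m
  closure_intrinsicInterior : closure (intrinsicInterior ℝ P) = P
  isConnected : IsConnected (intrinsicInterior ℝ P)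
  intrinsicFrontier_subset : ∃ A : Set (AffineSubspace ℝ (Euc d)), A.Finite ∧
    (∀ H ∈ A, H < affineSpan ℝ P) ∧ intrinsicFrontier ℝ P ⊆ ⋃ H ∈ A, (H : Set (Euc d))

/-- `Ω` is a bounded polygonal (`d = 2`) or polyhedral (`d = 3`) domain: the interior of a
`d`-dimensional polytope. -/
structure IsPolytopalDomain {d : ℕ} (Ω : Set (Euc d)) : Prop where
  isPolytope : IsPolytope d (closure Ω)
  interior_closure : interior (closure Ω) = Ω

/-- A finite partition of `Ω` into (possibly nonconvex) polytopal elements, together with the set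
of its edges (`d = 2`) or faces (`d = 3`). The boundary of each element is the union of the faces
that it contains, and the relative interior of a face meets no other face; thus a long side of an
element that carries a hanging node consists of several faces. -/
structure PolytopalMesh {d : ℕ} (Ω : Set (Euc d)) where
  cells : Finset (Set (Euc d))
  faces : Finset (Set (Euc d))
  cell_isPolytope : ∀ T ∈ cells, IsPolytope d T
  face_isPolytope : ∀ e ∈ faces, IsPolytope (d - 1) e
  iUnion_cells : ⋃ T ∈ cells, T = closure Ω
  disjoint_interior : ∀ T ∈ cells, ∀ T' ∈ cells, T ≠ T' → Disjoint (interior T) (interior T')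
  frontier_cell : ∀ T ∈ cells, frontier T = ⋃ e ∈ {e | e ∈ faces ∧ e ⊆ frontier T}, e
  exists_cell : ∀ e ∈ faces, ∃ T ∈ cells, e ⊆ frontier T
  disjoint_face : ∀ e ∈ faces, ∀ e' ∈ faces, e ≠ e' → Disjoint (intrinsicInterior ℝ e) e'

/-- `n` is the unit normal to the face `e` of the element `T` that points out of `T`. -/
structure IsOutwardUnitNormal {d : ℕ} (T e : Set (Euc d)) (n : Euc d) : Prop where
  norm_eq_one : ‖n‖ = 1
  orthogonal : ∀ w ∈ (affineSpan ℝ e).direction, inner ℝ n w = 0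
  outward : ∀ x ∈ intrinsicInterior ℝ e, ∀ᶠ t : ℝ in 𝓝[>] 0,
    x - t • n ∈ interior T ∧ x + t • n ∉ T

open Classical in
/-- The outward unit normal of `T` on its face `e`. -/
def outwardNormal {d : ℕ} (T e : Set (Euc d)) : Euc d :=
  if h : ∃ n : Euc d, IsOutwardUnitNormal T e n then h.choose else 0

/-! ### Polynomials -/

/-- The value of the polynomial `p` at the point `x`. -/
def polyEval {d : ℕ} (p : MvPolynomial (Fin d) ℝ) (x : Euc d) : ℝ :=
  MvPolynomial.eval (fun i => x i) p

/-- `P_m(S)`: the functions on `S` that are polynomials of total degree at most `m`. A function on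
`S` is represented by its extension by zero. -/
def polySpace {d : ℕ} (S : Set (Euc d)) (m : ℕ) : Submodule ℝ (Euc d → ℝ) where
  carrier := {g | ∃ p : MvPolynomial (Fin d) ℝ, p.totalDegree ≤ m ∧ g = S.indicator (polyEval p)}
  zero_mem' := ⟨0, by simp, by
    funext x
    simp [polyEval, Set.indicator]⟩
  add_mem' := by
    rintro _ _ ⟨p, hp, rfl⟩ ⟨p', hp', rfl⟩
    refine ⟨p + p', (MvPolynomial.totalDegree_add p p').trans (max_le hp hp'), ?_⟩
    funext x
    by_cases hx : x ∈ S <;> simp [polyEval, hx]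
  smul_mem' := by
    rintro a _ ⟨p, hp, rfl⟩
    refine ⟨a • p, (MvPolynomial.totalDegree_smul_le a p).trans hp, ?_⟩
    funext x
    by_cases hx : x ∈ S <;> simp [polyEval, hx]

namespace PolytopalMesh

variable {d : ℕ} {Ω : Set (Euc d)}

open Classical in
/-- The faces of the element `T`. -/
def facesOf (M : PolytopalMesh Ω) (T : M.cells) : Finset M.faces :=
  Finset.univ.filter fun e => (e : Set (Euc d)) ⊆ frontier (T : Set (Euc d))

/-- Every interior face belongs to an element none of whose other faces lies in the same
hyperplane. -/
def HasNoncoplanarFaces (M : PolytopalMesh Ω) : Prop :=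
  ∀ e ∈ M.faces, ¬ e ⊆ frontier Ω → ∃ T ∈ M.cells, e ⊆ frontier T ∧
    ∀ e' ∈ M.faces, e' ⊆ frontier T → affineSpan ℝ e' = affineSpan ℝ e → e' = e

/-- Weak functions `v = {v₀, v_b}` on the mesh: `v.1 T` is `v₀` on the element `T`, and `v.2 e` is
the value of `v_b` on the face `e`, shared by all the elements that contain `e`. -/
abbrev WeakFun (M : PolytopalMesh Ω) : Type :=
  (M.cells → Euc d → ℝ) × (M.faces → Euc d → ℝ)

/-- The weak finite element space `V_h`. -/
def V (M : PolytopalMesh Ω) (k q : ℕ) : Submodule ℝ M.WeakFun :=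
  (Submodule.pi Set.univ fun T : M.cells => polySpace (T : Set (Euc d)) k).prod
    (Submodule.pi Set.univ fun e : M.faces => polySpace (e : Set (Euc d)) q)

/-- The subspace `V_h^0` of the `v ∈ V_h` with `v_b = 0` on `∂Ω`. -/
def V₀ (M : PolytopalMesh Ω) (k q : ℕ) : Submodule ℝ M.WeakFun where
  carrier := {v | v ∈ M.V k q ∧ ∀ e : M.faces, (e : Set (Euc d)) ⊆ frontier Ω → v.2 e = 0}
  zero_mem' := ⟨Submodule.zero_mem _, fun _ _ => rfl⟩
  add_mem' := fun hu hv => ⟨Submodule.add_mem _ hu.1 hv.1, fun e he => by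
    simp [hu.2 e he, hv.2 e he]⟩
  smul_mem' := fun a _ hv => ⟨Submodule.smul_mem _ a hv.1, fun e he => by
    simp [hv.2 e he]⟩

open Classical in
/-- The degree `r` on the element `T`, which has `N` faces: `k - 1 + N` if `T` is convex and
`k - 1 + 2N` if it is not. -/
def degree (M : PolytopalMesh Ω) (k : ℕ) (T : M.cells) : ℕ :=
  if Convex ℝ (T : Set (Euc d)) then k + (M.facesOf T).card - 1
  else k + 2 * (M.facesOf T).card - 1

/-- `⟨g, 1⟩_{∂T}`, for a function `g e x` of a face `e` of `T` and a point `x` of `e`. -/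
def boundaryIntegral (M : PolytopalMesh Ω) (T : M.cells) (g : M.faces → Euc d → ℝ) : ℝ :=
  ∑ e ∈ M.facesOf T, ∫ x in (e : Set (Euc d)), g e x ∂μHE[d - 1]

/-- The outward unit normal of the element `T` on its face `e`. -/
def normal (M : PolytopalMesh Ω) (T : M.cells) (e : M.faces) : Euc d :=
  outwardNormal (T : Set (Euc d)) (e : Set (Euc d))

/-- `G ∈ [P_r(T)]^d` satisfies
`(G, φ)_T = -(v₀, ∇ · φ)_T + ⟨v_b, φ · n⟩_{∂T}` for all `φ ∈ [P_r(T)]^d`. -/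
def IsWeakGradient (M : PolytopalMesh Ω) (r : ℕ) (T : M.cells) (v : M.WeakFun)
    (G : Fin d → MvPolynomial (Fin d) ℝ) : Prop :=
  (∀ i, (G i).totalDegree ≤ r) ∧
    ∀ φ : Fin d → MvPolynomial (Fin d) ℝ, (∀ i, (φ i).totalDegree ≤ r) →
      ∫ x in (T : Set (Euc d)), ∑ i, polyEval (G i) x * polyEval (φ i) x =
        -(∫ x in (T : Set (Euc d)), v.1 T x * ∑ i, polyEval (MvPolynomial.pderiv i (φ i)) x) +
          M.boundaryIntegral T fun e x => v.2 e x * ∑ i, polyEval (φ i) x * M.normal T e i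

open Classical in
/-- The discrete weak gradient `∇_{w,r,T} v`. -/
def weakGradient (M : PolytopalMesh Ω) (r : ℕ) (T : M.cells) (v : M.WeakFun) :
    Fin d → MvPolynomial (Fin d) ℝ :=
  if h : ∃ G, M.IsWeakGradient r T v G then h.choose else 0

/-- `D ∈ P_r(T)` satisfies
`(D, w)_T = -(b v₀, ∇w)_T + ⟨(b · n) v_b, w⟩_{∂T}` for all `w ∈ P_r(T)`. -/
def IsWeakDivergence (M : PolytopalMesh Ω) (b : Euc d → Euc d) (r : ℕ) (T : M.cells)
    (v : M.WeakFun) (D : MvPolynomial (Fin d) ℝ) : Prop :=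
  D.totalDegree ≤ r ∧
    ∀ w : MvPolynomial (Fin d) ℝ, w.totalDegree ≤ r →
      ∫ x in (T : Set (Euc d)), polyEval D x * polyEval w x =
        -(∫ x in (T : Set (Euc d)), ∑ i, b x i * v.1 T x * polyEval (MvPolynomial.pderiv i w) x) +
          M.boundaryIntegral T fun e x => inner ℝ (b x) (M.normal T e) * v.2 e x * polyEval w x

open Classical in
/-- The discrete weak divergence `∇_{w,r,T} · (b v)`. -/
def weakDivergence (M : PolytopalMesh Ω) (b : Euc d → Euc d) (r : ℕ) (T : M.cells)
    (v : M.WeakFun) : MvPolynomial (Fin d) ℝ :=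
  if h : ∃ D, M.IsWeakDivergence b r T v D then h.choose else 0

/-- The bilinear form
`a(u, v) = ∑_T ρ (∇_w u, ∇_w v)_T + (∇_w · (b u), v₀)_T
  + ⟨b · n (u₀ - u_b), v₀ - v_b⟩_{∂T⁺} + (c u₀, v₀)_T`,
where `∂T⁺` is the part of `∂T` on which `b · n > 0`. -/
def form (M : PolytopalMesh Ω) (ρ : ℝ) (b : Euc d → Euc d) (c : Euc d → ℝ) (k : ℕ)
    (u v : M.WeakFun) : ℝ :=
  ∑ T : M.cells,
    (ρ * (∫ x in (T : Set (Euc d)), ∑ i, polyEval (M.weakGradient (M.degree k T) T u i) x *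
        polyEval (M.weakGradient (M.degree k T) T v i) x) +
      (∫ x in (T : Set (Euc d)), polyEval (M.weakDivergence b (M.degree k T) T u) x * v.1 T x) +
      (M.boundaryIntegral T fun e =>
        {x | 0 < inner ℝ (b x) (M.normal T e)}.indicator fun x =>
          inner ℝ (b x) (M.normal T e) * (u.1 T x - u.2 e x) * (v.1 T x - v.2 e x)) +
      ∫ x in (T : Set (Euc d)), c x * u.1 T x * v.1 T x)

/-- The load functional `(f, v₀)`. -/
def load (M : PolytopalMesh Ω) (f : Euc d → ℝ) (v : M.WeakFun) : ℝ :=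
  ∑ T : M.cells, ∫ x in (T : Set (Euc d)), f x * v.1 T x

end PolytopalMesh

end

/-!
The trial and test space is finite dimensional, so the theorem reduces to the definiteness of the
form: `a(v, v) ≤ 0` forces `v = 0` (`existsUnique_of_definite`, `eq_zero_of_form_self_nonpos`).

*Coercivity.* On an element `T`, integration by parts turns the convection terms of `a(v, v)` into
`½ (∇ · b, v₀²)_T + ½ ⟨|b · n|, (v₀ - v_b)²⟩_{∂T} + ½ ⟨b · n, v_b²⟩_{∂T}` (`convection_cell`).
In the sum over the elements the last terms cancel, because `v_b` is single-valued and vanishes on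
`∂Ω`, and an interior face has exactly two elements, with opposite normals
(`sum_boundaryIntegral_eq_zero`, `exists_two_cells`). Hence
`a(v, v) ≥ ∑_T ρ ‖∇_w v‖² + c₀ ‖v₀‖²` (`coercivity`), and `a(v, v) ≤ 0` gives `v₀ = 0` and
`∇_w v = 0`.

*Face values.* If `v₀` and `∇_w v` vanish on `T`, then `⟨v_b, φ · n⟩_{∂T} = 0` for every polynomial
field `φ` of degree at most `r`. For a face `e` of `T` that is coplanar with no other face of `T`,
take `φ = v_b P n_e`, where `P` is the product over the other faces of the affine functions that
vanish on them (a convex `T` lies on one side of each face, so `P ≥ 0` on `T`), or of the squares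
of these functions if `T` is not convex. Then `⟨v_b², P⟩_e = 0`, so `v_b = 0` on `e`. The degree
`r` is just large enough for this `φ` (`face_eq_zero`).

*Green's formula.* Elements are compact sets bounded by pieces of hyperplanes, not necessarily
Lipschitz, and `b` is only weakly differentiable, so the integration by parts is derived from the
definition of the weak derivative. Near a relative interior point of a face the element is a half
ball (`exists_isHalfBallAt`), where the test function is cut off in a thin layer along the face; in
the limit the layer produces the surface integral (`green_halfBall`). A partition of unity extends
this to test functions supported away from the relative boundaries of the faces
(`greenDefect_eq_zero_of_disjoint`). These boundaries lie in finitely many affine subspaces of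
codimension two, which have zero capacity, and are removed by cut-off functions whose gradients
tend to zero in `L¹` (`exists_isCutoffSeq_codim_two`, `green`).
-/

noncomputable section

/-! ### Relative interiors and hyperplanes -/

section Geometry

variable {d : ℕ}

theorem mem_intrinsicInterior_iff_exists_ball {s : Set (Euc d)} {x : Euc d} :
    x ∈ intrinsicInterior ℝ s ↔
      x ∈ affineSpan ℝ s ∧ ∃ r > 0, ∀ y ∈ Metric.ball x r, y ∈ affineSpan ℝ s → y ∈ s := by
  rw [mem_intrinsicInterior]
  constructor
  · rintro ⟨y, hy, rfl⟩
    refine ⟨y.2, ?_⟩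
    rw [mem_interior_iff_mem_nhds, Metric.mem_nhds_iff] at hy
    obtain ⟨r, hr, h⟩ := hy
    exact ⟨r, hr, fun z hz hzs => @h ⟨z, hzs⟩ hz⟩
  · rintro ⟨hx, r, hr, h⟩
    refine ⟨⟨x, hx⟩, ?_, rfl⟩
    rw [mem_interior_iff_mem_nhds, Metric.mem_nhds_iff]
    exact ⟨r, hr, fun z hz => h z hz z.2⟩

theorem intrinsicInterior_eq_interior {s : Set (Euc d)} (hs : affineSpan ℝ s = ⊤) :
    intrinsicInterior ℝ s = interior s := by
  refine Subset.antisymm (fun x hx => ?_) interior_subset_intrinsicInterior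
  obtain ⟨-, r, hr, h⟩ := mem_intrinsicInterior_iff_exists_ball.1 hx
  rw [mem_interior_iff_mem_nhds, Metric.mem_nhds_iff]
  exact ⟨r, hr, fun z hz => h z hz (by simp [hs])⟩

theorem IsClosed.intrinsicInterior_union_frontier {s : Set (Euc d)} (hs : IsClosed s) :
    intrinsicInterior ℝ s ∪ intrinsicFrontier ℝ s = s := by
  rw [intrinsicInterior_union_intrinsicFrontier]
  exact IsClosed.intrinsicClosure (hs.preimage continuous_subtype_val)

namespace IsPolytope

variable {m : ℕ} {P T e : Set (Euc d)}

theorem nonempty_intrinsicInterior (h : IsPolytope m P) : (intrinsicInterior ℝ P).Nonempty :=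
  h.isConnected.nonempty

theorem affineSpan_eq_top (h : IsPolytope d T) : affineSpan ℝ T = ⊤ := by
  obtain ⟨x, hx⟩ := h.nonempty_intrinsicInterior
  have hx' := subset_affineSpan ℝ T (intrinsicInterior_subset hx)
  rw [← AffineSubspace.direction_eq_top_iff_of_nonempty ⟨x, hx'⟩]
  exact Submodule.eq_top_of_finrank_eq (by simp [h.finrank_direction])

theorem closure_interior (h : IsPolytope d T) : closure (interior T) = T := by
  rw [← intrinsicInterior_eq_interior h.affineSpan_eq_top, h.closure_intrinsicInterior]

theorem nonempty_interior (h : IsPolytope d T) : (interior T).Nonempty := by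
  rw [← intrinsicInterior_eq_interior h.affineSpan_eq_top]
  exact h.nonempty_intrinsicInterior

theorem volume_frontier (h : IsPolytope d T) : volume (frontier T) = 0 := by
  obtain ⟨A, hA, hlt, hsub⟩ := h.intrinsicFrontier_subset
  have hfr : frontier T ⊆ intrinsicFrontier ℝ T := by
    intro x hx
    have hxT : x ∈ T := h.isCompact.isClosed.frontier_subset hx
    rw [← h.isCompact.isClosed.intrinsicInterior_union_frontier] at hxT
    rcases hxT with hxT | hxT
    · rw [intrinsicInterior_eq_interior h.affineSpan_eq_top] at hxT
      exact absurd hxT hx.2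
    · exact hxT
  refine measure_mono_null (hfr.trans hsub) ?_
  rw [measure_biUnion_null_iff hA.countable]
  intro H hH
  refine Measure.addHaar_affineSubspace _ _ fun htop => ?_
  have := hlt H hH
  rw [h.affineSpan_eq_top, htop] at this
  exact this.false

end IsPolytope

theorem volume_frontier_closure_of_isPolytopalDomain {Ω : Set (Euc d)} (h : IsPolytopalDomain Ω) :
    volume (closure Ω \ Ω) = 0 := by
  have := h.isPolytope.volume_frontier
  rwa [frontier, closure_closure, h.interior_closure] at this

theorem IsPolytopalDomain.isOpen {Ω : Set (Euc d)} (h : IsPolytopalDomain Ω) : IsOpen Ω := by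
  rw [← h.interior_closure]
  exact isOpen_interior

theorem isPreconnected_halfBall (x n : Euc d) (r : ℝ) :
    IsPreconnected (Metric.ball x r ∩ {y | inner ℝ n (y - x) < 0}) := by
  refine Convex.isPreconnected ((convex_ball x r).inter ?_)
  have : {y | inner ℝ n (y - x) < 0} = {y | inner ℝ n y < inner ℝ n x} := by
    ext y; simp [inner_sub_right]
  rw [this]
  exact convex_halfSpace_lt (f := fun y => inner ℝ n y)
    ⟨fun a b => inner_add_right _ _ _, fun a b => real_inner_smul_right _ _ _⟩ _

/-- A preconnected set that does not meet the frontier of a closed set lies inside or outside. -/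
theorem IsPreconnected.subset_interior_or_disjoint_of_frontier {B T : Set (Euc d)}
    (hB : IsPreconnected B) (hT : IsClosed T) (h : Disjoint B (frontier T)) :
    B ⊆ interior T ∨ Disjoint B T := by
  have hsub : B ⊆ interior T ∪ Tᶜ := by
    intro y hy
    by_cases hyT : y ∈ T
    · left
      by_contra hyi
      exact Set.disjoint_left.1 h hy ⟨subset_closure hyT, hyi⟩
    · exact Or.inr hyT
  rcases B.eq_empty_or_nonempty with hne | ⟨y, hy⟩
  · left; simp [hne]
  rcases hsub hy with hyi | hyc
  · left
    exact hB.subset_left_of_subset_union isOpen_interior hT.isOpen_compl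
      (disjoint_compl_right.mono_left interior_subset) hsub ⟨y, hy, hyi⟩
  · right
    have := hB.subset_right_of_subset_union isOpen_interior hT.isOpen_compl
      (disjoint_compl_right.mono_left interior_subset) hsub ⟨y, hy, hyc⟩
    exact Set.disjoint_left.2 fun z hz => this hz

/-- A unit normal of a polytope of codimension one spans the orthogonal complement of its
direction. -/
theorem IsPolytope.exists_unit_normal (hd : 0 < d) {e : Set (Euc d)} (h : IsPolytope (d - 1) e) :
    ∃ n : Euc d, ‖n‖ = 1 ∧ ∀ w ∈ (affineSpan ℝ e).direction, inner ℝ n w = 0 := by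
  have hfin : 0 < Module.finrank ℝ ((affineSpan ℝ e).directionᗮ) := by
    have := Submodule.finrank_add_finrank_orthogonal (affineSpan ℝ e).direction
    rw [h.finrank_direction, finrank_euclideanSpace_fin] at this
    omega
  have : Nontrivial ((affineSpan ℝ e).directionᗮ) := Module.finrank_pos_iff.1 hfin
  obtain ⟨⟨n, hn⟩, hne⟩ := exists_ne (0 : (affineSpan ℝ e).directionᗮ)
  have hn0 : n ≠ 0 := fun h0 => hne (Subtype.ext h0)
  refine ⟨‖n‖⁻¹ • n, ?_, fun w hw => ?_⟩
  · rw [norm_smul, norm_inv, norm_norm, inv_mul_cancel₀ (norm_ne_zero_iff.2 hn0)]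
  · rw [real_inner_smul_left, (Submodule.mem_orthogonal' _ _).1 hn w hw, mul_zero]

theorem IsPolytope.direction_eq_orthogonal {e : Set (Euc d)} (h : IsPolytope (d - 1) e)
    {n : Euc d} (hn : ‖n‖ = 1) (horth : ∀ w ∈ (affineSpan ℝ e).direction, inner ℝ n w = 0) :
    (affineSpan ℝ e).direction = (ℝ ∙ n)ᗮ := by
  refine Submodule.eq_of_le_of_finrank_eq (fun w hw => ?_) ?_
  · rw [Submodule.mem_orthogonal_singleton_iff_inner_right]
    exact horth w hw
  · have h1 := Submodule.finrank_add_finrank_orthogonal (ℝ ∙ n)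
    rw [finrank_span_singleton (norm_ne_zero_iff.1 (by rw [hn]; exact one_ne_zero)),
      finrank_euclideanSpace_fin] at h1
    rw [h.finrank_direction]
    omega

theorem IsPolytope.mem_affineSpan_iff {e : Set (Euc d)} (h : IsPolytope (d - 1) e)
    {n : Euc d} (hn : ‖n‖ = 1) (horth : ∀ w ∈ (affineSpan ℝ e).direction, inner ℝ n w = 0)
    {x : Euc d} (hx : x ∈ affineSpan ℝ e) (y : Euc d) :
    y ∈ affineSpan ℝ e ↔ inner ℝ n (y - x) = 0 := by
  rw [← AffineSubspace.vsub_right_mem_direction_iff_mem hx, h.direction_eq_orthogonal hn horth,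
    Submodule.mem_orthogonal_singleton_iff_inner_right]
  rfl

/-! ### The mesh near a relative interior point of a face -/

/-- In the ball of radius `r` about `x`, the set `T` is the closed half ball with outward normal
`n`, and its flat boundary is the part of `e` in the ball. -/
structure IsHalfBallAt (T e : Set (Euc d)) (n x : Euc d) (r : ℝ) : Prop where
  pos : 0 < r
  lt_imp : ∀ y ∈ Metric.ball x r, inner ℝ n (y - x) < 0 → y ∈ interior T
  gt_imp : ∀ y ∈ Metric.ball x r, 0 < inner ℝ n (y - x) → y ∉ T
  eq_iff : ∀ y ∈ Metric.ball x r, y ∈ e ↔ inner ℝ n (y - x) = 0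

theorem IsHalfBallAt.eventually {T e : Set (Euc d)} {n x : Euc d} {r : ℝ}
    (h : IsHalfBallAt T e n x r) (hn : ‖n‖ = 1) :
    ∀ᶠ t : ℝ in 𝓝[>] 0, x - t • n ∈ interior T ∧ x + t • n ∉ T := by
  have hmem : Ioo (0 : ℝ) r ∈ 𝓝[>] (0 : ℝ) := Ioo_mem_nhdsGT h.pos
  filter_upwards [hmem] with t ht
  have hin : inner ℝ n n = (1 : ℝ) := by rw [real_inner_self_eq_norm_sq, hn]; norm_num
  have hnorm : ‖t • n‖ < r := by
    rw [norm_smul, hn, mul_one, Real.norm_eq_abs, abs_of_pos ht.1]; exact ht.2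
  constructor
  · apply h.lt_imp
    · rw [mem_ball_iff_norm, sub_sub_cancel_left, norm_neg]; exact hnorm
    · rw [sub_sub_cancel_left, inner_neg_right, real_inner_smul_right, hin]
      linarith [ht.1]
  · apply h.gt_imp
    · rw [mem_ball_iff_norm, add_sub_cancel_left]; exact hnorm
    · rw [add_sub_cancel_left, real_inner_smul_right, hin]
      linarith [ht.1]

theorem IsHalfBallAt.mono_radius {T e : Set (Euc d)} {n x : Euc d} {r s : ℝ}
    (h : IsHalfBallAt T e n x r) (hs : 0 < s) (hsr : s ≤ r) : IsHalfBallAt T e n x s :=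
  ⟨hs, fun y hy => h.lt_imp y (Metric.ball_subset_ball hsr hy),
    fun y hy => h.gt_imp y (Metric.ball_subset_ball hsr hy),
    fun y hy => h.eq_iff y (Metric.ball_subset_ball hsr hy)⟩

theorem IsHalfBallAt.recenter {T e : Set (Euc d)} {n x y : Euc d} {r : ℝ}
    (h : IsHalfBallAt T e n x r) (hy : y ∈ Metric.ball x r) (hye : y ∈ e) :
    ∃ s, IsHalfBallAt T e n y s := by
  have h0 := (h.eq_iff y hy).1 hye
  have key : ∀ z, inner ℝ n (z - y) = inner ℝ n (z - x) := fun z => by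
    have : z - x = (z - y) + (y - x) := by abel
    rw [this, inner_add_right, h0, add_zero]
  have hb : Metric.ball y (r - dist y x) ⊆ Metric.ball x r :=
    Metric.ball_subset_ball' (by linarith)
  refine ⟨r - dist y x, by rw [sub_pos]; exact hy, fun z hz hlt => ?_, fun z hz hlt => ?_,
    fun z hz => ?_⟩
  · exact h.lt_imp z (hb hz) (by rwa [key] at hlt)
  · exact h.gt_imp z (hb hz) (by rwa [key] at hlt)
  · rw [key]; exact h.eq_iff z (hb hz)

namespace PolytopalMesh

variable {Ω : Set (Euc d)} (M : PolytopalMesh Ω)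

/-- Near a relative interior point of a face, the face is its hyperplane and no other face is
met. -/
theorem exists_ball_faces {e : Set (Euc d)} (he : e ∈ M.faces) {x : Euc d}
    (hx : x ∈ intrinsicInterior ℝ e) :
    ∃ r > 0, (∀ y ∈ Metric.ball x r, y ∈ affineSpan ℝ e → y ∈ e) ∧
      ∀ e' ∈ M.faces, e' ≠ e → Disjoint (Metric.ball x r) e' := by
  obtain ⟨hxs, r, hr, hball⟩ := mem_intrinsicInterior_iff_exists_ball.1 hx
  have hev : ∀ᶠ y in 𝓝 x, ∀ e' ∈ M.faces, e' ≠ e → y ∉ e' := by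
    rw [Filter.eventually_all_finset]
    intro e' he'
    by_cases hne : e' = e
    · simp [hne]
    · have hclosed : IsClosed e' := (M.face_isPolytope e' he').isCompact.isClosed
      have hxe' : x ∉ e' := fun h =>
        Set.disjoint_left.1 (M.disjoint_face e he e' he' (Ne.symm hne)) hx h
      filter_upwards [hclosed.isOpen_compl.mem_nhds hxe'] with y hy _ using hy
  obtain ⟨s, hs, hball'⟩ := Metric.eventually_nhds_iff_ball.1 hev
  refine ⟨min r s, lt_min hr hs, fun y hy hys => hball y ?_ hys, fun e' he' hne => ?_⟩
  · exact Metric.ball_subset_ball (min_le_left _ _) hy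
  · exact Set.disjoint_left.2 fun y hy hye =>
      hball' y (Metric.ball_subset_ball (min_le_right _ _) hy) e' he' hne hye

/-- Near a relative interior point of one of its faces, an element is a half ball: it cannot lie
on both sides of the face, as the point would then be interior, nor on neither side, as it is the
closure of its interior. -/
theorem exists_isHalfBallAt_or {T e : Set (Euc d)} (hT : T ∈ M.cells) (he : e ∈ M.faces)
    (heT : e ⊆ frontier T) {n : Euc d} (hn : ‖n‖ = 1)
    (horth : ∀ w ∈ (affineSpan ℝ e).direction, inner ℝ n w = 0) {x : Euc d}
    (hx : x ∈ intrinsicInterior ℝ e) :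
    ∃ r, IsHalfBallAt T e n x r ∨ IsHalfBallAt T e (-n) x r := by
  obtain ⟨r, hr, hflat, hdisj⟩ := M.exists_ball_faces he hx
  have hTcl : IsClosed T := (M.cell_isPolytope T hT).isCompact.isClosed
  have hxe : x ∈ e := intrinsicInterior_subset hx
  have hxs : x ∈ affineSpan ℝ e := subset_affineSpan ℝ e hxe
  have hspan := (M.face_isPolytope e he).mem_affineSpan_iff hn horth hxs
  have heq : ∀ y ∈ Metric.ball x r, y ∈ e ↔ inner ℝ n (y - x) = 0 := fun y hy =>
    ⟨fun h => (hspan y).1 (subset_affineSpan ℝ e h), fun h => hflat y hy ((hspan y).2 h)⟩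
  have hfr : ∀ y ∈ Metric.ball x r, y ∈ frontier T → inner ℝ n (y - x) = 0 := by
    intro y hy hyT
    rw [M.frontier_cell T hT, mem_iUnion₂] at hyT
    obtain ⟨e', ⟨he', -⟩, hye'⟩ := hyT
    by_cases hne : e' = e
    · rw [hne] at hye'; exact (heq y hy).1 hye'
    · exact absurd hye' (Set.disjoint_left.1 (hdisj e' he' hne) hy)
  have halt : ∀ ν : Euc d, (ν = n ∨ ν = -n) →
      (Metric.ball x r ∩ {y | inner ℝ ν (y - x) < 0} ⊆ interior T) ∨
      Disjoint (Metric.ball x r ∩ {y | inner ℝ ν (y - x) < 0}) T := by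
    intro ν hν
    refine (isPreconnected_halfBall x ν r).subset_interior_or_disjoint_of_frontier hTcl ?_
    refine Set.disjoint_left.2 fun y hy hyT => ?_
    have h0 := hfr y hy.1 hyT
    have h1 : inner ℝ ν (y - x) < 0 := hy.2
    rcases hν with rfl | rfl
    · exact h1.ne h0
    · rw [inner_neg_left, h0, neg_zero] at h1; exact h1.false
  have hneg : ∀ y, inner ℝ (-n) (y - x) < 0 ↔ 0 < inner ℝ n (y - x) := fun y => by
    rw [inner_neg_left, neg_lt_zero]
  have hneg' : ∀ y, 0 < inner ℝ (-n) (y - x) ↔ inner ℝ n (y - x) < 0 := fun y => by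
    rw [inner_neg_left, neg_pos]
  refine ⟨r, ?_⟩
  rcases halt n (Or.inl rfl) with h1 | h1 <;> rcases halt (-n) (Or.inr rfl) with h2 | h2
  · exfalso
    have hxfr := heT hxe
    refine hxfr.2 ?_
    have hTball : Metric.ball x r ⊆ T := by
      intro y hy
      rcases lt_trichotomy (inner ℝ n (y - x)) 0 with h | h | h
      · exact interior_subset (h1 ⟨hy, h⟩)
      · exact hTcl.frontier_subset (heT ((heq y hy).2 h))
      · exact interior_subset (h2 ⟨hy, (hneg y).2 h⟩)
    rw [mem_interior_iff_mem_nhds]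
    exact mem_of_superset (Metric.ball_mem_nhds x hr) hTball
  · left
    exact ⟨hr, fun y hy h => h1 ⟨hy, h⟩,
      fun y hy h hyT => Set.disjoint_left.1 h2 ⟨hy, (hneg y).2 h⟩ hyT, heq⟩
  · right
    exact ⟨hr, fun y hy h => h2 ⟨hy, h⟩,
      fun y hy h hyT => Set.disjoint_left.1 h1 ⟨hy, (hneg' y).1 h⟩ hyT, fun y hy => by
        rw [heq y hy, inner_neg_left, neg_eq_zero]⟩
  · exfalso
    have hxT : x ∈ closure (interior T) := by
      rw [(M.cell_isPolytope T hT).closure_interior]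
      exact hTcl.frontier_subset (heT hxe)
    obtain ⟨y, hyb, hyi⟩ := mem_closure_iff.1 hxT _ Metric.isOpen_ball (Metric.mem_ball_self hr)
    rcases lt_trichotomy (inner ℝ n (y - x)) 0 with h | h | h
    · exact Set.disjoint_left.1 h1 ⟨hyb, h⟩ (interior_subset hyi)
    · exact (heT ((heq y hyb).2 h)).2 hyi
    · exact Set.disjoint_left.1 h2 ⟨hyb, (hneg y).2 h⟩ (interior_subset hyi)

/-- An element does not lie on both sides of a face. -/
theorem not_isHalfBallAt_neg {T e : Set (Euc d)} {n x : Euc d} {r s : ℝ} (hn : ‖n‖ = 1)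
    (h : IsHalfBallAt T e n x r) (h' : IsHalfBallAt T e (-n) x s) : False := by
  obtain ⟨t, h1, h2⟩ := ((h.eventually hn).and (h'.eventually (by rwa [norm_neg]))).exists
  refine h2.2 ?_
  rw [smul_neg, ← sub_eq_add_neg]
  exact interior_subset h1.1

/-- The side of a face on which an element lies does not depend on the point of the face, as the
relative interior of the face is connected. -/
theorem exists_isOutwardUnitNormal (hd : 0 < d) {T e : Set (Euc d)} (hT : T ∈ M.cells)
    (he : e ∈ M.faces) (heT : e ⊆ frontier T) : ∃ n, IsOutwardUnitNormal T e n := by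
  obtain ⟨n, hn, horth⟩ := (M.face_isPolytope e he).exists_unit_normal hd
  have hor := fun x hx => M.exists_isHalfBallAt_or hT he heT hn horth (x := x) hx
  -- the points of the face with outward normal `n` or `-n` are covered by two open sets, which do
  -- not meet on the face
  let U : Euc d → Set (Euc d) := fun ν =>
    ⋃ p ∈ {p : Euc d × ℝ | p.1 ∈ intrinsicInterior ℝ e ∧ IsHalfBallAt T e ν p.1 p.2},
      Metric.ball p.1 p.2
  have hUo : ∀ ν, IsOpen (U ν) := fun ν =>
    isOpen_biUnion fun p _ => Metric.isOpen_ball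
  have hUmem : ∀ ν x, x ∈ intrinsicInterior ℝ e → (x ∈ U ν ↔ ∃ r, IsHalfBallAt T e ν x r) := by
    intro ν x hx
    simp only [U, mem_iUnion₂]
    constructor
    · rintro ⟨⟨p, r⟩, ⟨hp, hpr⟩, hxp⟩
      exact hpr.recenter hxp (intrinsicInterior_subset hx)
    · rintro ⟨r, hr⟩
      exact ⟨(x, r), ⟨hx, hr⟩, Metric.mem_ball_self hr.pos⟩
  have hcov : intrinsicInterior ℝ e ⊆ U n ∪ U (-n) := by
    intro x hx
    obtain ⟨r, hr | hr⟩ := hor x hx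
    · exact Or.inl ((hUmem n x hx).2 ⟨r, hr⟩)
    · exact Or.inr ((hUmem (-n) x hx).2 ⟨r, hr⟩)
  have key : ∀ ν, ‖ν‖ = 1 → (∀ w ∈ (affineSpan ℝ e).direction, inner ℝ ν w = 0) →
      (∀ x ∈ intrinsicInterior ℝ e, x ∈ U ν) → IsOutwardUnitNormal T e ν := by
    intro ν hν ho h
    refine ⟨hν, ho, fun x hx => ?_⟩
    obtain ⟨r, hr⟩ := (hUmem ν x hx).1 (h x hx)
    exact hr.eventually hν
  have hconn := (M.face_isPolytope e he).isConnected.isPreconnected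
  by_cases hne : (intrinsicInterior ℝ e ∩ U (-n)).Nonempty
  · refine ⟨-n, key (-n) (by rwa [norm_neg]) (fun w hw => by
      rw [inner_neg_left, horth w hw, neg_zero]) fun x hx => ?_⟩
    by_contra hxn
    have hx' : x ∈ U n := (hcov hx).resolve_right hxn
    obtain ⟨z, hz, hz1, hz2⟩ := hconn (U n) (U (-n)) (hUo _) (hUo _) hcov ⟨x, hx, hx'⟩ hne
    obtain ⟨r, hr⟩ := (hUmem n z hz).1 hz1
    obtain ⟨s, hs⟩ := (hUmem (-n) z hz).1 hz2
    exact not_isHalfBallAt_neg hn hr hs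
  · refine ⟨n, key n hn horth fun x hx => (hcov hx).resolve_right fun h => hne ⟨x, hx, h⟩⟩

theorem exists_isHalfBallAt {T e : Set (Euc d)} (hT : T ∈ M.cells) (he : e ∈ M.faces)
    (heT : e ⊆ frontier T) {n : Euc d} (hn : IsOutwardUnitNormal T e n) {x : Euc d}
    (hx : x ∈ intrinsicInterior ℝ e) : ∃ r, IsHalfBallAt T e n x r := by
  obtain ⟨r, hr | hr⟩ := M.exists_isHalfBallAt_or hT he heT hn.norm_eq_one hn.orthogonal hx
  · exact ⟨r, hr⟩
  · exfalso
    have h1 := hr.eventually (by rw [norm_neg]; exact hn.norm_eq_one)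
    obtain ⟨t, h1, h2⟩ := (h1.and (hn.outward x hx)).exists
    refine h2.2 ?_
    have := interior_subset h1.1
    rwa [smul_neg, sub_neg_eq_add] at this

theorem mem_facesOf {T : M.cells} {e : M.faces} :
    e ∈ M.facesOf T ↔ (e : Set (Euc d)) ⊆ frontier (T : Set (Euc d)) := by
  simp [facesOf]

theorem isOutwardUnitNormal_normal (hd : 0 < d) {T : M.cells} {e : M.faces}
    (he : e ∈ M.facesOf T) :
    IsOutwardUnitNormal (T : Set (Euc d)) (e : Set (Euc d)) (M.normal T e) := by
  have h := M.exists_isOutwardUnitNormal hd T.2 e.2 (M.mem_facesOf.1 he)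
  rw [normal, outwardNormal, dif_pos h]
  exact h.choose_spec

/-- A convex element lies on one side of the hyperplane of each of its faces. -/
theorem inner_normal_nonpos_of_convex (hd : 0 < d) {T : M.cells} {e : M.faces}
    (he : e ∈ M.facesOf T) (hconv : Convex ℝ (T : Set (Euc d))) {x y : Euc d}
    (hx : x ∈ intrinsicInterior ℝ (e : Set (Euc d))) (hy : y ∈ (T : Set (Euc d))) :
    inner ℝ (M.normal T e) (y - x) ≤ 0 := by
  have hN := M.isOutwardUnitNormal_normal hd he
  obtain ⟨r, hr⟩ := M.exists_isHalfBallAt T.2 e.2 (M.mem_facesOf.1 he) hN hx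
  by_contra! hpos
  have hTcl : IsClosed (T : Set (Euc d)) := (M.cell_isPolytope T T.2).isCompact.isClosed
  have hxT : x ∈ (T : Set (Euc d)) :=
    hTcl.frontier_subset (M.mem_facesOf.1 he (intrinsicInterior_subset hx))
  obtain ⟨s, hs0, hs1⟩ : ∃ s : ℝ, 0 < s ∧ s ≤ 1 ∧ s * ‖y - x‖ < r := by
    refine ⟨min 1 (r / (2 * (‖y - x‖ + 1))), lt_min one_pos (by have := hr.pos; positivity),
      min_le_left _ _, ?_⟩
    have hpos' : 0 < ‖y - x‖ + 1 := by positivity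
    calc min 1 (r / (2 * (‖y - x‖ + 1))) * ‖y - x‖
        ≤ r / (2 * (‖y - x‖ + 1)) * ‖y - x‖ :=
          mul_le_mul_of_nonneg_right (min_le_right _ _) (norm_nonneg _)
      _ ≤ r / (2 * (‖y - x‖ + 1)) * (‖y - x‖ + 1) := by
          have := hr.pos
          gcongr
          linarith
      _ = r / 2 := by field_simp
      _ < r := by linarith [hr.pos]
  have hmem : x + s • (y - x) ∈ (T : Set (Euc d)) :=
    hconv.add_smul_sub_mem hxT hy ⟨hs0.le, hs1.1⟩
  refine hr.gt_imp (x + s • (y - x)) ?_ ?_ hmem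
  · rw [mem_ball_iff_norm, add_sub_cancel_left, norm_smul, Real.norm_eq_abs, abs_of_pos hs0]
    exact hs1.2
  · rw [add_sub_cancel_left, real_inner_smul_right]
    positivity

/-- A face that is not contained in `∂Ω` belongs to exactly two elements, which lie on opposite
sides of it. -/
theorem exists_two_cells (hd : 0 < d) (hΩ : IsPolytopalDomain Ω) (e : M.faces)
    (he : ¬ (e : Set (Euc d)) ⊆ frontier Ω) :
    ∃ T₁ T₂ : M.cells, T₁ ≠ T₂ ∧ (∀ T, e ∈ M.facesOf T ↔ T = T₁ ∨ T = T₂) ∧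
      M.normal T₂ e = -M.normal T₁ e := by
  have hPe := M.face_isPolytope e e.2
  obtain ⟨T, hT, heT⟩ := M.exists_cell e e.2
  have hcellsub : ∀ T ∈ M.cells, T ⊆ closure Ω := fun T hT => by
    rw [← M.iUnion_cells]; exact subset_biUnion_of_mem (u := fun T => T) hT
  have hcl : ∀ T ∈ M.cells, IsClosed T := fun T hT => (M.cell_isPolytope T hT).isCompact.isClosed
  -- a relative interior point of the face that lies in the domain
  obtain ⟨x, hx, hxΩ⟩ : ∃ x ∈ intrinsicInterior ℝ (e : Set (Euc d)), x ∈ Ω := by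
    by_contra! hcon
    refine he ?_
    rw [← hPe.closure_intrinsicInterior]
    refine closure_minimal (fun x hx => ?_) isClosed_frontier
    refine ⟨hcellsub T hT ((hcl T hT).frontier_subset (heT (intrinsicInterior_subset hx))), ?_⟩
    rw [hΩ.isOpen.interior_eq]
    exact hcon x hx
  let T₁ : M.cells := ⟨T, hT⟩
  have he₁ : e ∈ M.facesOf T₁ := M.mem_facesOf.2 heT
  have hN₁ := M.isOutwardUnitNormal_normal hd he₁
  set n := M.normal T₁ e with hn
  obtain ⟨r₁, hr₁⟩ := M.exists_isHalfBallAt T₁.2 e.2 heT hN₁ hx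
  obtain ⟨r₂, hr₂, -, hdisj⟩ := M.exists_ball_faces e.2 hx
  obtain ⟨r₃, hr₃, hballΩ⟩ := Metric.isOpen_iff.1 hΩ.isOpen x hxΩ
  have hnn : inner ℝ n n = (1 : ℝ) := by
    rw [real_inner_self_eq_norm_sq, hN₁.norm_eq_one]; norm_num
  have hxe : x ∈ (e : Set (Euc d)) := intrinsicInterior_subset hx
  -- points just across the face belong to a second element
  have hcross : ∃ T' ∈ M.cells, ∀ δ > 0, ∃ t : ℝ, 0 < t ∧ t < δ ∧ x + t • n ∈ T' := by
    by_contra! hcon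
    choose! δ hδ hδ' using hcon
    have hev : ∀ᶠ t : ℝ in 𝓝[>] 0, (∀ T' ∈ M.cells, x + t • n ∉ T') ∧ t < r₃ ∧ 0 < t := by
      refine Filter.Eventually.and ?_ ?_
      · rw [Filter.eventually_all_finset]
        intro T' hT'
        filter_upwards [Ioo_mem_nhdsGT (hδ T' hT')] with t ht using hδ' T' hT' t ht.1 ht.2
      · filter_upwards [Ioo_mem_nhdsGT hr₃] with t ht using ⟨ht.2, ht.1⟩
    obtain ⟨t, ht, htr, ht0⟩ := hev.exists
    have : x + t • n ∈ Ω := hballΩ (by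
      rw [mem_ball_iff_norm, add_sub_cancel_left, norm_smul, hN₁.norm_eq_one, mul_one,
        Real.norm_eq_abs, abs_of_pos ht0]
      exact htr)
    have := subset_closure this
    rw [← M.iUnion_cells, mem_iUnion₂] at this
    obtain ⟨T', hT', hmem⟩ := this
    exact ht T' hT' hmem
  obtain ⟨T', hT', hclose⟩ := hcross
  have hxT' : x ∈ T' := by
    have hcl' : x ∈ closure T' := by
      rw [Metric.mem_closure_iff]
      intro ε hε
      obtain ⟨t, ht0, htε, hmem⟩ := hclose ε hε
      refine ⟨_, hmem, ?_⟩
      rw [dist_self_add_right, norm_smul, hN₁.norm_eq_one, mul_one, Real.norm_eq_abs,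
        abs_of_pos ht0]
      exact htε
    rwa [(hcl T' hT').closure_eq] at hcl'
  have hTT' : T ≠ T' := by
    rintro rfl
    obtain ⟨t, ht0, htr, hmem⟩ := hclose r₁ hr₁.pos
    refine hr₁.gt_imp (x + t • n) ?_ ?_ hmem
    · rw [mem_ball_iff_norm, add_sub_cancel_left, norm_smul, hN₁.norm_eq_one, mul_one,
        Real.norm_eq_abs, abs_of_pos ht0]
      exact htr
    · rw [add_sub_cancel_left, real_inner_smul_right, hnn, mul_one]; exact ht0
  have hxfr : x ∈ frontier T' := by
    refine ⟨subset_closure hxT', fun hxi => ?_⟩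
    have hxT : x ∈ closure (interior T) := by
      rw [(M.cell_isPolytope T hT).closure_interior]
      exact (hcl T hT).frontier_subset (heT hxe)
    obtain ⟨y, hy1, hy2⟩ := mem_closure_iff.1 hxT _ isOpen_interior hxi
    exact Set.disjoint_left.1 (M.disjoint_interior T hT T' hT' hTT') hy2 hy1
  have heT' : (e : Set (Euc d)) ⊆ frontier T' := by
    rw [M.frontier_cell T' hT', mem_iUnion₂] at hxfr
    obtain ⟨e', ⟨he', hsub⟩, hxe'⟩ := hxfr
    by_cases hne : e' = e
    · rwa [hne] at hsub
    · exact absurd hxe' (Set.disjoint_left.1 (hdisj e' he' hne) (Metric.mem_ball_self hr₂))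
  let T₂ : M.cells := ⟨T', hT'⟩
  -- two distinct elements cannot lie on the same side
  have hside : ∀ S₁ S₂ : M.cells, S₁ ≠ S₂ → ∀ ν : Euc d, ‖ν‖ = 1 → ∀ s₁ s₂,
      IsHalfBallAt (S₁ : Set (Euc d)) e ν x s₁ → IsHalfBallAt (S₂ : Set (Euc d)) e ν x s₂ →
      False := by
    intro S₁ S₂ hne ν hν s₁ s₂ h₁ h₂
    obtain ⟨t, h1, h2⟩ := ((h₁.eventually hν).and (h₂.eventually hν)).exists
    exact Set.disjoint_left.1 (M.disjoint_interior S₁ S₁.2 S₂ S₂.2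
      fun h => hne (Subtype.ext h)) h1.1 h2.1
  have hhalf : ∀ S : M.cells, e ∈ M.facesOf S → ∃ r,
      IsHalfBallAt (S : Set (Euc d)) e n x r ∨ IsHalfBallAt (S : Set (Euc d)) e (-n) x r :=
    fun S hS => M.exists_isHalfBallAt_or S.2 e.2 (M.mem_facesOf.1 hS) hN₁.norm_eq_one
      hN₁.orthogonal hx
  have he₂ : e ∈ M.facesOf T₂ := M.mem_facesOf.2 heT'
  have h12 : T₁ ≠ T₂ := fun h => hTT' (congrArg Subtype.val h)
  have hnorm' : ‖-n‖ = 1 := by rw [norm_neg]; exact hN₁.norm_eq_one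
  obtain ⟨s₂, hs₂⟩ : ∃ r, IsHalfBallAt (T₂ : Set (Euc d)) e (-n) x r := by
    obtain ⟨s, hs | hs⟩ := hhalf T₂ he₂
    · exact (hside T₁ T₂ h12 n hN₁.norm_eq_one _ _ hr₁ hs).elim
    · exact ⟨s, hs⟩
  refine ⟨T₁, T₂, h12, fun S => ⟨fun hS => ?_, ?_⟩, ?_⟩
  · by_contra! hcon
    obtain ⟨s, hs | hs⟩ := hhalf S hS
    · exact hside S T₁ hcon.1 n hN₁.norm_eq_one _ _ hs hr₁
    · exact hside S T₂ hcon.2 (-n) hnorm' _ _ hs hs₂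
  · rintro (rfl | rfl)
    · exact he₁
    · exact he₂
  · have hN₂ := M.isOutwardUnitNormal_normal hd he₂
    obtain ⟨r₄, hr₄⟩ := M.exists_isHalfBallAt T₂.2 e.2 heT' hN₂ hx
    -- both normals are orthogonal to the hyperplane of the face
    have hmem : M.normal T₂ e ∈ ((ℝ ∙ n)ᗮ)ᗮ := by
      rw [← hPe.direction_eq_orthogonal hN₁.norm_eq_one hN₁.orthogonal,
        Submodule.mem_orthogonal']
      exact hN₂.orthogonal
    rw [Submodule.orthogonal_orthogonal, Submodule.mem_span_singleton] at hmem
    obtain ⟨a, ha⟩ := hmem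
    have habs : |a| = 1 := by
      have := hN₂.norm_eq_one
      rwa [← ha, norm_smul, hN₁.norm_eq_one, mul_one, Real.norm_eq_abs] at this
    rcases (abs_eq one_pos.le).1 habs with h | h
    · rw [h, one_smul] at ha
      rw [← ha] at hr₄
      exact (hside T₁ T₂ h12 n hN₁.norm_eq_one _ _ hr₁ hr₄).elim
    · rw [← ha, h, neg_smul, one_smul]

theorem facesOf_nonempty (hd : 0 < d) (T : M.cells) : (M.facesOf T).Nonempty := by
  have hP := M.cell_isPolytope T T.2
  have hfr : (frontier (T : Set (Euc d))).Nonempty := by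
    have : Nonempty (Fin d) := ⟨⟨0, hd⟩⟩
    have : Nontrivial (Euc d) := inferInstance
    refine nonempty_frontier_iff.2 ⟨hP.nonempty_interior.mono interior_subset, fun h => ?_⟩
    exact noncompact_univ (Euc d) (h ▸ hP.isCompact)
  obtain ⟨x, hx⟩ := hfr
  rw [M.frontier_cell T T.2, mem_iUnion₂] at hx
  obtain ⟨e, ⟨he, hsub⟩, -⟩ := hx
  exact ⟨⟨e, he⟩, M.mem_facesOf.2 hsub⟩

end PolytopalMesh

end Geometry

/-! ### Orthogonal coordinates about a hyperplane -/

section Charts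

variable {d : ℕ}

theorem isometry_add_const_orthogonal (n x : Euc d) :
    Isometry (fun z : (ℝ ∙ n)ᗮ => (z : Euc d) + x) :=
  fun a b => by simp [edist_add_right, Subtype.edist_eq]

theorem range_add_const_orthogonal (n x : Euc d) :
    range (fun z : (ℝ ∙ n)ᗮ => (z : Euc d) + x) = {y | inner ℝ n (y - x) = 0} := by
  ext y
  constructor
  · rintro ⟨z, rfl⟩
    simpa using Submodule.mem_orthogonal_singleton_iff_inner_right.1 z.2
  · intro hy
    exact ⟨⟨y - x, Submodule.mem_orthogonal_singleton_iff_inner_right.2 hy⟩, by simp⟩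

theorem finrank_orthogonal_of_norm_eq_one {n : Euc d} (hn : ‖n‖ = 1) :
    Module.finrank ℝ (ℝ ∙ n)ᗮ = d - 1 := by
  have h1 := Submodule.finrank_add_finrank_orthogonal (ℝ ∙ n)
  rw [finrank_span_singleton (norm_ne_zero_iff.1 (by rw [hn]; exact one_ne_zero)),
    finrank_euclideanSpace_fin] at h1
  omega

/-- The surface measure on a hyperplane is the Lebesgue measure of its direction. -/
theorem map_volume_orthogonal {n : Euc d} (hn : ‖n‖ = 1) (x : Euc d) :
    Measure.map (fun z : (ℝ ∙ n)ᗮ => (z : Euc d) + x) volume =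
      (μHE[d - 1]).restrict {y | inner ℝ n (y - x) = 0} := by
  rw [← range_add_const_orthogonal,
    ← (isometry_add_const_orthogonal n x).map_euclideanHausdorffMeasure,
    ← finrank_orthogonal_of_norm_eq_one hn, InnerProductSpace.euclideanHausdorffMeasure_eq_volume]

theorem measurableEmbedding_add_const_orthogonal (n x : Euc d) :
    MeasurableEmbedding (fun z : (ℝ ∙ n)ᗮ => (z : Euc d) + x) :=
  (isometry_add_const_orthogonal n x).isClosedEmbedding.measurableEmbedding

/-- Fubini's theorem for the coordinates along and orthogonal to a unit vector. -/
theorem measurePreserving_add_smul_add {n : Euc d} (hn : ‖n‖ = 1) (x : Euc d) :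
    MeasurePreserving (fun p : ℝ × (ℝ ∙ n)ᗮ => (p.2 : Euc d) + p.1 • n + x)
      (volume.prod volume) volume := by
  have h1 := ((ℝ ∙ n).measurePreserving_measurableEquivProd x).symm
  rw [InnerProductSpace.euclideanHausdorffMeasure_eq_volume] at h1
  have h2 := (LinearIsometryEquiv.toSpanUnitSingleton n hn).measurePreserving
  have h3 := h1.comp (h2.prod (MeasurePreserving.id (volume : Measure (ℝ ∙ n)ᗮ)))
  have heq : (fun p : ℝ × (ℝ ∙ n)ᗮ => (p.2 : Euc d) + p.1 • n + x) =
      ((ℝ ∙ n).measurableEquivProd x).symm ∘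
        Prod.map (LinearIsometryEquiv.toSpanUnitSingleton n hn) id := by
    funext p
    simp [add_comm]
  rw [heq]
  exact h3

theorem norm_le_norm_add_smul_orthogonal {n : Euc d} (z : (ℝ ∙ n)ᗮ) (t : ℝ) :
    ‖(z : Euc d)‖ ≤ ‖(z : Euc d) + t • n‖ := by
  have h0 : inner ℝ n (z : Euc d) = 0 := Submodule.mem_orthogonal_singleton_iff_inner_right.1 z.2
  have h := norm_add_sq_eq_norm_sq_add_norm_sq_real (x := (z : Euc d)) (y := t • n)
    (by rw [real_inner_smul_right, real_inner_comm, h0, mul_zero])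
  refine le_of_sq_le_sq ?_ (norm_nonneg _)
  nlinarith [mul_self_nonneg ‖t • n‖]

end Charts

/-! ### Green's formula near a relative interior point of a face -/

section Layer

variable {d : ℕ}

/-- A smooth function of one variable that is `1` on `(-∞, -2]` and `0` on `[-1, ∞)`. -/
def stepDown (t : ℝ) : ℝ := Real.smoothTransition (-1 - t)

theorem contDiff_stepDown : ContDiff ℝ ∞ stepDown :=
  Real.smoothTransition.contDiff.comp (contDiff_const.sub contDiff_id)

theorem stepDown_of_le {t : ℝ} (ht : t ≤ -2) : stepDown t = 1 :=
  Real.smoothTransition.one_of_one_le (by linarith)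

theorem stepDown_of_ge {t : ℝ} (ht : -1 ≤ t) : stepDown t = 0 :=
  Real.smoothTransition.zero_of_nonpos (by linarith)

theorem stepDown_nonneg (t : ℝ) : 0 ≤ stepDown t := Real.smoothTransition.nonneg _

theorem stepDown_le_one (t : ℝ) : stepDown t ≤ 1 := Real.smoothTransition.le_one _

theorem hasDerivAt_stepDown (t : ℝ) : HasDerivAt stepDown (deriv stepDown t) t :=
  (contDiff_stepDown.differentiable (by simp)).differentiableAt.hasDerivAt

theorem continuous_deriv_stepDown : Continuous (deriv stepDown) :=
  contDiff_stepDown.continuous_deriv (by simp)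

theorem hasCompactSupport_deriv_stepDown : HasCompactSupport (deriv stepDown) := by
  refine HasCompactSupport.intro (isCompact_Icc (a := (-2 : ℝ)) (b := -1)) fun t ht => ?_
  rw [mem_Icc, not_and_or, not_le, not_le] at ht
  rcases ht with ht | ht
  · have : stepDown =ᶠ[𝓝 t] fun _ => 1 := by
      filter_upwards [Iio_mem_nhds ht] with s hs using stepDown_of_le (le_of_lt hs)
    rw [this.deriv_eq, deriv_const]
  · have : stepDown =ᶠ[𝓝 t] fun _ => 0 := by
      filter_upwards [Ioi_mem_nhds ht] with s hs using stepDown_of_ge (le_of_lt hs)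
    rw [this.deriv_eq, deriv_const]

theorem integral_deriv_stepDown : ∫ t, deriv stepDown t = -1 := by
  have h := integral_of_hasDerivAt_of_tendsto (f := stepDown) (m := 1) (n := 0)
    hasDerivAt_stepDown
    (continuous_deriv_stepDown.integrable_of_hasCompactSupport hasCompactSupport_deriv_stepDown)
    (tendsto_const_nhds.congr' ?_) (tendsto_const_nhds.congr' ?_)
  · rw [h]; norm_num
  · filter_upwards [Iic_mem_atBot (-2 : ℝ)] with t ht using (stepDown_of_le ht).symm
  · filter_upwards [Ici_mem_atTop (-1 : ℝ)] with t ht using (stepDown_of_ge ht).symm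

/-- The derivatives of the rescaled steps are an approximation of `-δ₀`. -/
theorem tendsto_integral_deriv_stepDown_mul {Φ : ℝ → ℝ} (hΦ : Continuous Φ) {C : ℝ}
    (hC : ∀ t, |Φ t| ≤ C) :
    Tendsto (fun ε : ℝ => ∫ t, ε⁻¹ * deriv stepDown (ε⁻¹ * t) * Φ t) (𝓝[>] 0) (𝓝 (-Φ 0)) := by
  have hint := continuous_deriv_stepDown.integrable_of_hasCompactSupport
    hasCompactSupport_deriv_stepDown (μ := volume)
  have h1 : Tendsto (fun ε : ℝ => ∫ s, deriv stepDown s * Φ (ε * s)) (𝓝[>] 0)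
      (𝓝 (∫ s, deriv stepDown s * Φ 0)) := by
    refine tendsto_integral_filter_of_dominated_convergence (fun s => ‖deriv stepDown s‖ * C)
      ?_ ?_ (hint.norm.mul_const C) ?_
    · exact Eventually.of_forall fun ε => (continuous_deriv_stepDown.mul
        (hΦ.comp (continuous_const.mul continuous_id))).aestronglyMeasurable
    · refine Eventually.of_forall fun ε => Eventually.of_forall fun s => ?_
      rw [norm_mul]
      exact mul_le_mul_of_nonneg_left (hC _) (norm_nonneg _)
    · refine Eventually.of_forall fun s => ?_
      refine Tendsto.const_mul _ ?_
      have : Tendsto (fun ε : ℝ => Φ (ε * s)) (𝓝 0) (𝓝 (Φ (0 * s))) :=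
        (hΦ.comp (continuous_id.mul continuous_const)).tendsto 0
      rw [zero_mul] at this
      exact this.mono_left nhdsWithin_le_nhds
  rw [integral_mul_const, integral_deriv_stepDown, neg_one_mul] at h1
  refine h1.congr' ?_
  filter_upwards [self_mem_nhdsWithin] with ε hε
  have hε : (0 : ℝ) < ε := hε
  have := Measure.integral_comp_mul_left (fun s => deriv stepDown s * Φ (ε * s)) ε⁻¹
  rw [inv_inv, abs_of_pos hε, smul_eq_mul] at this
  rw [← mul_right_inj' hε.ne', ← this, ← integral_const_mul]
  refine integral_congr_ae (Eventually.of_forall fun t => ?_)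
  simp only [mul_inv_cancel_left₀ hε.ne']
  field_simp

/-- For a continuous `F` with compact support, the integrals of `F` against the normal derivatives
of the rescaled steps converge to the integral over the hyperplane. -/
theorem tendsto_integral_layer {n : Euc d} (hn : ‖n‖ = 1) (x : Euc d) {F : Euc d → ℝ}
    (hF : Continuous F) (hFc : HasCompactSupport F) :
    Tendsto (fun ε : ℝ => ∫ y, ε⁻¹ * deriv stepDown (ε⁻¹ * inner ℝ n (y - x)) * F y) (𝓝[>] 0)
      (𝓝 (-∫ y in {y | inner ℝ n (y - x) = 0}, F y ∂μHE[d - 1])) := by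
  obtain ⟨C, hC⟩ := hFc.exists_bound_of_continuous hF
  obtain ⟨R, hR⟩ : ∃ R, ∀ y, R < ‖y - x‖ → F y = 0 := by
    obtain ⟨R, hR⟩ := hFc.isCompact.isBounded.subset_closedBall x
    refine ⟨R, fun y hy => ?_⟩
    by_contra hne
    have := hR (subset_tsupport F hne)
    rw [mem_closedBall_iff_norm] at this
    exact absurd this (not_le.2 hy)
  -- the integral of `F` over the parallel hyperplane at signed distance `t`
  let Φ : ℝ → ℝ := fun t => ∫ z : (ℝ ∙ n)ᗮ, F ((z : Euc d) + t • n + x)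
  have hbound : ∀ (t : ℝ) (z : (ℝ ∙ n)ᗮ), ‖F ((z : Euc d) + t • n + x)‖ ≤
      (Metric.closedBall (0 : (ℝ ∙ n)ᗮ) R).indicator (fun _ => C) z := by
    intro t z
    by_cases hz : z ∈ Metric.closedBall (0 : (ℝ ∙ n)ᗮ) R
    · rw [indicator_of_mem hz]; exact hC _
    · rw [indicator_of_notMem hz, hR, norm_zero]
      rw [add_sub_cancel_right]
      rw [mem_closedBall_zero_iff, not_le] at hz
      exact lt_of_lt_of_le hz (norm_le_norm_add_smul_orthogonal z t)
  have hbint : Integrable ((Metric.closedBall (0 : (ℝ ∙ n)ᗮ) R).indicator fun _ => C) :=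
    (integrable_indicator_iff Metric.isClosed_closedBall.measurableSet).2
      (integrableOn_const (isCompact_closedBall _ _).measure_lt_top.ne)
  have hcont : ∀ t : ℝ, Continuous fun z : (ℝ ∙ n)ᗮ => F ((z : Euc d) + t • n + x) :=
    fun t => by fun_prop
  have hΦ : Continuous Φ := by
    refine continuous_of_dominated (fun t => (hcont t).aestronglyMeasurable)
      (fun t => Eventually.of_forall (hbound t)) hbint (Eventually.of_forall fun z => ?_)
    fun_prop
  have hΦb : ∀ t, |Φ t| ≤ ∫ z, (Metric.closedBall (0 : (ℝ ∙ n)ᗮ) R).indicator (fun _ => C) z :=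
    fun t => norm_integral_le_of_norm_le hbint (Eventually.of_forall (hbound t))
  have h0 : ∫ y in {y | inner ℝ n (y - x) = 0}, F y ∂μHE[d - 1] = Φ 0 := by
    rw [← map_volume_orthogonal hn, (measurableEmbedding_add_const_orthogonal n x).integral_map]
    simp [Φ]
  rw [h0]
  refine (tendsto_integral_deriv_stepDown_mul hΦ hΦb).congr fun ε => ?_
  have hmp := measurePreserving_add_smul_add hn x
  have hcontI : Continuous fun y => ε⁻¹ * deriv stepDown (ε⁻¹ * inner ℝ n (y - x)) * F y := by
    have := continuous_deriv_stepDown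
    fun_prop
  have hintI : Integrable fun y => ε⁻¹ * deriv stepDown (ε⁻¹ * inner ℝ n (y - x)) * F y :=
    hcontI.integrable_of_hasCompactSupport hFc.mul_left
  have hin : ∀ p : ℝ × (ℝ ∙ n)ᗮ, inner ℝ n ((p.2 : Euc d) + p.1 • n + x - x) = p.1 := fun p => by
    rw [add_sub_cancel_right, inner_add_right, real_inner_smul_right, real_inner_self_eq_norm_sq,
      hn, Submodule.mem_orthogonal_singleton_iff_inner_right.1 p.2.2]
    norm_num
  have hsurj := hmp.map_eq
  rw [← hsurj, integral_map hmp.measurable.aemeasurable hcontI.aestronglyMeasurable]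
  rw [← hsurj] at hintI
  have hint2 := (integrable_map_measure hcontI.aestronglyMeasurable
    hmp.measurable.aemeasurable).1 hintI
  refine Eq.trans ?_ (integral_prod _ hint2).symm
  refine integral_congr_ae (Eventually.of_forall fun t => ?_)
  simp only [Φ, Function.comp_apply]
  rw [← integral_const_mul]
  refine integral_congr_ae (Eventually.of_forall fun z => ?_)
  simp only
  rw [hin (t, z)]

end Layer

section HalfBall

variable {d : ℕ} {Ω T e : Set (Euc d)} {n x : Euc d} {r : ℝ}

/-- In the limit of a thin layer the cut-off function selects the part of the ball in `T`, as it
vanishes on the other side of the flat boundary. -/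
theorem tendsto_setIntegral_mul_stepDown (hΩ : MeasurableSet Ω) (hT : IsClosed T)
    (hTΩ : interior T ⊆ Ω) (hfr : volume (frontier T) = 0) (hH : IsHalfBallAt T e n x r)
    (heT : e ⊆ frontier T) {F : Euc d → ℝ} (hF : IntegrableOn F T)
    (hF0 : ∀ y ∉ Metric.ball x r, F y = 0) :
    Tendsto (fun ε : ℝ => ∫ y in Ω, F y * stepDown (ε⁻¹ * inner ℝ n (y - x))) (𝓝[>] 0)
      (𝓝 (∫ y in T, F y)) := by
  have hcont : ∀ ε : ℝ, Continuous fun y : Euc d => stepDown (ε⁻¹ * inner ℝ n (y - x)) := fun ε =>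
    contDiff_stepDown.continuous.comp (by fun_prop)
  have hlim : Tendsto (fun ε : ℝ => ∫ y in T, F y * stepDown (ε⁻¹ * inner ℝ n (y - x))) (𝓝[>] 0)
      (𝓝 (∫ y in T, F y)) := by
    refine tendsto_integral_filter_of_dominated_convergence (fun y => ‖F y‖)
      ?_ ?_ hF.norm ?_
    · exact Eventually.of_forall fun ε => hF.1.mul (hcont ε).aestronglyMeasurable
    · refine Eventually.of_forall fun ε => Eventually.of_forall fun y => ?_
      rw [norm_mul, Real.norm_eq_abs (stepDown _), abs_of_nonneg (stepDown_nonneg _)]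
      exact mul_le_of_le_one_right (norm_nonneg _) (stepDown_le_one _)
    · have hae : ∀ᵐ y ∂volume.restrict T, y ∉ frontier T :=
        ae_restrict_of_ae (measure_eq_zero_iff_ae_notMem.1 hfr)
      filter_upwards [hae, ae_restrict_mem hT.measurableSet] with y hyfr hyT
      by_cases hyb : y ∈ Metric.ball x r
      · have hneg : inner ℝ n (y - x) < 0 := by
          rcases lt_trichotomy (inner ℝ n (y - x)) 0 with h | h | h
          · exact h
          · exact absurd (heT ((hH.eq_iff y hyb).2 h)) hyfr
          · exact absurd hyT (hH.gt_imp y hyb h)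
        refine tendsto_const_nhds.congr' ?_
        have hpos : (0 : ℝ) < -inner ℝ n (y - x) / 2 := by linarith
        filter_upwards [Ioo_mem_nhdsGT hpos] with ε hε
        rw [stepDown_of_le, mul_one]
        rw [inv_mul_le_iff₀ hε.1]
        linarith [hε.2]
      · simp [hF0 y hyb]
  refine hlim.congr' ?_
  filter_upwards [self_mem_nhdsWithin] with ε hε
  have hε : (0 : ℝ) < ε := hε
  have hz : ∀ y ∉ interior T, F y * stepDown (ε⁻¹ * inner ℝ n (y - x)) = 0 := by
    intro y hy
    by_cases hyb : y ∈ Metric.ball x r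
    · have : 0 ≤ inner ℝ n (y - x) := by
        by_contra! h
        exact hy (hH.lt_imp y hyb h)
      rw [stepDown_of_ge, mul_zero]
      have : 0 ≤ ε⁻¹ * inner ℝ n (y - x) := by positivity
      linarith
    · rw [hF0 y hyb, zero_mul]
  rw [setIntegral_eq_of_subset_of_forall_sdiff_eq_zero hT.measurableSet interior_subset
      fun y hy => hz y hy.2,
    setIntegral_eq_of_subset_of_forall_sdiff_eq_zero hΩ hTΩ fun y hy => hz y hy.2]

/-- Green's formula for test functions supported in a ball in which the domain of integration is a
half ball. The test function is cut off in a layer along the flat boundary, so that the definition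
of the weak derivative applies, and the thickness of the layer tends to zero. -/
theorem green_halfBall (hΩ : IsOpen Ω) (hT : IsClosed T) (he : IsClosed e)
    (hTΩ : interior T ⊆ Ω) (hfr : volume (frontier T) = 0) (hn : ‖n‖ = 1)
    (hH : IsHalfBallAt T e n x r) (heT : e ⊆ frontier T) {i : Fin d} {g g' : Euc d → ℝ}
    (hg : Continuous g) (hw : IsWeakPartial Ω i g g') (hg' : IntegrableOn g' T)
    {θ : Euc d → ℝ} (hθ : ContDiff ℝ ∞ θ) (hθc : HasCompactSupport θ)
    (hθs : tsupport θ ⊆ Metric.ball x r) :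
    (∫ y in T, g y * fderiv ℝ θ y (EuclideanSpace.single i 1)) + ∫ y in T, g' y * θ y =
      n i * ∫ y in e, g y * θ y ∂μHE[d - 1] := by
  set v : Euc d := EuclideanSpace.single i 1 with hv
  have hdiff : Differentiable ℝ θ := hθ.differentiable (by simp)
  have hdθ : Continuous fun y => fderiv ℝ θ y v :=
    (hθ.continuous_fderiv (by simp)).clm_apply continuous_const
  have hdθc : HasCompactSupport fun y => fderiv ℝ θ y v := hθc.fderiv_apply (𝕜 := ℝ) v
  have hθ0 : ∀ y ∉ Metric.ball x r, θ y = 0 := fun y hy =>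
    image_eq_zero_of_notMem_tsupport fun h => hy (hθs h)
  have hdθ0 : ∀ y ∉ Metric.ball x r, fderiv ℝ θ y v = 0 := fun y hy => by
    rw [fderiv_of_notMem_tsupport ℝ (fun h => hy (hθs h))]; rfl
  have hnv : inner ℝ n v = n i := by
    rw [hv, EuclideanSpace.inner_single_right]; simp
  -- the cut-off functions and their derivatives
  let χ : ℝ → Euc d → ℝ := fun ε y => stepDown (ε⁻¹ * inner ℝ n (y - x))
  have hχ : ∀ ε, ContDiff ℝ ∞ (χ ε) := fun ε =>
    contDiff_stepDown.comp
      (contDiff_const.mul (contDiff_const.inner ℝ (contDiff_id.sub contDiff_const)))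
  have hχd : ∀ ε y, fderiv ℝ (χ ε) y v = ε⁻¹ * deriv stepDown (ε⁻¹ * inner ℝ n (y - x)) * n i := by
    intro ε y
    have h1 : HasFDerivAt (fun y : Euc d => ε⁻¹ * inner ℝ n (y - x)) (ε⁻¹ • innerSL ℝ n) y := by
      have h2 : HasFDerivAt (fun y : Euc d => inner ℝ n (y - x)) (innerSL ℝ n) y := by
        have h3 := (innerSL ℝ n).hasFDerivAt.comp y ((hasFDerivAt_id y).sub_const x)
        simpa [Function.comp_def] using h3
      exact h2.const_mul ε⁻¹
    have h4 := (hasDerivAt_stepDown (ε⁻¹ * inner ℝ n (y - x))).comp_hasFDerivAt y h1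
    have h5 : fderiv ℝ (χ ε) y = _ := h4.fderiv
    rw [h5]
    simp only [_root_.smul_apply, innerSL_apply_apply, smul_eq_mul, hnv]
    ring
  -- the definition of the weak derivative, tested with `θ χ_ε`
  have hweak : ∀ ε : ℝ, 0 < ε →
      (∫ y in Ω, (g y * fderiv ℝ θ y v) * χ ε y) + (∫ y in Ω, (g' y * θ y) * χ ε y) =
        -(n i * ∫ y, ε⁻¹ * deriv stepDown (ε⁻¹ * inner ℝ n (y - x)) * (g y * θ y)) := by
    intro ε hε
    have hsuppD : ∀ y, y ∉ Ω →
        ε⁻¹ * deriv stepDown (ε⁻¹ * inner ℝ n (y - x)) * (g y * θ y) = 0 := by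
      intro y hy
      by_cases hyb : y ∈ Metric.ball x r
      · have h0 : 0 ≤ inner ℝ n (y - x) := by
          by_contra! h
          exact hy (hTΩ (hH.lt_imp y hyb h))
        have hev : stepDown =ᶠ[𝓝 (ε⁻¹ * inner ℝ n (y - x))] fun _ => 0 := by
          have : (-1 : ℝ) < ε⁻¹ * inner ℝ n (y - x) := by
            have : 0 ≤ ε⁻¹ * inner ℝ n (y - x) := by positivity
            linarith
          filter_upwards [Ioi_mem_nhds this] with s hs using stepDown_of_ge (le_of_lt hs)
        rw [hev.deriv_eq, deriv_const]; ring
      · rw [hθ0 y hyb]; ring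
    have hts : tsupport (fun y => θ y * χ ε y) ⊆ Ω := by
      have hsub : tsupport (fun y => θ y * χ ε y) ⊆
          tsupport θ ∩ {y | ε⁻¹ * inner ℝ n (y - x) ≤ -1} := by
        refine subset_inter (tsupport_mul_subset_left) ?_
        refine closure_minimal (fun y hy => ?_)
          (isClosed_le (by fun_prop) continuous_const)
        by_contra h
        rw [mem_ofPred_eq, not_le] at h
        refine hy ?_
        simp only [χ]
        rw [stepDown_of_ge h.le, mul_zero]
      refine hsub.trans fun y hy => hTΩ (hH.lt_imp y (hθs hy.1) ?_)
      have h1 : ε⁻¹ * inner ℝ n (y - x) ≤ -1 := hy.2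
      by_contra! h
      have : 0 ≤ ε⁻¹ * inner ℝ n (y - x) := by positivity
      linarith
    have h := hw.integral_eq (fun y => θ y * χ ε y) (hθ.mul (hχ ε)) hθc.mul_right hts
    have hfd : ∀ y, g y * fderiv ℝ (fun y => θ y * χ ε y) y v =
        (g y * fderiv ℝ θ y v) * χ ε y +
          n i * (ε⁻¹ * deriv stepDown (ε⁻¹ * inner ℝ n (y - x)) * (g y * θ y)) := by
      intro y
      have hm := fderiv_fun_mul (hdiff y) ((hχ ε).differentiable (by simp) y)
      rw [hm]
      simp only [_root_.add_apply, _root_.smul_apply, smul_eq_mul, hχd]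
      ring
    have hχc : Continuous (χ ε) := (hχ ε).continuous
    have hcont : Continuous fun y =>
        ε⁻¹ * deriv stepDown (ε⁻¹ * inner ℝ n (y - x)) * (g y * θ y) := by
      have := continuous_deriv_stepDown
      have := hθ.continuous
      fun_prop
    change ∫ y in Ω, g y * fderiv ℝ (fun y => θ y * χ ε y) y v =
      -∫ y in Ω, g' y * (θ y * χ ε y) at h
    simp only [hfd] at h
    have hi1 : Integrable fun y => (g y * fderiv ℝ θ y v) * χ ε y :=
      ((hg.mul hdθ).mul hχc).integrable_of_hasCompactSupport hdθc.mul_left.mul_right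
    have hi2 : Integrable fun y =>
        n i * (ε⁻¹ * deriv stepDown (ε⁻¹ * inner ℝ n (y - x)) * (g y * θ y)) :=
      (continuous_const.mul hcont).integrable_of_hasCompactSupport
        (hθc.mul_left.mul_left.mul_left)
    rw [integral_add hi1.integrableOn hi2.integrableOn, integral_const_mul,
      setIntegral_eq_integral_of_forall_compl_eq_zero hsuppD] at h
    have h' : ∫ y in Ω, g' y * θ y * χ ε y = ∫ y in Ω, g' y * (θ y * χ ε y) := by
      simp only [mul_assoc]
    rw [h']
    linarith
  have hgd : IntegrableOn (fun y => g y * fderiv ℝ θ y v) T :=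
    ((hg.mul hdθ).integrable_of_hasCompactSupport hdθc.mul_left).integrableOn
  have hg'θ : IntegrableOn (fun y => g' y * θ y) T := by
    obtain ⟨C, hC⟩ := hθc.exists_bound_of_continuous hθ.continuous
    exact hg'.mul_bdd (c := C) hθ.continuous.aestronglyMeasurable (Eventually.of_forall hC)
  have l1 := tendsto_setIntegral_mul_stepDown hΩ.measurableSet hT hTΩ hfr hH heT hgd
    fun y hy => by rw [hdθ0 y hy, mul_zero]
  have l2 := tendsto_setIntegral_mul_stepDown hΩ.measurableSet hT hTΩ hfr hH heT hg'θ
    fun y hy => by rw [hθ0 y hy, mul_zero]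
  have l3 := (tendsto_integral_layer hn x (hg.mul hθ.continuous) hθc.mul_left).const_mul (n i)
  have hfin := tendsto_nhds_unique (l1.add l2) (l3.neg.congr' (by
    filter_upwards [self_mem_nhdsWithin] with ε hε
    exact (hweak ε hε).symm))
  rw [hfin, mul_neg, neg_neg]
  congr 1
  have hz : ∀ y ∉ Metric.ball x r, g y * θ y = 0 := fun y hy => by rw [hθ0 y hy, mul_zero]
  have hHm : MeasurableSet {y : Euc d | inner ℝ n (y - x) = 0} :=
    (isClosed_eq (by fun_prop) continuous_const).measurableSet
  simp only [Pi.mul_apply]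
  have e1 : {y : Euc d | inner ℝ n (y - x) = 0} ∩ Metric.ball x r = e ∩ Metric.ball x r := by
    ext y
    exact ⟨fun h => ⟨(hH.eq_iff y h.2).2 h.1, h.2⟩, fun h => ⟨(hH.eq_iff y h.2).1 h.1, h.2⟩⟩
  rw [setIntegral_eq_of_subset_of_forall_sdiff_eq_zero hHm
      (inter_subset_left (t := Metric.ball x r)) fun y hy => hz y fun h => hy.2 ⟨hy.1, h⟩,
    setIntegral_eq_of_subset_of_forall_sdiff_eq_zero he.measurableSet
      (inter_subset_left (t := Metric.ball x r)) fun y hy => hz y fun h => hy.2 ⟨hy.1, h⟩, e1]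

end HalfBall

/-! ### Sets of codimension two are negligible for Green's formula -/

section Cutoff

variable {d : ℕ}

/-- A sequence of smooth functions that vanish near `S` and tend to `1` off `S`, and whose
gradients tend to zero in `L¹` on bounded sets. -/
structure IsCutoffSeq (S : Set (Euc d)) (ψ : ℕ → Euc d → ℝ) : Prop where
  contDiff : ∀ j, ContDiff ℝ ∞ (ψ j)
  disjoint : ∀ j, Disjoint (tsupport (ψ j)) S
  abs_le_one : ∀ j y, |ψ j y| ≤ 1
  tendsto_one : ∀ y ∉ S, Tendsto (fun j => ψ j y) atTop (𝓝 1)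
  tendsto_fderiv : ∀ R : ℝ, Tendsto
    (fun j => ∫ y in Metric.closedBall (0 : Euc d) R, ‖fderiv ℝ (ψ j) y‖) atTop (𝓝 0)

theorem IsCutoffSeq.empty : IsCutoffSeq (∅ : Set (Euc d)) fun _ _ => 1 where
  contDiff _ := contDiff_const
  disjoint _ := disjoint_empty _
  abs_le_one _ _ := by simp
  tendsto_one _ _ := tendsto_const_nhds
  tendsto_fderiv _ := by simp

theorem IsCutoffSeq.continuous_fderiv {S : Set (Euc d)} {ψ : ℕ → Euc d → ℝ}
    (h : IsCutoffSeq S ψ) (j : ℕ) : Continuous (fderiv ℝ (ψ j)) :=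
  (h.contDiff j).continuous_fderiv (by simp)

theorem IsCutoffSeq.mul {S S' : Set (Euc d)} {ψ ψ' : ℕ → Euc d → ℝ} (h : IsCutoffSeq S ψ)
    (h' : IsCutoffSeq S' ψ') : IsCutoffSeq (S ∪ S') fun j y => ψ j y * ψ' j y where
  contDiff j := (h.contDiff j).mul (h'.contDiff j)
  disjoint j := by
    rw [disjoint_union_right]
    exact ⟨(h.disjoint j).mono_left (tsupport_mul_subset_left),
      (h'.disjoint j).mono_left (tsupport_mul_subset_right)⟩
  abs_le_one j y := by
    rw [abs_mul]
    exact mul_le_one₀ (h.abs_le_one j y) (abs_nonneg _) (h'.abs_le_one j y)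
  tendsto_one y hy := by
    rw [mem_union, not_or] at hy
    simpa using (h.tendsto_one y hy.1).mul (h'.tendsto_one y hy.2)
  tendsto_fderiv R := by
    have hsum := (h.tendsto_fderiv R).add (h'.tendsto_fderiv R)
    rw [add_zero] at hsum
    have hc : IsCompact (Metric.closedBall (0 : Euc d) R) := isCompact_closedBall _ _
    have hi : ∀ j, IntegrableOn (fun y => ‖fderiv ℝ (ψ j) y‖) (Metric.closedBall (0 : Euc d) R) :=
      fun j => (h.continuous_fderiv j).norm.continuousOn.integrableOn_compact hc
    have hi' : ∀ j, IntegrableOn (fun y => ‖fderiv ℝ (ψ' j) y‖)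
        (Metric.closedBall (0 : Euc d) R) :=
      fun j => (h'.continuous_fderiv j).norm.continuousOn.integrableOn_compact hc
    refine squeeze_zero (fun j => integral_nonneg fun y => norm_nonneg _) (fun j => ?_) hsum
    rw [← integral_add (hi j) (hi' j)]
    refine integral_mono_of_nonneg (Eventually.of_forall fun y => norm_nonneg _)
      ((hi j).add (hi' j)) (Eventually.of_forall fun y => ?_)
    simp only
    rw [fderiv_fun_mul ((h.contDiff j).differentiable (by simp) y)
      ((h'.contDiff j).differentiable (by simp) y)]
    refine (norm_add_le _ _).trans ?_
    rw [norm_smul, norm_smul, Real.norm_eq_abs, Real.norm_eq_abs, add_comm]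
    exact add_le_add (mul_le_of_le_one_left (norm_nonneg _) (h'.abs_le_one j y))
      (mul_le_of_le_one_left (norm_nonneg _) (h.abs_le_one j y))

/-- The part in a ball of the `δ`-neighbourhood of a subspace of codimension two has volume
`O(δ²)`. -/
theorem exists_volume_slab_le (hd : 2 ≤ d) {a b : Euc d} (ha : ‖a‖ = 1) (hb : ‖b‖ = 1)
    (hab : inner ℝ a b = 0) (x : Euc d) (R : ℝ) :
    ∃ C : ℝ, ∀ δ : ℝ, 0 ≤ δ →
      volume.real {y ∈ Metric.closedBall (0 : Euc d) R |
        |inner ℝ a (y - x)| ≤ δ ∧ |inner ℝ b (y - x)| ≤ δ} ≤ C * δ ^ 2 := by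
  classical
  -- extend `a, b` to an orthonormal basis, and put the set into a box in its coordinates
  let i₀ : Fin d := ⟨0, by omega⟩
  let i₁ : Fin d := ⟨1, by omega⟩
  have h01 : i₀ ≠ i₁ := by simp [i₀, i₁]
  let v : Fin d → Euc d := fun i => if i = i₀ then a else b
  have hv0 : v i₀ = a := by simp [v]
  have hv1 : v i₁ = b := by simp [v, h01.symm]
  have horth : Orthonormal ℝ (({i₀, i₁} : Set (Fin d)).domRestrict v) := by
    refine ⟨fun ⟨i, hi⟩ => ?_, fun ⟨i, hi⟩ ⟨j, hj⟩ hij => ?_⟩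
    · change ‖v i‖ = 1
      have h : i = i₀ ∨ i = i₁ := by simpa using hi
      rcases h with h | h <;> rw [h]
      · rw [hv0, ha]
      · rw [hv1, hb]
    · change inner ℝ (v i) (v j) = 0
      have h : i = i₀ ∨ i = i₁ := by simpa using hi
      have h' : j = i₀ ∨ j = i₁ := by simpa using hj
      have hne : i ≠ j := fun h => hij (Subtype.ext h)
      rcases h with h | h <;> rcases h' with h' | h' <;> rw [h, h']
      · exact absurd (h.trans h'.symm) hne
      · rw [hv0, hv1, hab]
      · rw [hv0, hv1, real_inner_comm, hab]
      · exact absurd (h.trans h'.symm) hne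
  obtain ⟨B, hB⟩ := horth.exists_orthonormalBasis_extension_of_card_eq (by simp)
  have hB0 : B i₀ = a := by rw [hB i₀ (by simp), hv0]
  have hB1 : B i₁ = b := by rw [hB i₁ (by simp), hv1]
  let p : Fin d → Prop := fun i => i = i₀ ∨ i = i₁
  let w : ℝ → Fin d → ℝ := fun δ i => if p i then δ else |R|
  let c : Fin d → ℝ := fun i => if p i then inner ℝ (B i) x else 0
  refine ⟨2 ^ 2 * (2 * |R|) ^ (Finset.univ.filter fun i => ¬ p i).card, fun δ hδ => ?_⟩
  have hmp : MeasurePreserving (fun y : Euc d => (B.repr y).ofLp) volume volume :=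
    (PiLp.volume_preserving_ofLp (Fin d)).comp B.measurePreserving_repr
  have hsub : {y ∈ Metric.closedBall (0 : Euc d) R |
        |inner ℝ a (y - x)| ≤ δ ∧ |inner ℝ b (y - x)| ≤ δ} ⊆
      (fun y : Euc d => (B.repr y).ofLp) ⁻¹' Icc (c - w δ) (c + w δ) := by
    rintro y ⟨hyR, hya, hyb⟩
    have hcoord : ∀ i, |inner ℝ (B i) y - c i| ≤ w δ i := by
      intro i
      by_cases hi : p i
      · simp only [c, w, if_pos hi, ← inner_sub_right]
        rcases hi with rfl | rfl
        · rwa [hB0]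
        · rwa [hB1]
      · simp only [c, w, if_neg hi, sub_zero]
        refine (abs_real_inner_le_norm _ _).trans ?_
        rw [B.norm_eq_one, one_mul]
        exact (mem_closedBall_zero_iff.1 hyR).trans (le_abs_self R)
    refine ⟨fun i => ?_, fun i => ?_⟩ <;>
    · have := abs_le.1 (hcoord i)
      simp only [Pi.sub_apply, Pi.add_apply, B.repr_apply_apply]
      linarith
  have hw : ∀ i, 0 ≤ w δ i := fun i => by
    simp only [w]; split_ifs
    · exact hδ
    · exact abs_nonneg _
  have hvol : volume.real (Icc (c - w δ) (c + w δ)) = ∏ i, (2 * w δ i) := by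
    rw [Measure.real, Real.volume_Icc_pi_toReal]
    · refine Finset.prod_congr rfl fun i _ => ?_
      simp only [Pi.sub_apply, Pi.add_apply]; ring
    · intro i
      simp only [Pi.sub_apply, Pi.add_apply]; linarith [hw i]
  have hpre : volume.real ((fun y : Euc d => (B.repr y).ofLp) ⁻¹' Icc (c - w δ) (c + w δ)) =
      volume.real (Icc (c - w δ) (c + w δ)) := by
    rw [Measure.real, hmp.measure_preimage measurableSet_Icc.nullMeasurableSet, Measure.real]
  have hfin : volume ((fun y : Euc d => (B.repr y).ofLp) ⁻¹' Icc (c - w δ) (c + w δ)) ≠ ⊤ := by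
    rw [hmp.measure_preimage measurableSet_Icc.nullMeasurableSet]
    exact isCompact_Icc.measure_lt_top.ne
  refine (measureReal_mono hsub hfin).trans (le_of_eq ?_)
  rw [hpre, hvol, ← Finset.prod_filter_mul_prod_filter_not Finset.univ p]
  have e1 : ∏ i ∈ Finset.univ.filter p, (2 * w δ i) = (2 * δ) ^ 2 := by
    have : Finset.univ.filter p = {i₀, i₁} := by
      ext i; simp [p]
    rw [this, Finset.prod_pair h01]
    simp [w, p]
    ring
  have e2 : ∏ i ∈ Finset.univ.filter (fun i => ¬ p i), (2 * w δ i) =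
      (2 * |R|) ^ (Finset.univ.filter fun i => ¬ p i).card := by
    rw [← Finset.prod_const]
    refine Finset.prod_congr rfl fun i hi => ?_
    simp only [w, if_neg (Finset.mem_filter.1 hi).2]
  rw [e1, e2]
  ring

/-- A smooth function of one variable that is `0` on `(-∞, 1]` and `1` on `[2, ∞)`. -/
def stepUp (t : ℝ) : ℝ := Real.smoothTransition (t - 1)

theorem contDiff_stepUp : ContDiff ℝ ∞ stepUp :=
  Real.smoothTransition.contDiff.comp (contDiff_id.sub contDiff_const)

theorem stepUp_of_ge {t : ℝ} (ht : 2 ≤ t) : stepUp t = 1 :=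
  Real.smoothTransition.one_of_one_le (by linarith)

theorem stepUp_of_le {t : ℝ} (ht : t ≤ 1) : stepUp t = 0 :=
  Real.smoothTransition.zero_of_nonpos (by linarith)

theorem exists_abs_deriv_stepUp_le : ∃ C, 0 ≤ C ∧ ∀ t, |deriv stepUp t| ≤ C := by
  have hc : HasCompactSupport (deriv stepUp) := by
    refine HasCompactSupport.intro (isCompact_Icc (a := (1 : ℝ)) (b := 2)) fun t ht => ?_
    rw [mem_Icc, not_and_or, not_le, not_le] at ht
    rcases ht with ht | ht
    · have : stepUp =ᶠ[𝓝 t] fun _ => 0 := by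
        filter_upwards [Iio_mem_nhds ht] with s hs using stepUp_of_le (le_of_lt hs)
      rw [this.deriv_eq, deriv_const]
    · have : stepUp =ᶠ[𝓝 t] fun _ => 1 := by
        filter_upwards [Ioi_mem_nhds ht] with s hs using stepUp_of_ge (le_of_lt hs)
      rw [this.deriv_eq, deriv_const]
  obtain ⟨C, hC⟩ := hc.exists_bound_of_continuous (contDiff_stepUp.continuous_deriv (by simp))
  exact ⟨C, (norm_nonneg _).trans (hC 0), hC⟩

theorem deriv_stepUp_of_gt {t : ℝ} (ht : 2 < t) : deriv stepUp t = 0 := by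
  have : stepUp =ᶠ[𝓝 t] fun _ => 1 := by
    filter_upwards [Ioi_mem_nhds ht] with s hs using stepUp_of_ge (le_of_lt hs)
  rw [this.deriv_eq, deriv_const]

/-- A subspace of codimension two has zero capacity: the cut-off functions have gradients of size
`j` on a set of measure `O(j⁻²)`. -/
theorem exists_isCutoffSeq_codim_two (hd : 2 ≤ d) {a b : Euc d} (ha : ‖a‖ = 1) (hb : ‖b‖ = 1)
    (hab : inner ℝ a b = 0) (x : Euc d) :
    ∃ ψ, IsCutoffSeq {y : Euc d | inner ℝ a (y - x) = 0 ∧ inner ℝ b (y - x) = 0} ψ := by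
  obtain ⟨K, hK0, hK⟩ := exists_abs_deriv_stepUp_le
  -- the squared distance to the subspace
  let ρ : Euc d → ℝ := fun y => inner ℝ a (y - x) ^ 2 + inner ℝ b (y - x) ^ 2
  let N : ℕ → ℝ := fun j => (j : ℝ) + 1
  have hN : ∀ j, 0 < N j := fun j => by positivity
  have hρ : ContDiff ℝ ∞ ρ :=
    ((contDiff_const.inner ℝ (contDiff_id.sub contDiff_const)).pow 2).add
      ((contDiff_const.inner ℝ (contDiff_id.sub contDiff_const)).pow 2)
  let ψ : ℕ → Euc d → ℝ := fun j y => stepUp (N j ^ 2 * ρ y)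
  have hψ : ∀ j, ContDiff ℝ ∞ (ψ j) := fun j => contDiff_stepUp.comp (contDiff_const.mul hρ)
  have hfd : ∀ j y, fderiv ℝ (ψ j) y = deriv stepUp (N j ^ 2 * ρ y) •
      (N j ^ 2 •
        ((2 * inner ℝ a (y - x)) • innerSL ℝ a + (2 * inner ℝ b (y - x)) • innerSL ℝ b)) := by
    intro j y
    have hlin : ∀ c : Euc d, HasFDerivAt (fun y : Euc d => inner ℝ c (y - x)) (innerSL ℝ c) y := by
      intro c
      have h3 := (innerSL ℝ c).hasFDerivAt.comp y ((hasFDerivAt_id y).sub_const x)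
      simpa [Function.comp_def] using h3
    have h1 : HasFDerivAt ρ ((2 * inner ℝ a (y - x)) • innerSL ℝ a +
        (2 * inner ℝ b (y - x)) • innerSL ℝ b) y := by
      have := ((hlin a).pow 2).fun_add ((hlin b).pow 2)
      exact this.congr_fderiv (by simp)
    have hs := (contDiff_stepUp.differentiable (by simp) (N j ^ 2 * ρ y)).hasDerivAt
    have h2 := hs.comp_hasFDerivAt y (h1.const_mul (N j ^ 2))
    exact h2.fderiv
  refine ⟨ψ, hψ, fun j => ?_, fun j y => ?_, fun y hy => ?_, fun R => ?_⟩
  · have hsub : tsupport (ψ j) ⊆ {y | 1 ≤ N j ^ 2 * ρ y} := by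
      refine closure_minimal (fun y hy => ?_)
        (isClosed_le continuous_const (continuous_const.mul hρ.continuous))
      by_contra h
      rw [mem_ofPred_eq, not_le] at h
      exact hy (stepUp_of_le h.le)
    refine (Set.disjoint_left.2 fun y hy hyS => ?_).mono_left hsub
    have h1 : 1 ≤ N j ^ 2 * ρ y := hy
    simp only [ρ, hyS.1, hyS.2] at h1
    norm_num at h1
  · change |Real.smoothTransition _| ≤ 1
    rw [abs_of_nonneg (Real.smoothTransition.nonneg _)]
    exact Real.smoothTransition.le_one _
  · have hpos : 0 < ρ y := by
      rw [mem_ofPred_eq, not_and_or] at hy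
      rcases hy with h | h
      · have := sq_nonneg (inner ℝ b (y - x) : ℝ)
        have := sq_pos_of_ne_zero h
        simp only [ρ]; linarith
      · have := sq_nonneg (inner ℝ a (y - x) : ℝ)
        have := sq_pos_of_ne_zero h
        simp only [ρ]; linarith
    refine tendsto_const_nhds.congr' ?_
    obtain ⟨j₀, hj₀⟩ := exists_nat_gt (2 / ρ y)
    filter_upwards [eventually_ge_atTop j₀] with j hj
    refine (stepUp_of_ge ?_).symm
    have h1 : 2 / ρ y < N j := hj₀.trans_le (by
      have : (j₀ : ℝ) ≤ j := by exact_mod_cast hj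
      simp only [N]; linarith)
    rw [div_lt_iff₀ hpos] at h1
    have h2 : N j ≤ N j ^ 2 := by
      have : (1 : ℝ) ≤ N j := by simp [N]
      nlinarith
    nlinarith
  · obtain ⟨C, hC⟩ := exists_volume_slab_le hd ha hb hab x R
    let A : ℕ → Set (Euc d) := fun j => {y ∈ Metric.closedBall (0 : Euc d) R |
        |inner ℝ a (y - x)| ≤ 2 / N j ∧ |inner ℝ b (y - x)| ≤ 2 / N j}
    have hslab : ∀ (c : Euc d) (t : ℝ), IsClosed {y : Euc d | |inner ℝ c (y - x)| ≤ t} :=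
      fun c t => isClosed_le (by fun_prop) continuous_const
    have hAm : ∀ j, MeasurableSet (A j) := fun j =>
      (Metric.isClosed_closedBall.inter ((hslab a _).inter (hslab b _))).measurableSet
    have hAfin : ∀ j, volume (A j) ≠ ⊤ := fun j =>
      ((measure_mono (sep_subset _ _)).trans_lt
        (isCompact_closedBall (0 : Euc d) R).measure_lt_top).ne
    have hpt : ∀ j, ∀ y ∈ Metric.closedBall (0 : Euc d) R,
        ‖fderiv ℝ (ψ j) y‖ ≤ (A j).indicator (fun _ => K * (8 * N j)) y := by
      intro j y hyR
      rw [hfd]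
      by_cases h2 : 2 < N j ^ 2 * ρ y
      · rw [deriv_stepUp_of_gt h2, zero_smul, norm_zero]
        refine indicator_nonneg (fun _ _ => ?_) _
        have := hN j
        positivity
      · rw [not_lt] at h2
        have hle : ∀ s : ℝ, s ^ 2 ≤ ρ y → |s| ≤ 2 / N j := by
          intro s hs
          refine abs_le_of_sq_le_sq ?_ (by have := hN j; positivity)
          rw [div_pow, le_div_iff₀ (by have := hN j; positivity)]
          have := mul_le_mul_of_nonneg_right hs (sq_nonneg (N j))
          nlinarith
        have hA1 := hle (inner ℝ a (y - x)) (by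
          simp only [ρ]; nlinarith [sq_nonneg (inner ℝ b (y - x) : ℝ)])
        have hA2 := hle (inner ℝ b (y - x)) (by
          simp only [ρ]; nlinarith [sq_nonneg (inner ℝ a (y - x) : ℝ)])
        rw [indicator_of_mem (show y ∈ A j from ⟨hyR, hA1, hA2⟩), norm_smul]
        refine mul_le_mul (hK _) ?_ (norm_nonneg _) hK0
        rw [norm_smul, Real.norm_eq_abs, abs_of_pos (pow_pos (hN j) 2)]
        have hs : ‖(2 * inner ℝ a (y - x)) • innerSL ℝ a + (2 * inner ℝ b (y - x)) • innerSL ℝ b‖ ≤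
            8 / N j := by
          refine (norm_add_le _ _).trans ?_
          rw [norm_smul, norm_smul, innerSL_apply_norm, innerSL_apply_norm, ha, hb, mul_one,
            mul_one, norm_mul, norm_mul, Real.norm_eq_abs, Real.norm_eq_abs, Real.norm_eq_abs,
            abs_two]
          calc 2 * |inner ℝ a (y - x)| + 2 * |inner ℝ b (y - x)|
              ≤ 2 * (2 / N j) + 2 * (2 / N j) := by gcongr
            _ = 8 / N j := by ring
        calc N j ^ 2 * _ ≤ N j ^ 2 * (8 / N j) :=
              mul_le_mul_of_nonneg_left hs (sq_nonneg _)
          _ = 8 * N j := by have := (hN j).ne'; field_simp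
    have hbound : ∀ j, ∫ y in Metric.closedBall (0 : Euc d) R, ‖fderiv ℝ (ψ j) y‖ ≤
        32 * K * C * (1 / N j) := by
      intro j
      have hgi : Integrable ((A j).indicator fun _ => K * (8 * N j))
          (volume.restrict (Metric.closedBall (0 : Euc d) R)) :=
        ((integrable_indicator_iff (hAm j)).2
          (integrableOn_const (hAfin j))).integrableOn
      calc ∫ y in Metric.closedBall (0 : Euc d) R, ‖fderiv ℝ (ψ j) y‖
          ≤ ∫ y in Metric.closedBall (0 : Euc d) R,
              (A j).indicator (fun _ => K * (8 * N j)) y := by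
            refine integral_mono_of_nonneg (Eventually.of_forall fun y => norm_nonneg _) hgi ?_
            filter_upwards [ae_restrict_mem Metric.isClosed_closedBall.measurableSet] with y hy
            exact hpt j y hy
        _ = volume.real (A j) * (K * (8 * N j)) := by
            rw [setIntegral_indicator (hAm j), setIntegral_const, smul_eq_mul,
              inter_eq_self_of_subset_right (sep_subset _ _)]
        _ ≤ C * (2 / N j) ^ 2 * (K * (8 * N j)) := by
            have := hN j
            exact mul_le_mul_of_nonneg_right (hC _ (by positivity)) (by positivity)
        _ = 32 * K * C * (1 / N j) := by have := (hN j).ne'; field_simp; ring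
    refine squeeze_zero (fun j => integral_nonneg fun y => norm_nonneg _) hbound ?_
    have := (tendsto_one_div_add_atTop_nhds_zero_nat (𝕜 := ℝ)).const_mul (32 * K * C)
    rwa [mul_zero] at this

end Cutoff

/-! ### Surface measure of faces -/

section FaceMeasure

variable {d : ℕ} {e : Set (Euc d)}

/-- A proper affine subspace of the hyperplane of a face lies in a set cut out by two orthonormal
equations. -/
theorem IsPolytope.exists_codim_two (hd : 0 < d) (he : IsPolytope (d - 1) e)
    {A : AffineSubspace ℝ (Euc d)} (hA : A < affineSpan ℝ e) {x : Euc d} (hx : x ∈ A) :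
    ∃ a b : Euc d, ‖a‖ = 1 ∧ ‖b‖ = 1 ∧ inner ℝ a b = 0 ∧
      (A : Set (Euc d)) ⊆ {y | inner ℝ a (y - x) = 0 ∧ inner ℝ b (y - x) = 0} := by
  obtain ⟨a, ha, horth⟩ := he.exists_unit_normal hd
  have hlt : A.direction < (affineSpan ℝ e).direction :=
    AffineSubspace.direction_lt_of_nonempty hA ⟨x, hx⟩
  have hne : A.directionᗮ ⊓ (affineSpan ℝ e).direction ≠ ⊥ := by
    intro h
    have := Submodule.sup_orthogonal_inf_of_hasOrthogonalProjection hlt.le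
    rw [h, sup_bot_eq] at this
    exact hlt.ne this
  obtain ⟨b, hb, hb0⟩ := Submodule.exists_mem_ne_zero_of_ne_bot hne
  refine ⟨a, ‖b‖⁻¹ • b, ha, ?_, ?_, fun y hy => ⟨?_, ?_⟩⟩
  · rw [norm_smul, norm_inv, norm_norm, inv_mul_cancel₀ (norm_ne_zero_iff.2 hb0)]
  · rw [real_inner_smul_right, horth b hb.2, mul_zero]
  · exact horth _ (hlt.le (AffineSubspace.vsub_mem_direction hy hx))
  · have h0 : inner ℝ b (y - x) = 0 := (Submodule.mem_orthogonal' _ _).1 hb.1 _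
      (AffineSubspace.vsub_mem_direction hy hx)
    rw [real_inner_smul_left, h0, mul_zero]

theorem surfaceMeasure_codim_two {a b : Euc d} (ha : ‖a‖ = 1) (hb : ‖b‖ = 1)
    (hab : inner ℝ a b = 0) (x : Euc d) :
    (μHE[d - 1] : Measure (Euc d)) {y | inner ℝ a (y - x) = 0 ∧ inner ℝ b (y - x) = 0} = 0 := by
  have hcl : ∀ c : Euc d, IsClosed {y : Euc d | inner ℝ c (y - x) = 0} := fun c =>
    isClosed_eq (by fun_prop) continuous_const
  have hm : MeasurableSet {y : Euc d | inner ℝ a (y - x) = 0 ∧ inner ℝ b (y - x) = 0} :=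
    ((hcl a).inter (hcl b)).measurableSet
  rw [← inter_eq_self_of_subset_left (s := {y : Euc d | inner ℝ a (y - x) = 0 ∧
      inner ℝ b (y - x) = 0}) (t := {y | inner ℝ a (y - x) = 0}) fun y hy => hy.1,
    ← Measure.restrict_apply hm,
    ← map_volume_orthogonal ha x, (measurableEmbedding_add_const_orthogonal a x).map_apply]
  let S : Submodule ℝ (ℝ ∙ a)ᗮ := LinearMap.ker ((innerSL ℝ b).toLinearMap ∘ₗ (ℝ ∙ a)ᗮ.subtype)
  have hS : S ≠ ⊤ := by
    intro htop
    have hmem : (⟨b, Submodule.mem_orthogonal_singleton_iff_inner_right.2 hab⟩ : (ℝ ∙ a)ᗮ) ∈ S := by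
      rw [htop]; trivial
    have h0 : inner ℝ b b = (0 : ℝ) := hmem
    rw [real_inner_self_eq_norm_sq, hb] at h0
    norm_num at h0
  refine measure_mono_null (fun z hz => ?_) (Measure.addHaar_submodule volume S hS)
  have h2 : inner ℝ b ((z : Euc d) + x - x) = 0 := hz.2
  rw [add_sub_cancel_right] at h2
  exact h2

/-- A proper affine subspace of the hyperplane of a face has surface measure zero. -/
theorem IsPolytope.surfaceMeasure_eq_zero (hd : 0 < d) (he : IsPolytope (d - 1) e)
    {A : AffineSubspace ℝ (Euc d)} (hA : A < affineSpan ℝ e) :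
    (μHE[d - 1] : Measure (Euc d)) (A : Set (Euc d)) = 0 := by
  rcases (A : Set (Euc d)).eq_empty_or_nonempty with hem | ⟨x, hx⟩
  · rw [hem, measure_empty]
  obtain ⟨a, b, ha, hb, hab, hsub⟩ := he.exists_codim_two hd hA hx
  exact measure_mono_null hsub (surfaceMeasure_codim_two ha hb hab x)

theorem IsPolytope.surfaceMeasure_apply (he : IsPolytope (d - 1) e) {n x : Euc d} (hn : ‖n‖ = 1)
    (horth : ∀ w ∈ (affineSpan ℝ e).direction, inner ℝ n w = 0) (hx : x ∈ affineSpan ℝ e)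
    {s : Set (Euc d)} (hs : s ⊆ affineSpan ℝ e) (hsm : MeasurableSet s) :
    (μHE[d - 1] : Measure (Euc d)) s =
      volume ((fun z : (ℝ ∙ n)ᗮ => (z : Euc d) + x) ⁻¹' s) := by
  have hsub : s ⊆ {y | inner ℝ n (y - x) = 0} := fun y hy =>
    (he.mem_affineSpan_iff hn horth hx y).1 (hs hy)
  rw [← (measurableEmbedding_add_const_orthogonal n x).map_apply, map_volume_orthogonal hn x,
    Measure.restrict_apply hsm, inter_eq_self_of_subset_left hsub]

theorem IsPolytope.surfaceMeasure_lt_top (hd : 0 < d) (he : IsPolytope (d - 1) e) :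
    (μHE[d - 1] : Measure (Euc d)) e < ⊤ := by
  obtain ⟨n, hn, horth⟩ := he.exists_unit_normal hd
  obtain ⟨x, hx⟩ := he.nonempty_intrinsicInterior
  rw [he.surfaceMeasure_apply hn horth (subset_affineSpan ℝ e (intrinsicInterior_subset hx))
    (subset_affineSpan ℝ e) he.isCompact.isClosed.measurableSet]
  exact ((isometry_add_const_orthogonal n x).isClosedEmbedding.isCompact_preimage
    he.isCompact).measure_lt_top

/-- Every relatively open part of a face has positive surface measure. -/
theorem IsPolytope.surfaceMeasure_inter_pos (hd : 0 < d) (he : IsPolytope (d - 1) e) {x : Euc d}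
    (hx : x ∈ intrinsicInterior ℝ e) {U : Set (Euc d)} (hU : IsOpen U) (hxU : x ∈ U) :
    0 < (μHE[d - 1] : Measure (Euc d)) (e ∩ U) := by
  obtain ⟨n, hn, horth⟩ := he.exists_unit_normal hd
  obtain ⟨hxs, r, hr, hball⟩ := mem_intrinsicInterior_iff_exists_ball.1 hx
  obtain ⟨s, hs, hballU⟩ := Metric.isOpen_iff.1 hU x hxU
  rw [he.surfaceMeasure_apply hn horth hxs (inter_subset_left.trans (subset_affineSpan ℝ e))
    (he.isCompact.isClosed.measurableSet.inter hU.measurableSet)]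
  refine (Metric.measure_ball_pos volume (0 : (ℝ ∙ n)ᗮ) (lt_min hr hs)).trans_le
    (measure_mono fun z hz => ?_)
  have hz' : ‖(z : Euc d)‖ < min r s := by simpa using hz
  have hb : (z : Euc d) + x ∈ Metric.ball x (min r s) := by
    rw [mem_ball_iff_norm, add_sub_cancel_right]; exact hz'
  refine ⟨hball _ (Metric.ball_subset_ball (min_le_left _ _) hb) ?_,
    hballU (Metric.ball_subset_ball (min_le_right _ _) hb)⟩
  rw [he.mem_affineSpan_iff hn horth hxs, add_sub_cancel_right]
  exact Submodule.mem_orthogonal_singleton_iff_inner_right.1 z.2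

theorem IsPolytope.integrableOn_surface (hd : 0 < d) (he : IsPolytope (d - 1) e) {F : Euc d → ℝ}
    (hF : ContinuousOn F e) : IntegrableOn F e (μHE[d - 1] : Measure (Euc d)) := by
  obtain ⟨C, hC⟩ := he.isCompact.exists_bound_of_continuousOn hF
  have hem := he.isCompact.isClosed.measurableSet
  refine IntegrableOn.of_bound (he.surfaceMeasure_lt_top hd) (hF.aestronglyMeasurable hem) C ?_
  filter_upwards [ae_restrict_mem hem] with y hy using hC y hy

/-- A continuous function that vanishes almost everywhere on a face vanishes on the face. -/
theorem IsPolytope.eqOn_zero_of_ae (hd : 0 < d) (he : IsPolytope (d - 1) e) {F : Euc d → ℝ}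
    (hF : Continuous F) (h : ∀ᵐ y ∂(μHE[d - 1] : Measure (Euc d)).restrict e, F y = 0) :
    ∀ y ∈ e, F y = 0 := by
  have hint : intrinsicInterior ℝ e ⊆ {y | F y = 0} := by
    intro x hx
    by_contra hne
    have hU : IsOpen {y | F y ≠ 0} := isOpen_ne_fun hF continuous_const
    have hpos := he.surfaceMeasure_inter_pos hd hx hU hne
    rw [ae_iff, Measure.restrict_apply hU.measurableSet, inter_comm] at h
    exact hpos.ne' h
  intro y hy
  rw [← he.closure_intrinsicInterior] at hy
  exact closure_minimal hint (isClosed_eq hF continuous_const) hy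

end FaceMeasure

/-! ### Green's formula on an element -/

section Green

variable {d : ℕ}

/-- An additive functional of smooth compactly supported functions that vanishes locally near a
compact set vanishes on the functions supported in this set. -/
theorem eq_zero_of_locally_eq_zero {Λ : (Euc d → ℝ) → ℝ}
    (hadd : ∀ φ ψ : Euc d → ℝ, ContDiff ℝ ∞ φ → HasCompactSupport φ → ContDiff ℝ ∞ ψ →
      HasCompactSupport ψ → Λ (φ + ψ) = Λ φ + Λ ψ)
    {φ : Euc d → ℝ} (hφ : ContDiff ℝ ∞ φ) (hφc : HasCompactSupport φ)
    (hloc : ∀ x ∈ tsupport φ, ∃ U : Set (Euc d), IsOpen U ∧ x ∈ U ∧ ∀ θ : Euc d → ℝ,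
      ContDiff ℝ ∞ θ → HasCompactSupport θ → tsupport θ ⊆ U → Λ θ = 0) :
    Λ φ = 0 := by
  classical
  choose! U hUo hxU hU using hloc
  obtain ⟨t, ht, hcov⟩ := hφc.isCompact.elim_nhds_subcover U fun x hx =>
    (hUo x hx).mem_nhds (hxU x hx)
  obtain ⟨f, hf⟩ := SmoothPartitionOfUnity.exists_isSubordinate (modelWithCornersSelf ℝ (Euc d))
    (isClosed_tsupport φ) (fun i : t => U i) (fun i => hUo i (ht i i.2)) (fun x hx => by
      have := hcov hx
      rw [mem_iUnion₂] at this
      obtain ⟨i, hi, hxi⟩ := this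
      exact mem_iUnion.2 ⟨⟨i, hi⟩, hxi⟩)
  have hfs : ∀ i, ContDiff ℝ ∞ (f i) := fun i => (f i).contMDiff.contDiff
  have hsum : φ = ∑ i : t, fun y => f i y * φ y := by
    funext y
    rw [Finset.sum_apply, ← Finset.sum_mul]
    by_cases hy : y ∈ tsupport φ
    · have h1 := f.sum_eq_one hy
      rw [finsum_eq_sum_of_fintype] at h1
      rw [h1, one_mul]
    · rw [image_eq_zero_of_notMem_tsupport hy, mul_zero]
  have hzero : Λ 0 = 0 := by
    have := hadd 0 0 contDiff_const HasCompactSupport.zero contDiff_const HasCompactSupport.zero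
    rw [add_zero] at this
    linarith
  have key : ∀ s : Finset t, ContDiff ℝ ∞ (∑ i ∈ s, fun y => f i y * φ y) ∧
      HasCompactSupport (∑ i ∈ s, fun y => f i y * φ y) ∧
      Λ (∑ i ∈ s, fun y => f i y * φ y) = 0 := by
    intro s
    induction s using Finset.induction_on with
    | empty => exact ⟨contDiff_const, HasCompactSupport.zero, by simpa using hzero⟩
    | insert i s hi ih =>
      rw [Finset.sum_insert hi]
      have h1 : ContDiff ℝ ∞ fun y => f i y * φ y := (hfs i).mul hφ
      have h2 : HasCompactSupport fun y => f i y * φ y := hφc.mul_left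
      refine ⟨h1.add ih.1, h2.add ih.2.1, ?_⟩
      rw [hadd _ _ h1 h2 ih.1 ih.2.1, ih.2.2, add_zero]
      exact hU i (ht i i.2) _ h1 h2 ((tsupport_mul_subset_left).trans (hf i))
  rw [hsum]
  exact (key Finset.univ).2.2

/-- A set that can be cut out of Green's formula in the limit. -/
structure IsNegligible (S : Set (Euc d)) : Prop where
  exists_isCutoffSeq : ∃ ψ, IsCutoffSeq S ψ
  volume_eq_zero : volume S = 0
  surfaceMeasure_eq_zero : (μHE[d - 1] : Measure (Euc d)) S = 0

theorem IsNegligible.empty : IsNegligible (∅ : Set (Euc d)) :=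
  ⟨⟨_, IsCutoffSeq.empty⟩, measure_empty, measure_empty⟩

theorem IsNegligible.union {S S' : Set (Euc d)} (h : IsNegligible S) (h' : IsNegligible S') :
    IsNegligible (S ∪ S') := by
  obtain ⟨⟨ψ, hψ⟩, h1, h2⟩ := h
  obtain ⟨⟨ψ', hψ'⟩, h1', h2'⟩ := h'
  exact ⟨⟨_, hψ.mul hψ'⟩, measure_union_null h1 h1', measure_union_null h2 h2'⟩

theorem isNegligible_codim_two (hd : 2 ≤ d) {a b : Euc d} (ha : ‖a‖ = 1) (hb : ‖b‖ = 1)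
    (hab : inner ℝ a b = 0) (x : Euc d) :
    IsNegligible {y : Euc d | inner ℝ a (y - x) = 0 ∧ inner ℝ b (y - x) = 0} := by
  refine ⟨exists_isCutoffSeq_codim_two hd ha hb hab x, ?_, surfaceMeasure_codim_two ha hb hab x⟩
  have hne : AffineSubspace.mk' x (ℝ ∙ a)ᗮ ≠ ⊤ := by
    intro h
    have h1 : a + x ∈ AffineSubspace.mk' x (ℝ ∙ a)ᗮ := by rw [h]; trivial
    rw [AffineSubspace.mem_mk', Submodule.mem_orthogonal_singleton_iff_inner_right,
      vsub_eq_sub, add_sub_cancel_right, real_inner_self_eq_norm_sq, ha] at h1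
    norm_num at h1
  refine measure_mono_null (fun y hy => ?_) (Measure.addHaar_affineSubspace volume _ hne)
  exact AffineSubspace.mem_mk'.2 (Submodule.mem_orthogonal_singleton_iff_inner_right.2 hy.1)

theorem IsPolytope.exists_isNegligible (hd : 2 ≤ d) {e : Set (Euc d)}
    (he : IsPolytope (d - 1) e) :
    ∃ S : Set (Euc d), IsNegligible S ∧ intrinsicFrontier ℝ e ⊆ S := by
  obtain ⟨A, hA, hlt, hsub⟩ := he.intrinsicFrontier_subset
  have key : ∀ B : Set (AffineSubspace ℝ (Euc d)), B.Finite → B ⊆ A →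
      ∃ S : Set (Euc d), IsNegligible S ∧ ⋃ H ∈ B, (H : Set (Euc d)) ⊆ S := by
    intro B hB
    induction B, hB using Set.Finite.induction_on with
    | empty => exact fun _ => ⟨∅, IsNegligible.empty, by simp⟩
    | @insert H B hH hB ih =>
      intro hBA
      obtain ⟨S, hS, h⟩ := ih ((subset_insert _ _).trans hBA)
      rw [biUnion_insert]
      rcases (H : Set (Euc d)).eq_empty_or_nonempty with hem | ⟨x, hx⟩
      · exact ⟨S, hS, by rw [hem, empty_union]; exact h⟩
      · obtain ⟨a, b, ha, hb, hab, hHs⟩ := he.exists_codim_two (by omega)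
          (hlt H (hBA (mem_insert _ _))) hx
        exact ⟨_, (isNegligible_codim_two hd ha hb hab x).union hS, union_subset_union hHs h⟩
  obtain ⟨S, hS, h⟩ := key A hA subset_rfl
  exact ⟨S, hS, hsub.trans h⟩

namespace PolytopalMesh

variable {Ω : Set (Euc d)} (M : PolytopalMesh Ω)

theorem cell_subset_closure (T : M.cells) : (T : Set (Euc d)) ⊆ closure Ω := by
  rw [← M.iUnion_cells]
  exact subset_biUnion_of_mem (u := fun T => T) T.2

theorem isCompact_cell (T : M.cells) : IsCompact (T : Set (Euc d)) :=
  (M.cell_isPolytope T T.2).isCompact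

theorem isClosed_face (e : M.faces) : IsClosed (e : Set (Euc d)) :=
  (M.face_isPolytope e e.2).isCompact.isClosed

theorem interior_cell_subset (hΩ : IsPolytopalDomain Ω) (T : M.cells) :
    interior (T : Set (Euc d)) ⊆ Ω :=
  (interior_mono (M.cell_subset_closure T)).trans hΩ.interior_closure.subset

theorem face_subset_cell {T : M.cells} {e : M.faces} (he : e ∈ M.facesOf T) :
    (e : Set (Euc d)) ⊆ T :=
  (M.mem_facesOf.1 he).trans (M.isCompact_cell T).isClosed.frontier_subset

theorem integrableOn_cell (hΩ : IsPolytopalDomain Ω) (T : M.cells) {g : Euc d → ℝ}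
    (hg : IntegrableOn g Ω) : IntegrableOn g T := by
  have h1 : IntegrableOn g (closure Ω) := by
    rw [← union_sdiff_cancel (subset_closure : Ω ⊆ closure Ω)]
    exact hg.union (IntegrableOn.of_measure_zero (volume_frontier_closure_of_isPolytopalDomain hΩ))
  exact h1.mono_set (M.cell_subset_closure T)

theorem integrableOn_face (hd : 0 < d) (e : M.faces) {F : Euc d → ℝ}
    (hF : ContinuousOn F e) :
    IntegrableOn F (e : Set (Euc d)) (μHE[d - 1] : Measure (Euc d)) :=
  (M.face_isPolytope e e.2).integrableOn_surface hd hF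

/-- There are cut-off functions for the union of the relative boundaries of the faces. -/
theorem exists_isNegligible (hd : 2 ≤ d) :
    ∃ S : Set (Euc d), IsNegligible S ∧ ∀ e ∈ M.faces, intrinsicFrontier ℝ e ⊆ S := by
  classical
  have key : ∀ s : Finset (Set (Euc d)), s ⊆ M.faces →
      ∃ S : Set (Euc d), IsNegligible S ∧ ∀ e ∈ s, intrinsicFrontier ℝ e ⊆ S := by
    intro s
    induction s using Finset.induction_on with
    | empty => exact fun _ => ⟨∅, IsNegligible.empty, by simp⟩
    | insert e s he ih =>
      intro hs
      obtain ⟨S, hS, h⟩ := ih fun e' he' => hs (Finset.mem_insert_of_mem he')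
      obtain ⟨S', hS', h'⟩ := (M.face_isPolytope e
        (hs (Finset.mem_insert_self _ _))).exists_isNegligible hd
      refine ⟨S ∪ S', hS.union hS', fun e' he' => ?_⟩
      rcases Finset.mem_insert.1 he' with rfl | he'
      · exact h'.trans subset_union_right
      · exact (h e' he').trans subset_union_left
  exact key M.faces subset_rfl

/-- The difference of the two sides of Green's formula
`(g, ∂ᵢφ)_T + (∂ᵢg, φ)_T = ⟨g nᵢ, φ⟩_{∂T}`, where `g'` stands for `∂ᵢg`. -/
def greenDefect (T : M.cells) (i : Fin d) (g g' φ : Euc d → ℝ) : ℝ :=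
  (∫ y in (T : Set (Euc d)), g y * fderiv ℝ φ y (EuclideanSpace.single i 1)) +
    (∫ y in (T : Set (Euc d)), g' y * φ y) -
    M.boundaryIntegral T fun e y => g y * φ y * M.normal T e i

theorem integrableOn_mul_fderiv (T : M.cells) (i : Fin d) {g φ : Euc d → ℝ} (hg : Continuous g)
    (hφ : ContDiff ℝ ∞ φ) :
    IntegrableOn (fun y => g y * fderiv ℝ φ y (EuclideanSpace.single i 1)) T := by
  have h1 : Continuous fun y => fderiv ℝ φ y (EuclideanSpace.single i 1) :=
    (hφ.continuous_fderiv (by simp)).clm_apply continuous_const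
  exact (hg.mul h1).continuousOn.integrableOn_compact (M.isCompact_cell T)

theorem integrableOn_mul_continuousOn (T : M.cells) {g' φ : Euc d → ℝ} (hg' : IntegrableOn g' T)
    (hφ : ContinuousOn φ T) : IntegrableOn (fun y => g' y * φ y) T := by
  exact hg'.mul_continuousOn hφ (M.isCompact_cell T)

theorem greenDefect_add (hd : 0 < d) (T : M.cells) (i : Fin d) {g g' : Euc d → ℝ}
    (hg : Continuous g) (hg' : IntegrableOn g' T) {φ ψ : Euc d → ℝ} (hφ : ContDiff ℝ ∞ φ)
    (hψ : ContDiff ℝ ∞ ψ) :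
    M.greenDefect T i g g' (φ + ψ) = M.greenDefect T i g g' φ + M.greenDefect T i g g' ψ := by
  have h1 : ∀ y, g y * fderiv ℝ (φ + ψ) y (EuclideanSpace.single i 1) =
      g y * fderiv ℝ φ y (EuclideanSpace.single i 1) +
        g y * fderiv ℝ ψ y (EuclideanSpace.single i 1) := fun y => by
    rw [fderiv_add (hφ.differentiable (by simp) y) (hψ.differentiable (by simp) y),
      _root_.add_apply, mul_add]
  have h2 : ∀ y, g' y * (φ + ψ) y = g' y * φ y + g' y * ψ y := fun y => by
    rw [Pi.add_apply, mul_add]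
  have h3 : (M.boundaryIntegral T fun e y => g y * (φ + ψ) y * M.normal T e i) =
      (M.boundaryIntegral T fun e y => g y * φ y * M.normal T e i) +
        M.boundaryIntegral T fun e y => g y * ψ y * M.normal T e i := by
    rw [boundaryIntegral, boundaryIntegral, boundaryIntegral, ← Finset.sum_add_distrib]
    refine Finset.sum_congr rfl fun e _ => ?_
    rw [← integral_add]
    · refine integral_congr_ae (Eventually.of_forall fun y => ?_)
      simp only [Pi.add_apply]; ring
    · exact M.integrableOn_face hd e ((hg.mul hφ.continuous).mul continuous_const).continuousOn
    · exact M.integrableOn_face hd e ((hg.mul hψ.continuous).mul continuous_const).continuousOn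
  simp only [greenDefect, h1, h2]
  rw [h3, integral_add (M.integrableOn_mul_fderiv T i hg hφ) (M.integrableOn_mul_fderiv T i hg hψ),
    integral_add (M.integrableOn_mul_continuousOn T hg' hφ.continuous.continuousOn)
      (M.integrableOn_mul_continuousOn T hg' hψ.continuous.continuousOn)]
  ring

/-- Green's formula for test functions whose support avoids the relative boundaries of the
faces. -/
theorem greenDefect_eq_zero_of_disjoint (hd : 0 < d) (hΩ : IsPolytopalDomain Ω) (T : M.cells)
    {i : Fin d} {g g' : Euc d → ℝ} (hg : Continuous g) (hw : IsWeakPartial Ω i g g')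
    (hg' : IntegrableOn g' T) {φ : Euc d → ℝ} (hφ : ContDiff ℝ ∞ φ) (hφc : HasCompactSupport φ)
    (hS : ∀ e ∈ M.faces, Disjoint (tsupport φ) (intrinsicFrontier ℝ e)) :
    M.greenDefect T i g g' φ = 0 := by
  have hTP := M.cell_isPolytope T T.2
  have hTcl : IsClosed (T : Set (Euc d)) := (M.isCompact_cell T).isClosed
  refine eq_zero_of_locally_eq_zero (Λ := M.greenDefect T i g g')
    (fun φ ψ hφ _ hψ _ => M.greenDefect_add hd T i hg hg' hφ hψ) hφ hφc fun x hx => ?_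
  -- a face disjoint from the support does not contribute
  have hface : ∀ (θ : Euc d → ℝ) (e : M.faces), Disjoint (tsupport θ) (e : Set (Euc d)) → ∀ c : ℝ,
      ∫ y in (e : Set (Euc d)), g y * θ y * c ∂(μHE[d - 1] : Measure (Euc d)) = 0 := by
    intro θ e hdisj c
    refine setIntegral_eq_zero_of_forall_eq_zero fun y hy => ?_
    rw [image_eq_zero_of_notMem_tsupport fun h => Set.disjoint_left.1 hdisj h hy]
    ring
  by_cases hxT : x ∈ (T : Set (Euc d))
  swap
  · refine ⟨(T : Set (Euc d))ᶜ, hTcl.isOpen_compl, hxT, fun θ hθ hθc hθs => ?_⟩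
    have hz : ∀ y ∈ (T : Set (Euc d)), y ∉ tsupport θ := fun y hy h => hθs h hy
    rw [greenDefect, boundaryIntegral, Finset.sum_eq_zero fun e he => hface θ e
        (Set.disjoint_left.2 fun y hy hye => hz y (M.face_subset_cell he hye) hy) _,
      setIntegral_eq_zero_of_forall_eq_zero fun y hy => by
        rw [fderiv_of_notMem_tsupport ℝ (hz y hy), _root_.zero_apply, mul_zero],
      setIntegral_eq_zero_of_forall_eq_zero fun y hy => by
        rw [image_eq_zero_of_notMem_tsupport (hz y hy), mul_zero]]
    norm_num
  by_cases hxi : x ∈ interior (T : Set (Euc d))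
  · refine ⟨_, isOpen_interior, hxi, fun θ hθ hθc hθs => ?_⟩
    have hz : ∀ y ∉ interior (T : Set (Euc d)), y ∉ tsupport θ := fun y hy h => hy (hθs h)
    have hz1 : ∀ y ∉ interior (T : Set (Euc d)),
        g y * fderiv ℝ θ y (EuclideanSpace.single i 1) = 0 := fun y hy => by
      rw [fderiv_of_notMem_tsupport ℝ (hz y hy), _root_.zero_apply, mul_zero]
    have hz2 : ∀ y ∉ interior (T : Set (Euc d)), g' y * θ y = 0 := fun y hy => by
      rw [image_eq_zero_of_notMem_tsupport (hz y hy), mul_zero]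
    have hsub := M.interior_cell_subset hΩ T
    have h := hw.integral_eq θ hθ hθc (hθs.trans hsub)
    rw [setIntegral_eq_of_subset_of_forall_sdiff_eq_zero hΩ.isOpen.measurableSet hsub
        fun y hy => hz1 y hy.2,
      setIntegral_eq_of_subset_of_forall_sdiff_eq_zero hΩ.isOpen.measurableSet hsub
        fun y hy => hz2 y hy.2] at h
    rw [greenDefect, boundaryIntegral, Finset.sum_eq_zero fun e he => hface θ e
        (Set.disjoint_left.2 fun y hy hye => (M.mem_facesOf.1 he hye).2 (hθs hy)) _,
      setIntegral_eq_of_subset_of_forall_sdiff_eq_zero hTcl.measurableSet interior_subset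
        fun y hy => hz1 y hy.2,
      setIntegral_eq_of_subset_of_forall_sdiff_eq_zero hTcl.measurableSet interior_subset
        fun y hy => hz2 y hy.2, h]
    ring
  · have hxfr : x ∈ frontier (T : Set (Euc d)) := ⟨subset_closure hxT, hxi⟩
    rw [M.frontier_cell T T.2, mem_iUnion₂] at hxfr
    obtain ⟨e, ⟨he, heT⟩, hxe⟩ := hxfr
    have hxint : x ∈ intrinsicInterior ℝ e := by
      have hcl := (M.face_isPolytope e he).isCompact.isClosed
      rw [← hcl.intrinsicInterior_union_frontier] at hxe
      exact hxe.resolve_right fun h => Set.disjoint_left.1 (hS e he) hx h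
    let e₀ : M.faces := ⟨e, he⟩
    have he₀ : e₀ ∈ M.facesOf T := M.mem_facesOf.2 heT
    have hN := M.isOutwardUnitNormal_normal hd he₀
    obtain ⟨r, hr⟩ := M.exists_isHalfBallAt T.2 he heT hN hxint
    obtain ⟨s, hs, -, hdisj⟩ := M.exists_ball_faces he hxint
    have hr' := hr.mono_radius (lt_min hr.pos hs) (min_le_left r s)
    refine ⟨Metric.ball x (min r s), Metric.isOpen_ball, Metric.mem_ball_self hr'.pos,
      fun θ hθ hθc hθs => ?_⟩
    have hG := green_halfBall hΩ.isOpen hTcl (M.isClosed_face e₀) (M.interior_cell_subset hΩ T)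
      hTP.volume_frontier hN.norm_eq_one hr' heT hg hw hg' hθ hθc hθs
    rw [greenDefect, hG, boundaryIntegral, Finset.sum_eq_single_of_mem e₀ he₀ fun e' _ hne =>
      hface θ e' (((hdisj e' e'.2 fun h => hne (Subtype.ext h)).mono_left
        (Metric.ball_subset_ball (min_le_right _ _))).mono_left hθs) _]
    rw [integral_mul_const]
    ring

/-- Green's formula on an element. The cut-off functions for the relative boundaries of the faces
reduce it to test functions supported away from these boundaries. -/
theorem green (hd : 2 ≤ d) (hΩ : IsPolytopalDomain Ω) (T : M.cells)
    {i : Fin d} {g g' : Euc d → ℝ} (hg : Continuous g) (hw : IsWeakPartial Ω i g g')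
    (hg' : IntegrableOn g' T) {φ : Euc d → ℝ} (hφ : ContDiff ℝ ∞ φ) (hφc : HasCompactSupport φ) :
    (∫ y in (T : Set (Euc d)), g y * fderiv ℝ φ y (EuclideanSpace.single i 1)) +
      (∫ y in (T : Set (Euc d)), g' y * φ y) =
      M.boundaryIntegral T fun e y => g y * φ y * M.normal T e i := by
  have hd0 : 0 < d := by omega
  obtain ⟨S, ⟨⟨ψ, hψ⟩, hvol, hsurf⟩, hS⟩ := M.exists_isNegligible hd
  set v : Euc d := EuclideanSpace.single i 1 with hv
  have hzero : ∀ j, (∫ y in (T : Set (Euc d)), (g y * fderiv ℝ φ y v) * ψ j y) +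
      (∫ y in (T : Set (Euc d)), (g y * φ y) * fderiv ℝ (ψ j) y v) +
      (∫ y in (T : Set (Euc d)), (g' y * φ y) * ψ j y) -
      (∑ e ∈ M.facesOf T, ∫ y in (e : Set (Euc d)), (g y * φ y * M.normal T e i) * ψ j y
        ∂(μHE[d - 1] : Measure (Euc d))) = 0 := by
    intro j
    have h := M.greenDefect_eq_zero_of_disjoint hd0 hΩ T hg hw hg' (φ := fun y => φ y * ψ j y)
      (hφ.mul (hψ.contDiff j)) hφc.mul_right fun e he =>
        ((hψ.disjoint j).mono_left tsupport_mul_subset_right).mono_right (hS e he)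
    have hfd : ∀ y, g y * fderiv ℝ (fun y => φ y * ψ j y) y (EuclideanSpace.single i 1) =
        (g y * fderiv ℝ φ y v) * ψ j y + (g y * φ y) * fderiv ℝ (ψ j) y v := fun y => by
      rw [fderiv_fun_mul (hφ.differentiable (by simp) y)
        ((hψ.contDiff j).differentiable (by simp) y)]
      simp only [_root_.add_apply, _root_.smul_apply, smul_eq_mul, ← hv]
      ring
    rw [greenDefect, boundaryIntegral] at h
    simp only [hfd] at h
    rw [integral_add] at h
    · rw [← h]
      congr 1
      · simp only [mul_assoc]
      · refine Finset.sum_congr rfl fun e _ => integral_congr_ae (Eventually.of_forall fun y => ?_)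
        simp only; ring
    · exact (M.integrableOn_mul_fderiv T i hg hφ).mul_continuousOn
        (hψ.contDiff j).continuous.continuousOn (M.isCompact_cell T)
    · exact M.integrableOn_mul_fderiv T i (hg.mul hφ.continuous) (hψ.contDiff j)
  -- dominated convergence for the terms without derivatives of the cut-off functions
  have hdom : ∀ (μ : Measure (Euc d)) (F : Euc d → ℝ), Integrable F μ → μ S = 0 →
      Tendsto (fun j => ∫ y, F y * ψ j y ∂μ) atTop (𝓝 (∫ y, F y ∂μ)) := by
    intro μ F hF hμS
    refine tendsto_integral_of_dominated_convergence (fun y => ‖F y‖)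
      (fun j => hF.1.mul (hψ.contDiff j).continuous.aestronglyMeasurable) hF.norm
      (fun j => Eventually.of_forall fun y => ?_) ?_
    · rw [norm_mul]
      exact mul_le_of_le_one_right (norm_nonneg _) (hψ.abs_le_one j y)
    · filter_upwards [measure_eq_zero_iff_ae_notMem.1 hμS] with y hy
      simpa using (hψ.tendsto_one y hy).const_mul (F y)
  have hres : ∀ (μ : Measure (Euc d)) (A : Set (Euc d)), μ S = 0 → (μ.restrict A) S = 0 :=
    fun μ A h => le_antisymm ((Measure.restrict_apply_le _ _).trans h.le) bot_le
  have l1 := hdom (volume.restrict T) _ (M.integrableOn_mul_fderiv T i hg hφ) (hres _ _ hvol)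
  have l2 := hdom (volume.restrict T) _ (M.integrableOn_mul_continuousOn T hg'
    hφ.continuous.continuousOn) (hres _ _ hvol)
  have l3 : Tendsto (fun j => ∑ e ∈ M.facesOf T, ∫ y in (e : Set (Euc d)),
      (g y * φ y * M.normal T e i) * ψ j y ∂(μHE[d - 1] : Measure (Euc d))) atTop
      (𝓝 (M.boundaryIntegral T fun e y => g y * φ y * M.normal T e i)) :=
    tendsto_finsetSum _ fun e _ => hdom _ _
      (M.integrableOn_face hd0 e ((hg.mul hφ.continuous).mul continuous_const).continuousOn)
      (hres _ _ hsurf)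
  have l4 : Tendsto (fun j => ∫ y in (T : Set (Euc d)), (g y * φ y) * fderiv ℝ (ψ j) y v) atTop
      (𝓝 0) := by
    obtain ⟨C, hC⟩ := hφc.mul_left.exists_bound_of_continuous (hg.mul hφ.continuous)
    obtain ⟨R, hR⟩ := (M.isCompact_cell T).isBounded.subset_closedBall 0
    have hlim := (hψ.tendsto_fderiv R).const_mul C
    rw [mul_zero] at hlim
    have hv1 : ‖v‖ = 1 := by rw [hv, PiLp.norm_single, norm_one]
    have hC0 : 0 ≤ C := (norm_nonneg _).trans (hC 0)
    refine squeeze_zero_norm (fun j => ?_) hlim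
    have hint : IntegrableOn (fun y => C * ‖fderiv ℝ (ψ j) y‖) (Metric.closedBall (0 : Euc d) R) :=
      (continuous_const.mul (hψ.continuous_fderiv j).norm).continuousOn.integrableOn_compact
        (isCompact_closedBall _ _)
    rw [← integral_const_mul]
    refine (norm_integral_le_of_norm_le (hint.mono_set hR) (Eventually.of_forall fun y => ?_)).trans
      (setIntegral_mono_set hint (Eventually.of_forall fun y =>
        mul_nonneg hC0 (norm_nonneg _)) hR.eventuallyLE)
    rw [norm_mul]
    refine mul_le_mul (hC y) ?_ (norm_nonneg _) hC0
    have := (fderiv ℝ (ψ j) y).le_opNorm v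
    rwa [hv1, mul_one] at this
  have hlim := ((l1.add l4).add l2).sub l3
  have := tendsto_nhds_unique hlim (tendsto_const_nhds.congr fun j => (hzero j).symm)
  rw [add_zero] at this
  linarith

end PolytopalMesh

end Green

/-! ### Polynomials on elements -/

section Poly

variable {d : ℕ}

@[simp]
theorem polyEval_zero (x : Euc d) : polyEval 0 x = 0 := by simp [polyEval]

@[simp]
theorem polyEval_C (a : ℝ) (x : Euc d) : polyEval (MvPolynomial.C a) x = a := by simp [polyEval]

@[simp]
theorem polyEval_X (i : Fin d) (x : Euc d) : polyEval (MvPolynomial.X i) x = x i := by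
  simp [polyEval]

@[simp]
theorem polyEval_add (p q : MvPolynomial (Fin d) ℝ) (x : Euc d) :
    polyEval (p + q) x = polyEval p x + polyEval q x := by simp [polyEval]

@[simp]
theorem polyEval_mul (p q : MvPolynomial (Fin d) ℝ) (x : Euc d) :
    polyEval (p * q) x = polyEval p x * polyEval q x := by simp [polyEval]

@[simp]
theorem polyEval_smul (a : ℝ) (p : MvPolynomial (Fin d) ℝ) (x : Euc d) :
    polyEval (a • p) x = a * polyEval p x := by simp [polyEval]

theorem contDiff_polyEval (p : MvPolynomial (Fin d) ℝ) : ContDiff ℝ ∞ (polyEval p) := by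
  induction p using MvPolynomial.induction_on with
  | C a => simp only [funext (polyEval_C a)]; exact contDiff_const
  | add p q hp hq => simp only [funext (polyEval_add p q)]; exact hp.add hq
  | mul_X p i hp =>
    simp only [funext (polyEval_mul p _), polyEval_X]
    exact hp.mul (EuclideanSpace.proj (𝕜 := ℝ) i).contDiff

@[fun_prop]
theorem continuous_polyEval (p : MvPolynomial (Fin d) ℝ) : Continuous (polyEval p) :=
  (contDiff_polyEval p).continuous

theorem fderiv_polyEval (p : MvPolynomial (Fin d) ℝ) (i : Fin d) (x : Euc d) :
    fderiv ℝ (polyEval p) x (EuclideanSpace.single i 1) =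
      polyEval (MvPolynomial.pderiv i p) x := by
  have hdiff : ∀ p : MvPolynomial (Fin d) ℝ, DifferentiableAt ℝ (polyEval p) x := fun p =>
    (contDiff_polyEval p).differentiable (by simp) x
  induction p using MvPolynomial.induction_on with
  | C a => simp [funext (polyEval_C a)]
  | add p q hp hq =>
    rw [funext (polyEval_add p q), fderiv_fun_add (hdiff p) (hdiff q), _root_.add_apply, hp, hq,
      map_add, polyEval_add]
  | mul_X p j hp =>
    have hX : fderiv ℝ (polyEval (MvPolynomial.X j)) x = EuclideanSpace.proj (𝕜 := ℝ) j := by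
      rw [funext (polyEval_X j)]
      exact (EuclideanSpace.proj (𝕜 := ℝ) j).fderiv
    rw [funext (polyEval_mul p _), fderiv_fun_mul (hdiff p) (hdiff _), hX, _root_.add_apply,
      _root_.smul_apply, _root_.smul_apply, hp, Derivation.leibniz, polyEval_add, smul_eq_mul,
      smul_eq_mul, smul_eq_mul, smul_eq_mul, polyEval_mul, polyEval_mul, MvPolynomial.pderiv_X]
    by_cases hij : i = j
    · subst hij; simp [polyEval]
    · simp [Ne.symm hij]

theorem eq_zero_of_polyEval_eq_zero {p : MvPolynomial (Fin d) ℝ} {U : Set (Euc d)}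
    (hU : IsOpen U) (hne : U.Nonempty) (h : ∀ x ∈ U, polyEval p x = 0) : p = 0 := by
  obtain ⟨x, hx⟩ := hne
  have hU' : IsOpen ((WithLp.toLp 2 : (Fin d → ℝ) → Euc d) ⁻¹' U) :=
    hU.preimage (PiLp.continuous_toLp 2 _)
  obtain ⟨r, hr, hball⟩ := Metric.isOpen_iff.1 hU' x.ofLp hx
  rw [ball_pi _ hr] at hball
  refine MvPolynomial.funext_set (fun i => Metric.ball (x i) r) (fun i => ?_) fun y hy => ?_
  · rw [Real.ball_eq_Ioo]
    exact Set.Ioo_infinite (by linarith)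
  · have := h _ (hball hy)
    rw [map_zero]
    exact this

/-- A polynomial is determined by its values on a `d`-dimensional polytope, even up to null
sets. -/
theorem IsPolytope.eq_zero_of_setIntegral_sq {T : Set (Euc d)} (hT : IsPolytope d T)
    {p : MvPolynomial (Fin d) ℝ} (h : ∫ x in T, polyEval p x * polyEval p x = 0) : p = 0 := by
  have hc : Continuous fun x => polyEval p x * polyEval p x := by fun_prop
  rw [setIntegral_eq_zero_iff_of_nonneg_ae (Eventually.of_forall fun x => mul_self_nonneg _)
    (hc.continuousOn.integrableOn_compact hT.isCompact)] at h
  have h2 : (fun x => polyEval p x * polyEval p x) =ᵐ[volume.restrict (interior T)] fun _ => 0 :=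
    ae_restrict_of_ae_restrict_of_subset interior_subset h
  have h3 := Measure.eqOn_open_of_ae_eq h2 isOpen_interior hc.continuousOn continuousOn_const
  exact eq_zero_of_polyEval_eq_zero isOpen_interior hT.nonempty_interior fun x hx =>
    mul_self_eq_zero.1 (h3 hx)

/-- In finite dimensions a definite bilinear form represents every linear functional. -/
theorem existsUnique_of_definite {W : Type*} [AddCommGroup W] [Module ℝ W]
    [FiniteDimensional ℝ W] (A : W →ₗ[ℝ] W →ₗ[ℝ] ℝ) (hA : ∀ u, A u u = 0 → u = 0)
    (F : W →ₗ[ℝ] ℝ) : ∃! u, A u = F := by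
  have hinj : Function.Injective A := by
    rw [injective_iff_map_eq_zero]
    exact fun u hu => hA u (by rw [hu]; rfl)
  have hsurj : Function.Surjective A :=
    (LinearMap.injective_iff_surjective_of_finrank_eq_finrank
      (Subspace.dual_finrank_eq (K := ℝ) (V := W)).symm).1 hinj
  obtain ⟨u, hu⟩ := hsurj F
  exact ⟨u, hu, fun w hw => hinj (hw.trans hu.symm)⟩

/-- Riesz representation in the space of polynomials of degree at most `r`, with the inner product
of `L²(T)`. -/
theorem IsPolytope.exists_riesz {T : Set (Euc d)} (hT : IsPolytope d T) (r : ℕ)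
    (ℓ : MvPolynomial (Fin d) ℝ →ₗ[ℝ] ℝ) :
    ∃ D : MvPolynomial (Fin d) ℝ, D.totalDegree ≤ r ∧ ∀ w : MvPolynomial (Fin d) ℝ,
      w.totalDegree ≤ r → ∫ x in T, polyEval D x * polyEval w x = ℓ w := by
  let W := MvPolynomial.restrictTotalDegree (Fin d) ℝ r
  have hint : ∀ p q : MvPolynomial (Fin d) ℝ,
      IntegrableOn (fun x => polyEval p x * polyEval q x) T := fun p q =>
    (Continuous.continuousOn (by fun_prop)).integrableOn_compact hT.isCompact
  let B : W →ₗ[ℝ] W →ₗ[ℝ] ℝ := LinearMap.mk₂ ℝ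
    (fun p q => ∫ x in T, polyEval (p : MvPolynomial (Fin d) ℝ) x *
      polyEval (q : MvPolynomial (Fin d) ℝ) x)
    (fun p p' q => by
      simp only [Submodule.coe_add, polyEval_add, add_mul]
      exact integral_add (hint _ _) (hint _ _))
    (fun a p q => by
      simp only [Submodule.coe_smul, polyEval_smul, mul_assoc, smul_eq_mul]
      exact integral_const_mul _ _)
    (fun p q q' => by
      simp only [Submodule.coe_add, polyEval_add, mul_add]
      exact integral_add (hint _ _) (hint _ _))
    (fun a p q => by
      simp only [Submodule.coe_smul, polyEval_smul, mul_left_comm _ a, smul_eq_mul]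
      exact integral_const_mul _ _)
  obtain ⟨D, hD, -⟩ := existsUnique_of_definite B
    (fun p hp => Subtype.ext (hT.eq_zero_of_setIntegral_sq hp)) (ℓ ∘ₗ W.subtype)
  refine ⟨D, (MvPolynomial.mem_restrictTotalDegree _ _ _).1 D.2, fun w hw => ?_⟩
  exact LinearMap.congr_fun hD ⟨w, (MvPolynomial.mem_restrictTotalDegree _ _ _).2 hw⟩

end Poly

/-! ### Weak gradient and weak divergence -/

section WeakOperators

variable {d : ℕ} {Ω : Set (Euc d)}

namespace PolytopalMesh

variable (M : PolytopalMesh Ω)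

theorem exists_poly_cell {k q : ℕ} {v : M.WeakFun} (hv : v ∈ M.V k q) (T : M.cells) :
    ∃ p : MvPolynomial (Fin d) ℝ, p.totalDegree ≤ k ∧
      v.1 T = (T : Set (Euc d)).indicator (polyEval p) := by
  have h := hv.1 T (mem_univ T)
  exact h

theorem exists_poly_face {k q : ℕ} {v : M.WeakFun} (hv : v ∈ M.V k q) (e : M.faces) :
    ∃ p : MvPolynomial (Fin d) ℝ, p.totalDegree ≤ q ∧
      v.2 e = (e : Set (Euc d)).indicator (polyEval p) := by
  have h := hv.2 e (mem_univ e)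
  exact h

theorem continuousOn_cell {k q : ℕ} {v : M.WeakFun} (hv : v ∈ M.V k q) (T : M.cells) :
    ContinuousOn (v.1 T) T := by
  obtain ⟨p, -, hp⟩ := M.exists_poly_cell hv T
  rw [hp]
  exact (continuous_polyEval p).continuousOn.congr fun x hx => indicator_of_mem hx _

theorem continuousOn_face {k q : ℕ} {v : M.WeakFun} (hv : v ∈ M.V k q) (e : M.faces) :
    ContinuousOn (v.2 e) e := by
  obtain ⟨p, -, hp⟩ := M.exists_poly_face hv e
  rw [hp]
  exact (continuous_polyEval p).continuousOn.congr fun x hx => indicator_of_mem hx _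

theorem integrableOn_of_continuousOn (T : M.cells) {F : Euc d → ℝ} (hF : ContinuousOn F T) :
    IntegrableOn F (T : Set (Euc d)) :=
  hF.integrableOn_compact (M.isCompact_cell T)

theorem boundaryIntegral_smul_add (hd : 0 < d) (T : M.cells) (a : ℝ)
    {F G : M.faces → Euc d → ℝ} (hF : ∀ e ∈ M.facesOf T, ContinuousOn (F e) e)
    (hG : ∀ e ∈ M.facesOf T, ContinuousOn (G e) e) :
    (M.boundaryIntegral T fun e x => a * F e x + G e x) =
      a * M.boundaryIntegral T F + M.boundaryIntegral T G := by
  rw [boundaryIntegral, boundaryIntegral, boundaryIntegral, Finset.mul_sum,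
    ← Finset.sum_add_distrib]
  refine Finset.sum_congr rfl fun e he => ?_
  rw [integral_add ((M.integrableOn_face hd e (hF e he)).const_mul a)
    (M.integrableOn_face hd e (hG e he)), integral_const_mul]

theorem boundaryIntegral_congr (T : M.cells) {F G : M.faces → Euc d → ℝ}
    (h : ∀ e ∈ M.facesOf T, ∀ x ∈ (e : Set (Euc d)), F e x = G e x) :
    M.boundaryIntegral T F = M.boundaryIntegral T G := by
  rw [boundaryIntegral, boundaryIntegral]
  exact Finset.sum_congr rfl fun e he =>
    setIntegral_congr_fun (M.isClosed_face e).measurableSet (h e he)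

/-- The functional `w ↦ -(b v₀, ∇w)_T + ⟨(b · n) v_b, w⟩_{∂T}` that the weak divergence
represents. -/
def weakDivFunctional (b : Euc d → Euc d) (T : M.cells) (v : M.WeakFun)
    (w : MvPolynomial (Fin d) ℝ) : ℝ :=
  -(∫ x in (T : Set (Euc d)), ∑ i, b x i * v.1 T x * polyEval (MvPolynomial.pderiv i w) x) +
    M.boundaryIntegral T fun e x => inner ℝ (b x) (M.normal T e) * v.2 e x * polyEval w x

variable {b : Euc d → Euc d} {T : M.cells} {k q : ℕ}

theorem continuousOn_coord {S : Set (Euc d)} (hb : ContinuousOn b S) (i : Fin d) :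
    ContinuousOn (fun x => b x i) S :=
  (EuclideanSpace.proj (𝕜 := ℝ) i).continuous.comp_continuousOn hb

theorem continuousOn_divIntegrand (hb : ContinuousOn b T) {v : M.WeakFun} (hv : v ∈ M.V k q)
    (w : MvPolynomial (Fin d) ℝ) :
    ContinuousOn (fun x => ∑ i, b x i * v.1 T x * polyEval (MvPolynomial.pderiv i w) x) T :=
  continuousOn_finsetSum _ fun i _ =>
    ((continuousOn_coord hb i).mul (M.continuousOn_cell hv T)).mul
      (continuous_polyEval _).continuousOn

theorem continuousOn_divBoundaryIntegrand (hb : ContinuousOn b T) {v : M.WeakFun}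
    (hv : v ∈ M.V k q) (w : MvPolynomial (Fin d) ℝ) {e : M.faces} (he : e ∈ M.facesOf T) :
    ContinuousOn (fun x => inner ℝ (b x) (M.normal T e) * v.2 e x * polyEval w x) e :=
  (((hb.mono (M.face_subset_cell he)).inner continuousOn_const).mul
    (M.continuousOn_face hv e)).mul (continuous_polyEval _).continuousOn

theorem weakDivFunctional_smul_add_left (hd : 0 < d) (hb : ContinuousOn b T) {u v : M.WeakFun}
    (hu : u ∈ M.V k q) (hv : v ∈ M.V k q) (a : ℝ) (w : MvPolynomial (Fin d) ℝ) :
    M.weakDivFunctional b T (a • u + v) w =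
      a * M.weakDivFunctional b T u w + M.weakDivFunctional b T v w := by
  have h1 : ∀ x, ∑ i, b x i * (a • u + v).1 T x * polyEval (MvPolynomial.pderiv i w) x =
      a * (∑ i, b x i * u.1 T x * polyEval (MvPolynomial.pderiv i w) x) +
        ∑ i, b x i * v.1 T x * polyEval (MvPolynomial.pderiv i w) x := fun x => by
    rw [Finset.mul_sum, ← Finset.sum_add_distrib]
    refine Finset.sum_congr rfl fun i _ => ?_
    simp only [Prod.fst_add, Prod.smul_fst, Pi.add_apply, Pi.smul_apply, smul_eq_mul]
    ring
  have h2 : (M.boundaryIntegral T fun e x =>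
      inner ℝ (b x) (M.normal T e) * (a • u + v).2 e x * polyEval w x) =
      M.boundaryIntegral T fun e x =>
        a * (inner ℝ (b x) (M.normal T e) * u.2 e x * polyEval w x) +
          inner ℝ (b x) (M.normal T e) * v.2 e x * polyEval w x := by
    refine M.boundaryIntegral_congr T fun e _ x _ => ?_
    simp only [Prod.snd_add, Prod.smul_snd, Pi.add_apply, Pi.smul_apply, smul_eq_mul]
    ring
  simp only [weakDivFunctional, h1, h2]
  rw [M.boundaryIntegral_smul_add hd T a
      (fun e he => M.continuousOn_divBoundaryIntegrand hb hu w he)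
      (fun e he => M.continuousOn_divBoundaryIntegrand hb hv w he),
    integral_add ((M.integrableOn_of_continuousOn T
      (M.continuousOn_divIntegrand hb hu w)).const_mul a)
      (M.integrableOn_of_continuousOn T (M.continuousOn_divIntegrand hb hv w)),
    integral_const_mul]
  ring

theorem weakDivFunctional_smul_add_right (hd : 0 < d) (hb : ContinuousOn b T) {v : M.WeakFun}
    (hv : v ∈ M.V k q) (a : ℝ) (w w' : MvPolynomial (Fin d) ℝ) :
    M.weakDivFunctional b T v (a • w + w') =
      a * M.weakDivFunctional b T v w + M.weakDivFunctional b T v w' := by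
  have h1 : ∀ x, ∑ i, b x i * v.1 T x * polyEval (MvPolynomial.pderiv i (a • w + w')) x =
      a * (∑ i, b x i * v.1 T x * polyEval (MvPolynomial.pderiv i w) x) +
        ∑ i, b x i * v.1 T x * polyEval (MvPolynomial.pderiv i w') x := fun x => by
    rw [Finset.mul_sum, ← Finset.sum_add_distrib]
    refine Finset.sum_congr rfl fun i _ => ?_
    rw [map_add, Derivation.map_smul, polyEval_add, polyEval_smul]
    ring
  have h2 : (M.boundaryIntegral T fun e x =>
      inner ℝ (b x) (M.normal T e) * v.2 e x * polyEval (a • w + w') x) =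
      M.boundaryIntegral T fun e x =>
        a * (inner ℝ (b x) (M.normal T e) * v.2 e x * polyEval w x) +
          inner ℝ (b x) (M.normal T e) * v.2 e x * polyEval w' x := by
    refine M.boundaryIntegral_congr T fun e _ x _ => ?_
    rw [polyEval_add, polyEval_smul]
    ring
  simp only [weakDivFunctional, h1, h2]
  rw [M.boundaryIntegral_smul_add hd T a
      (fun e he => M.continuousOn_divBoundaryIntegrand hb hv w he)
      (fun e he => M.continuousOn_divBoundaryIntegrand hb hv w' he),
    integral_add ((M.integrableOn_of_continuousOn T
      (M.continuousOn_divIntegrand hb hv w)).const_mul a)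
      (M.integrableOn_of_continuousOn T (M.continuousOn_divIntegrand hb hv w')),
    integral_const_mul]
  ring

theorem exists_isWeakDivergence (hd : 0 < d) (hb : ContinuousOn b T) {v : M.WeakFun}
    (hv : v ∈ M.V k q) (r : ℕ) : ∃ D, M.IsWeakDivergence b r T v D := by
  have hadd := M.weakDivFunctional_smul_add_right hd hb hv
  have h0 : M.weakDivFunctional b T v 0 = 0 := by
    have := hadd 1 0 0
    rw [smul_zero, add_zero, one_mul] at this
    linarith
  let ℓ : MvPolynomial (Fin d) ℝ →ₗ[ℝ] ℝ :=
    { toFun := M.weakDivFunctional b T v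
      map_add' := fun w w' => by simpa using hadd 1 w w'
      map_smul' := fun a w => by simpa [h0] using hadd a w 0 }
  exact (M.cell_isPolytope T T.2).exists_riesz r ℓ

theorem IsWeakDivergence.unique {r : ℕ} {v : M.WeakFun} {D D' : MvPolynomial (Fin d) ℝ}
    (h : M.IsWeakDivergence b r T v D) (h' : M.IsWeakDivergence b r T v D') : D = D' := by
  rw [← sub_eq_zero]
  refine (M.cell_isPolytope T T.2).eq_zero_of_setIntegral_sq ?_
  have hdeg : (D - D').totalDegree ≤ r :=
    (MvPolynomial.totalDegree_sub _ _).trans (max_le h.1 h'.1)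
  have e1 := h.2 _ hdeg
  have e2 := h'.2 _ hdeg
  rw [← e2] at e1
  have hsub : ∀ x, polyEval (D - D') x * polyEval (D - D') x =
      polyEval D x * polyEval (D - D') x - polyEval D' x * polyEval (D - D') x := fun x => by
    simp only [polyEval, map_sub]; ring
  simp only [hsub]
  rw [integral_sub (M.integrableOn_of_continuousOn T (Continuous.continuousOn (by fun_prop)))
    (M.integrableOn_of_continuousOn T (Continuous.continuousOn (by fun_prop))), e1, sub_self]

theorem isWeakDivergence_weakDivergence (hd : 0 < d) (hb : ContinuousOn b T) {v : M.WeakFun}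
    (hv : v ∈ M.V k q) (r : ℕ) : M.IsWeakDivergence b r T v (M.weakDivergence b r T v) := by
  have h := M.exists_isWeakDivergence hd hb hv r
  rw [weakDivergence, dif_pos h]
  exact h.choose_spec

theorem weakDivergence_smul_add (hd : 0 < d) (hb : ContinuousOn b T) {u v : M.WeakFun}
    (hu : u ∈ M.V k q) (hv : v ∈ M.V k q) (a : ℝ) (r : ℕ) :
    M.weakDivergence b r T (a • u + v) =
      a • M.weakDivergence b r T u + M.weakDivergence b r T v := by
  refine IsWeakDivergence.unique M (M.isWeakDivergence_weakDivergence hd hb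
    (Submodule.add_mem _ (Submodule.smul_mem _ a hu) hv) r) ?_
  have h1 := M.isWeakDivergence_weakDivergence hd hb hu r
  have h2 := M.isWeakDivergence_weakDivergence hd hb hv r
  refine ⟨(MvPolynomial.totalDegree_add _ _).trans
    (max_le ((MvPolynomial.totalDegree_smul_le _ _).trans h1.1) h2.1), fun w hw => ?_⟩
  have e1 := h1.2 w hw
  have e2 := h2.2 w hw
  have hfun := M.weakDivFunctional_smul_add_left hd hb hu hv a w
  refine Eq.trans ?_ hfun.symm
  rw [weakDivFunctional, weakDivFunctional, ← e1, ← e2]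
  simp only [polyEval_add, polyEval_smul, add_mul, mul_assoc]
  rw [integral_add ((M.integrableOn_of_continuousOn T
      (Continuous.continuousOn (by fun_prop))).const_mul a)
    (M.integrableOn_of_continuousOn T (Continuous.continuousOn (by fun_prop))), integral_const_mul]

/-- The components of the weak gradient are the weak divergences for the constant fields of the
coordinate directions. -/
theorem isWeakGradient_iff (hd : 0 < d) {v : M.WeakFun} (hv : v ∈ M.V k q) {r : ℕ}
    {G : Fin d → MvPolynomial (Fin d) ℝ} :
    M.IsWeakGradient r T v G ↔
      ∀ i, M.IsWeakDivergence (fun _ => EuclideanSpace.single i 1) r T v (G i) := by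
  have hsingle : ∀ (i : Fin d) (w : MvPolynomial (Fin d) ℝ),
      M.weakDivFunctional (fun _ => EuclideanSpace.single i 1) T v w =
        -(∫ x in (T : Set (Euc d)), v.1 T x * polyEval (MvPolynomial.pderiv i w) x) +
          M.boundaryIntegral T fun e x => v.2 e x * (polyEval w x * M.normal T e i) := by
    intro i w
    rw [weakDivFunctional]
    congr 2
    · refine integral_congr_ae (Eventually.of_forall fun x => ?_)
      simp only
      rw [Finset.sum_eq_single i (fun j _ hj => by simp [hj]) (by simp)]
      simp
    · funext e x
      rw [EuclideanSpace.inner_single_left]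
      simp only [map_one, one_mul]
      ring
  constructor
  · rintro ⟨hdeg, h⟩ i
    refine ⟨hdeg i, fun w hw => ?_⟩
    have h1 := h (Pi.single i w) fun j => by
      by_cases hj : j = i
      · subst hj; simpa using hw
      · simp [hj]
    have hs : ∀ (F : Fin d → ℝ) (x : Euc d),
        ∑ j, F j * polyEval ((Pi.single i w : Fin d → MvPolynomial (Fin d) ℝ) j) x =
          F i * polyEval w x := fun F x => by
      rw [Finset.sum_eq_single i (fun j _ hj => by simp [hj]) (by simp)]
      simp
    have hs2 : ∀ x : Euc d, ∑ j, polyEval (MvPolynomial.pderiv j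
        ((Pi.single i w : Fin d → MvPolynomial (Fin d) ℝ) j)) x =
          polyEval (MvPolynomial.pderiv i w) x := fun x => by
      rw [Finset.sum_eq_single i (fun j _ hj => by simp [hj]) (by simp)]
      simp
    have hs3 : ∀ (e : M.faces) (x : Euc d),
        ∑ j, polyEval ((Pi.single i w : Fin d → MvPolynomial (Fin d) ℝ) j) x * M.normal T e j =
          polyEval w x * M.normal T e i := fun e x => by
      rw [Finset.sum_eq_single i (fun j _ hj => by simp [hj]) (by simp)]
      simp
    simp only [hs, hs2, hs3] at h1
    exact h1.trans (hsingle i w).symm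
  · intro h
    refine ⟨fun i => (h i).1, fun φ hφ => ?_⟩
    have hT : ∀ F : Euc d → ℝ, ContinuousOn F T → IntegrableOn F T := fun F hF =>
      M.integrableOn_of_continuousOn T hF
    have hvT := M.continuousOn_cell hv T
    have hi := fun i => ((h i).2 (φ i) (hφ i)).trans (hsingle i (φ i))
    rw [integral_finsetSum _ fun i _ => hT _ (Continuous.continuousOn (by fun_prop)),
      Finset.sum_congr rfl fun i _ => hi i, Finset.sum_add_distrib, Finset.sum_neg_distrib,
      ← integral_finsetSum (f := fun i x => v.1 T x * polyEval (MvPolynomial.pderiv i (φ i)) x) _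
        fun i _ => hT _ (hvT.mul (continuous_polyEval _).continuousOn)]
    simp only [Finset.mul_sum]
    congr 1
    simp only [boundaryIntegral]
    rw [Finset.sum_comm]
    refine Finset.sum_congr rfl fun e _ => ?_
    rw [integral_finsetSum]
    intro i _
    exact M.integrableOn_face hd e ((M.continuousOn_face hv e).mul
      ((continuous_polyEval _).continuousOn.mul continuousOn_const))

theorem isWeakGradient_weakGradient (hd : 0 < d) {v : M.WeakFun} (hv : v ∈ M.V k q) (r : ℕ) :
    M.IsWeakGradient r T v (M.weakGradient r T v) := by
  have h : ∃ G, M.IsWeakGradient r T v G :=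
    ⟨fun i => M.weakDivergence (fun _ => EuclideanSpace.single i 1) r T v,
      (M.isWeakGradient_iff hd hv).2 fun i =>
        M.isWeakDivergence_weakDivergence hd continuousOn_const hv r⟩
  rw [weakGradient, dif_pos h]
  exact h.choose_spec

theorem weakGradient_apply (hd : 0 < d) {v : M.WeakFun} (hv : v ∈ M.V k q) (r : ℕ) (i : Fin d) :
    M.weakGradient r T v i = M.weakDivergence (fun _ => EuclideanSpace.single i 1) r T v :=
  IsWeakDivergence.unique M
    ((M.isWeakGradient_iff hd hv).1 (M.isWeakGradient_weakGradient hd hv r) i)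
    (M.isWeakDivergence_weakDivergence hd continuousOn_const hv r)

end PolytopalMesh

end WeakOperators

/-! ### Green's formula for the convection field -/

section Field

variable {d : ℕ} {Ω : Set (Euc d)}

/-- Weak derivatives are unique almost everywhere. -/
theorem IsWeakPartial.ae_eq (hΩ : IsOpen Ω) {i : Fin d} {g g₁ g₂ : Euc d → ℝ}
    (h₁ : IsWeakPartial Ω i g g₁) (h₂ : IsWeakPartial Ω i g g₂) :
    g₁ =ᵐ[volume.restrict Ω] g₂ := by
  have hloc := h₁.locallyIntegrableOn_deriv.sub h₂.locallyIntegrableOn_deriv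
  have h := hΩ.ae_eq_zero_of_integral_contDiff_smul_eq_zero hloc fun φ hφ hφc hφs => by
    have hz : ∀ y ∉ Ω, φ y • (g₁ - g₂) y = 0 := fun y hy => by
      rw [image_eq_zero_of_notMem_tsupport fun h => hy (hφs h), zero_smul]
    rw [← setIntegral_eq_integral_of_forall_compl_eq_zero hz]
    have hi : ∀ f : Euc d → ℝ, LocallyIntegrableOn f Ω → IntegrableOn (fun y => f y * φ y) Ω := by
      intro f hf
      have h1 : IntegrableOn f (tsupport φ) := hf.integrableOn_compact_subset hφs hφc
      have h2 : IntegrableOn (fun y => f y * φ y) (tsupport φ) :=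
        h1.mul_continuousOn hφ.continuous.continuousOn hφc
      refine (h2.of_forall_sdiff_eq_zero hΩ.measurableSet fun y hy => ?_)
      rw [image_eq_zero_of_notMem_tsupport hy.2, mul_zero]
    have e1 := h₁.integral_eq φ hφ hφc hφs
    have e2 := h₂.integral_eq φ hφ hφc hφs
    have hfun : ∀ y, φ y • (g₁ - g₂) y = g₁ y * φ y - g₂ y * φ y := fun y => by
      rw [Pi.sub_apply, smul_eq_mul]; ring
    simp only [hfun]
    rw [integral_sub (hi _ h₁.locallyIntegrableOn_deriv) (hi _ h₂.locallyIntegrableOn_deriv)]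
    linarith
  rw [Filter.EventuallyEq, ae_restrict_iff' hΩ.measurableSet]
  filter_upwards [h] with y hy hyΩ
  exact sub_eq_zero.1 (hy hyΩ)

theorem MemWOneInfty.isWeakPartial_weakPartial {g : Euc d → ℝ} (h : MemWOneInfty Ω g)
    (i : Fin d) : IsWeakPartial Ω i g (weakPartial Ω i g) := by
  obtain ⟨g', -, hg'⟩ := h.2 i
  have hex : ∃ g', IsWeakPartial Ω i g g' := ⟨g', hg'⟩
  rw [weakPartial, dif_pos hex]
  exact hex.choose_spec

theorem MemWOneInfty.integrableOn_weakPartial (hΩ : IsPolytopalDomain Ω) {g : Euc d → ℝ}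
    (h : MemWOneInfty Ω g) (i : Fin d) : IntegrableOn (weakPartial Ω i g) Ω := by
  obtain ⟨g', hg', hw⟩ := h.2 i
  have hfin : volume Ω < ⊤ :=
    (measure_mono subset_closure).trans_lt hΩ.isPolytope.isCompact.measure_lt_top
  have : IsFiniteMeasure (volume.restrict Ω) := ⟨by rwa [Measure.restrict_apply_univ]⟩
  exact (hg'.integrable le_top).congr (hw.ae_eq hΩ.isOpen (h.isWeakPartial_weakPartial i))

theorem IsWeakPartial.congr (hΩ : MeasurableSet Ω) {i : Fin d} {g f g' : Euc d → ℝ}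
    (h : IsWeakPartial Ω i g g') (hf : Continuous f) (hfg : EqOn f g Ω) :
    IsWeakPartial Ω i f g' := by
  refine ⟨hf.locallyIntegrable.locallyIntegrableOn _, h.locallyIntegrableOn_deriv,
    fun φ hφ hφc hφs => ?_⟩
  rw [← h.integral_eq φ hφ hφc hφs]
  exact setIntegral_congr_fun hΩ fun x hx => by simp only [hfg hx]

namespace PolytopalMesh

variable (M : PolytopalMesh Ω)

/-- Green's formula for a component of the field and a polynomial. The field is extended
continuously to the whole space, and the polynomial is cut off away from the element. -/
theorem green_polyEval (hd : 2 ≤ d) (hΩ : IsPolytopalDomain Ω) (T : M.cells) {g : Euc d → ℝ}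
    (hg : MemWOneInfty Ω g) (hgc : ContinuousOn g (closure Ω)) (i : Fin d)
    (p : MvPolynomial (Fin d) ℝ) :
    (∫ y in (T : Set (Euc d)), g y * polyEval (MvPolynomial.pderiv i p) y) +
      (∫ y in (T : Set (Euc d)), weakPartial Ω i g y * polyEval p y) =
      M.boundaryIntegral T fun e y => g y * polyEval p y * M.normal T e i := by
  have hTcl : IsClosed (T : Set (Euc d)) := (M.isCompact_cell T).isClosed
  obtain ⟨f, hf⟩ := ContinuousMap.exists_restrict_eq isClosed_closure
    (⟨(closure Ω).domRestrict g, hgc.domRestrict⟩ : C(closure Ω, ℝ))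
  have hfg : EqOn f g (closure Ω) := fun x hx => by
    have := congrArg (fun F : C(closure Ω, ℝ) => F ⟨x, hx⟩) hf
    simpa using this
  have hfT : EqOn f g T := hfg.mono (M.cell_subset_closure T)
  have hw : IsWeakPartial Ω i f (weakPartial Ω i g) :=
    (hg.isWeakPartial_weakPartial i).congr hΩ.isOpen.measurableSet f.continuous
      (hfg.mono subset_closure)
  obtain ⟨R, hR⟩ := (M.isCompact_cell T).isBounded.subset_closedBall 0
  let β : ContDiffBump (0 : Euc d) :=
    ⟨|R| + 1, |R| + 2, by positivity, by linarith⟩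
  have hβ : ∀ y ∈ (T : Set (Euc d)), β =ᶠ[𝓝 y] fun _ => 1 := fun y hy =>
    β.eventuallyEq_one_of_mem_ball (by
      have := hR hy
      rw [mem_closedBall_zero_iff] at this
      rw [mem_ball_zero_iff]
      change ‖y‖ < |R| + 1
      linarith [le_abs_self R])
  have hG := M.green hd hΩ T f.continuous hw
    (M.integrableOn_cell hΩ T (hg.integrableOn_weakPartial hΩ i))
    ((contDiff_polyEval p).mul β.contDiff) β.hasCompactSupport.mul_left
  have e1 : ∀ y ∈ (T : Set (Euc d)), f y * fderiv ℝ (fun x => polyEval p x * β x) y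
      (EuclideanSpace.single i 1) = g y * polyEval (MvPolynomial.pderiv i p) y := by
    intro y hy
    have hev : (fun x => polyEval p x * β x) =ᶠ[𝓝 y] polyEval p := by
      filter_upwards [hβ y hy] with x hx
      rw [hx, mul_one]
    rw [hev.fderiv_eq, fderiv_polyEval, hfT hy]
  have e2 : ∀ y ∈ (T : Set (Euc d)), weakPartial Ω i g y * (polyEval p y * β y) =
      weakPartial Ω i g y * polyEval p y := fun y hy => by
    rw [(hβ y hy).self_of_nhds, mul_one]
  rw [setIntegral_congr_fun hTcl.measurableSet e1,
    setIntegral_congr_fun hTcl.measurableSet e2] at hG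
  rw [hG]
  refine M.boundaryIntegral_congr T fun e he y hy => ?_
  have hyT := M.face_subset_cell he hy
  rw [hfT hyT, (hβ y hyT).self_of_nhds, mul_one]

theorem integrableOn_divergence (hΩ : IsPolytopalDomain Ω) {b : Euc d → Euc d}
    (hb : ∀ i : Fin d, MemWOneInfty Ω fun x => b x i) (T : M.cells) :
    IntegrableOn (divergence Ω b) T := by
  have : divergence Ω b = fun x => ∑ i, weakPartial Ω i (fun y => b y i) x := rfl
  rw [this]
  exact integrable_finsetSum _ fun i _ =>
    M.integrableOn_cell hΩ T ((hb i).integrableOn_weakPartial hΩ i)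

/-- The divergence theorem on an element, for the product of the field and a polynomial. -/
theorem divergence_theorem (hd : 2 ≤ d) (hΩ : IsPolytopalDomain Ω) {b : Euc d → Euc d}
    (hb : ∀ i : Fin d, MemWOneInfty Ω fun x => b x i) (hbc : ContinuousOn b (closure Ω))
    (T : M.cells) (p : MvPolynomial (Fin d) ℝ) :
    (∫ y in (T : Set (Euc d)), ∑ i, b y i * polyEval (MvPolynomial.pderiv i p) y) +
      (∫ y in (T : Set (Euc d)), divergence Ω b y * polyEval p y) =
      M.boundaryIntegral T fun e y => inner ℝ (b y) (M.normal T e) * polyEval p y := by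
  have hG := fun i => M.green_polyEval hd hΩ T (hb i) (continuousOn_coord hbc i) i p
  have hbT := hbc.mono (M.cell_subset_closure T)
  have h1 : ∫ y in (T : Set (Euc d)), ∑ i, b y i * polyEval (MvPolynomial.pderiv i p) y =
      ∑ i, ∫ y in (T : Set (Euc d)), b y i * polyEval (MvPolynomial.pderiv i p) y :=
    integral_finsetSum _ fun i _ => M.integrableOn_of_continuousOn T
      ((continuousOn_coord hbT i).mul (continuous_polyEval _).continuousOn)
  have h2 : ∫ y in (T : Set (Euc d)), divergence Ω b y * polyEval p y =
      ∑ i, ∫ y in (T : Set (Euc d)), weakPartial Ω i (fun y => b y i) y * polyEval p y := by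
    simp only [divergence, Finset.sum_mul]
    exact integral_finsetSum _ fun i _ => M.integrableOn_mul_continuousOn T
      (M.integrableOn_cell hΩ T ((hb i).integrableOn_weakPartial hΩ i))
      (continuous_polyEval _).continuousOn
  rw [h1, h2, ← Finset.sum_add_distrib, Finset.sum_congr rfl fun i _ => hG i]
  simp only [boundaryIntegral]
  rw [Finset.sum_comm]
  refine Finset.sum_congr rfl fun e he => ?_
  rw [← integral_finsetSum]
  · refine integral_congr_ae (Eventually.of_forall fun y => ?_)
    simp only [PiLp.inner_apply, Finset.sum_mul]
    refine Finset.sum_congr rfl fun i _ => ?_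
    simp only [RCLike.inner_apply, conj_trivial]
    ring
  · intro i _
    exact M.integrableOn_face (by omega) e
      (((continuousOn_coord (hbT.mono (M.face_subset_cell he)) i).mul
        (continuous_polyEval _).continuousOn).mul continuousOn_const)

/-- The flux of the field through the faces, weighted by a function that is single-valued on the
faces and vanishes on the boundary, cancels in the sum over the elements. -/
theorem sum_boundaryIntegral_eq_zero (hd : 0 < d) (hΩ : IsPolytopalDomain Ω) {b : Euc d → Euc d}
    {h : M.faces → Euc d → ℝ}
    (h0 : ∀ e : M.faces, (e : Set (Euc d)) ⊆ frontier Ω → h e = 0) :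
    ∑ T : M.cells, M.boundaryIntegral T (fun e x => inner ℝ (b x) (M.normal T e) * h e x) = 0 := by
  classical
  simp only [boundaryIntegral]
  have hswap : ∑ T : M.cells, ∑ e ∈ M.facesOf T, ∫ x in (e : Set (Euc d)),
      inner ℝ (b x) (M.normal T e) * h e x ∂(μHE[d - 1] : Measure (Euc d)) =
      ∑ e : M.faces, ∑ T ∈ Finset.univ.filter (fun T => e ∈ M.facesOf T),
        ∫ x in (e : Set (Euc d)), inner ℝ (b x) (M.normal T e) * h e x
          ∂(μHE[d - 1] : Measure (Euc d)) :=
    Finset.sum_comm' fun T e => by simp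
  rw [hswap]
  refine Finset.sum_eq_zero fun e _ => ?_
  by_cases he : (e : Set (Euc d)) ⊆ frontier Ω
  · simp [h0 e he]
  · obtain ⟨T₁, T₂, hne, hiff, hn⟩ := M.exists_two_cells hd hΩ e he
    have hfil : Finset.univ.filter (fun T => e ∈ M.facesOf T) = {T₁, T₂} := by
      ext T; simp [hiff T]
    rw [hfil, Finset.sum_pair hne, hn]
    simp only [inner_neg_right, neg_mul]
    rw [integral_neg, add_neg_cancel]

end PolytopalMesh

end Field

/-! ### The bilinear form -/

section Form

variable {d : ℕ} {Ω : Set (Euc d)}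

namespace PolytopalMesh

variable (M : PolytopalMesh Ω) {T : M.cells} {k q : ℕ} {ρ : ℝ} {b : Euc d → Euc d}
  {c : Euc d → ℝ}

theorem setIntegral_eq_smul_add (T : M.cells) (a : ℝ) {F G H : Euc d → ℝ}
    (hF : IntegrableOn F T) (hG : IntegrableOn G T)
    (h : ∀ x ∈ (T : Set (Euc d)), H x = a * F x + G x) :
    ∫ x in (T : Set (Euc d)), H x =
      a * (∫ x in (T : Set (Euc d)), F x) + ∫ x in (T : Set (Euc d)), G x := by
  rw [setIntegral_congr_fun (M.isCompact_cell T).isClosed.measurableSet h,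
    integral_add (hF.const_mul a) hG, integral_const_mul]

theorem boundaryIntegral_eq_smul_add (hd : 0 < d) (T : M.cells) (a : ℝ)
    {F G H : M.faces → Euc d → ℝ} (hF : ∀ e ∈ M.facesOf T, ContinuousOn (F e) e)
    (hG : ∀ e ∈ M.facesOf T, ContinuousOn (G e) e)
    (h : ∀ e ∈ M.facesOf T, ∀ x ∈ (e : Set (Euc d)), H e x = a * F e x + G e x) :
    M.boundaryIntegral T H = a * M.boundaryIntegral T F + M.boundaryIntegral T G := by
  rw [← M.boundaryIntegral_smul_add hd T a hF hG]
  exact M.boundaryIntegral_congr T h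

theorem weakGradient_smul_add (hd : 0 < d) {u v : M.WeakFun}
    (hu : u ∈ M.V k q) (hv : v ∈ M.V k q) (a : ℝ) (r : ℕ) (i : Fin d) :
    M.weakGradient r T (a • u + v) i =
      a • M.weakGradient r T u i + M.weakGradient r T v i := by
  rw [M.weakGradient_apply hd hu, M.weakGradient_apply hd hv,
    M.weakGradient_apply hd (Submodule.add_mem _ (Submodule.smul_mem _ a hu) hv),
    M.weakDivergence_smul_add hd continuousOn_const hu hv]

/-- The contribution of the element `T` to the bilinear form. -/
def cellForm (ρ : ℝ) (b : Euc d → Euc d) (c : Euc d → ℝ) (k : ℕ) (T : M.cells)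
    (u v : M.WeakFun) : ℝ :=
  ρ * (∫ x in (T : Set (Euc d)), ∑ i, polyEval (M.weakGradient (M.degree k T) T u i) x *
      polyEval (M.weakGradient (M.degree k T) T v i) x) +
    (∫ x in (T : Set (Euc d)), polyEval (M.weakDivergence b (M.degree k T) T u) x * v.1 T x) +
    (M.boundaryIntegral T fun e x =>
      max (inner ℝ (b x) (M.normal T e)) 0 * ((u.1 T x - u.2 e x) * (v.1 T x - v.2 e x))) +
    ∫ x in (T : Set (Euc d)), c x * (u.1 T x * v.1 T x)

/-- The indicator function of the outflow boundary is absorbed by the positive part of `b · n`. -/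
theorem form_eq_sum_cellForm (u v : M.WeakFun) :
    M.form ρ b c k u v = ∑ T : M.cells, M.cellForm ρ b c k T u v := by
  simp only [form, cellForm, mul_assoc]
  refine Finset.sum_congr rfl fun T _ => ?_
  congr 2
  refine M.boundaryIntegral_congr T fun e _ x _ => ?_
  by_cases hx : 0 < (inner ℝ (b x) (M.normal T e) : ℝ)
  · rw [indicator_of_mem (by exact hx), max_eq_left hx.le]
  · rw [indicator_of_notMem (by exact hx), max_eq_right (not_lt.1 hx), zero_mul]

theorem continuousOn_jump (hb : ContinuousOn b T) {u v : M.WeakFun} (hu : u ∈ M.V k q)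
    (hv : v ∈ M.V k q) {e : M.faces} (he : e ∈ M.facesOf T) :
    ContinuousOn (fun x => max (inner ℝ (b x) (M.normal T e)) 0 *
      ((u.1 T x - u.2 e x) * (v.1 T x - v.2 e x))) e := by
  have hsub := M.face_subset_cell he
  have h1 := (M.continuousOn_cell hu T).mono hsub
  have h2 := (M.continuousOn_cell hv T).mono hsub
  have h3 := M.continuousOn_face hu e
  have h4 := M.continuousOn_face hv e
  have h5 : ContinuousOn (fun x => inner ℝ (b x) (M.normal T e)) (e : Set (Euc d)) :=
    (hb.mono hsub).inner continuousOn_const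
  exact (h5.sup continuousOn_const).mul ((h1.sub h3).mul (h2.sub h4))

theorem continuousOn_gradGrad (G H : Fin d → MvPolynomial (Fin d) ℝ) {S : Set (Euc d)} :
    ContinuousOn (fun x => ∑ i, polyEval (G i) x * polyEval (H i) x) S :=
  Continuous.continuousOn (by fun_prop)

theorem cellForm_smul_add_left (hd : 0 < d) (hb : ContinuousOn b T) (hc : IntegrableOn c T)
    {u u' v : M.WeakFun} (hu : u ∈ M.V k q) (hu' : u' ∈ M.V k q) (hv : v ∈ M.V k q) (a : ℝ) :
    M.cellForm ρ b c k T (a • u + u') v =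
      a * M.cellForm ρ b c k T u v + M.cellForm ρ b c k T u' v := by
  have hI := fun {F : Euc d → ℝ} => M.integrableOn_of_continuousOn T (F := F)
  have hvT := M.continuousOn_cell hv T
  have hgrad := M.setIntegral_eq_smul_add T a
    (F := fun x => ∑ i, polyEval (M.weakGradient (M.degree k T) T u i) x *
      polyEval (M.weakGradient (M.degree k T) T v i) x)
    (G := fun x => ∑ i, polyEval (M.weakGradient (M.degree k T) T u' i) x *
      polyEval (M.weakGradient (M.degree k T) T v i) x)
    (H := fun x => ∑ i, polyEval (M.weakGradient (M.degree k T) T (a • u + u') i) x *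
      polyEval (M.weakGradient (M.degree k T) T v i) x)
    (hI (continuousOn_gradGrad _ _)) (hI (continuousOn_gradGrad _ _)) fun x _ => by
      rw [Finset.mul_sum, ← Finset.sum_add_distrib]
      refine Finset.sum_congr rfl fun i _ => ?_
      rw [M.weakGradient_smul_add hd hu hu', polyEval_add, polyEval_smul, add_mul, mul_assoc]
  have hdiv := M.setIntegral_eq_smul_add T a
    (F := fun x => polyEval (M.weakDivergence b (M.degree k T) T u) x * v.1 T x)
    (G := fun x => polyEval (M.weakDivergence b (M.degree k T) T u') x * v.1 T x)
    (H := fun x => polyEval (M.weakDivergence b (M.degree k T) T (a • u + u')) x * v.1 T x)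
    (hI ((continuous_polyEval _).continuousOn.mul hvT))
    (hI ((continuous_polyEval _).continuousOn.mul hvT)) fun x _ => by
      rw [M.weakDivergence_smul_add hd hb hu hu', polyEval_add, polyEval_smul, add_mul, mul_assoc]
  have hjump := M.boundaryIntegral_eq_smul_add hd T a
    (H := fun e x => max (inner ℝ (b x) (M.normal T e)) 0 *
      (((a • u + u').1 T x - (a • u + u').2 e x) * (v.1 T x - v.2 e x)))
    (fun e he => M.continuousOn_jump hb hu hv he)
    (fun e he => M.continuousOn_jump hb hu' hv he) fun e he x _ => by
      simp only [Prod.fst_add, Prod.smul_fst, Pi.add_apply, Pi.smul_apply, smul_eq_mul,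
        Prod.snd_add, Prod.smul_snd]
      ring
  have hzero := M.setIntegral_eq_smul_add T a
    (F := fun x => c x * (u.1 T x * v.1 T x)) (G := fun x => c x * (u'.1 T x * v.1 T x))
    (H := fun x => c x * ((a • u + u').1 T x * v.1 T x))
    (M.integrableOn_mul_continuousOn T hc ((M.continuousOn_cell hu T).mul hvT))
    (M.integrableOn_mul_continuousOn T hc ((M.continuousOn_cell hu' T).mul hvT)) fun x _ => by
      simp only [Prod.fst_add, Prod.smul_fst, Pi.add_apply, Pi.smul_apply, smul_eq_mul]
      ring
  unfold cellForm
  rw [hgrad, hdiv, hjump, hzero]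
  ring

theorem cellForm_smul_add_right (hd : 0 < d) (hb : ContinuousOn b T) (hc : IntegrableOn c T)
    {u v v' : M.WeakFun} (hu : u ∈ M.V k q) (hv : v ∈ M.V k q) (hv' : v' ∈ M.V k q) (a : ℝ) :
    M.cellForm ρ b c k T u (a • v + v') =
      a * M.cellForm ρ b c k T u v + M.cellForm ρ b c k T u v' := by
  have hI := fun {F : Euc d → ℝ} => M.integrableOn_of_continuousOn T (F := F)
  have hvT := M.continuousOn_cell hv T
  have hvT' := M.continuousOn_cell hv' T
  have huT := M.continuousOn_cell hu T
  have hgrad := M.setIntegral_eq_smul_add T a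
    (F := fun x => ∑ i, polyEval (M.weakGradient (M.degree k T) T u i) x *
      polyEval (M.weakGradient (M.degree k T) T v i) x)
    (G := fun x => ∑ i, polyEval (M.weakGradient (M.degree k T) T u i) x *
      polyEval (M.weakGradient (M.degree k T) T v' i) x)
    (H := fun x => ∑ i, polyEval (M.weakGradient (M.degree k T) T u i) x *
      polyEval (M.weakGradient (M.degree k T) T (a • v + v') i) x)
    (hI (continuousOn_gradGrad _ _)) (hI (continuousOn_gradGrad _ _)) fun x _ => by
      rw [Finset.mul_sum, ← Finset.sum_add_distrib]
      refine Finset.sum_congr rfl fun i _ => ?_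
      rw [M.weakGradient_smul_add hd hv hv', polyEval_add, polyEval_smul]
      ring
  have hdiv := M.setIntegral_eq_smul_add T a
    (F := fun x => polyEval (M.weakDivergence b (M.degree k T) T u) x * v.1 T x)
    (G := fun x => polyEval (M.weakDivergence b (M.degree k T) T u) x * v'.1 T x)
    (H := fun x => polyEval (M.weakDivergence b (M.degree k T) T u) x * (a • v + v').1 T x)
    (hI ((continuous_polyEval _).continuousOn.mul hvT))
    (hI ((continuous_polyEval _).continuousOn.mul hvT')) fun x _ => by
      simp only [Prod.fst_add, Prod.smul_fst, Pi.add_apply, Pi.smul_apply, smul_eq_mul]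
      ring
  have hjump := M.boundaryIntegral_eq_smul_add hd T a
    (H := fun e x => max (inner ℝ (b x) (M.normal T e)) 0 *
      ((u.1 T x - u.2 e x) * ((a • v + v').1 T x - (a • v + v').2 e x)))
    (fun e he => M.continuousOn_jump hb hu hv he)
    (fun e he => M.continuousOn_jump hb hu hv' he) fun e he x _ => by
      simp only [Prod.fst_add, Prod.smul_fst, Pi.add_apply, Pi.smul_apply, smul_eq_mul,
        Prod.snd_add, Prod.smul_snd]
      ring
  have hzero := M.setIntegral_eq_smul_add T a
    (F := fun x => c x * (u.1 T x * v.1 T x)) (G := fun x => c x * (u.1 T x * v'.1 T x))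
    (H := fun x => c x * (u.1 T x * (a • v + v').1 T x))
    (M.integrableOn_mul_continuousOn T hc (huT.mul hvT))
    (M.integrableOn_mul_continuousOn T hc (huT.mul hvT')) fun x _ => by
      simp only [Prod.fst_add, Prod.smul_fst, Pi.add_apply, Pi.smul_apply, smul_eq_mul]
      ring
  unfold cellForm
  rw [hgrad, hdiv, hjump, hzero]
  ring

theorem form_smul_add_left (hd : 0 < d) (hΩ : IsPolytopalDomain Ω)
    (hb : ContinuousOn b (closure Ω)) (hc : IntegrableOn c Ω) {u u' v : M.WeakFun}
    (hu : u ∈ M.V k q) (hu' : u' ∈ M.V k q) (hv : v ∈ M.V k q) (a : ℝ) :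
    M.form ρ b c k (a • u + u') v = a * M.form ρ b c k u v + M.form ρ b c k u' v := by
  simp only [form_eq_sum_cellForm]
  rw [Finset.mul_sum, ← Finset.sum_add_distrib]
  exact Finset.sum_congr rfl fun T _ => M.cellForm_smul_add_left hd
    (hb.mono (M.cell_subset_closure T)) (M.integrableOn_cell hΩ T hc) hu hu' hv a

theorem form_smul_add_right (hd : 0 < d) (hΩ : IsPolytopalDomain Ω)
    (hb : ContinuousOn b (closure Ω)) (hc : IntegrableOn c Ω) {u v v' : M.WeakFun}
    (hu : u ∈ M.V k q) (hv : v ∈ M.V k q) (hv' : v' ∈ M.V k q) (a : ℝ) :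
    M.form ρ b c k u (a • v + v') = a * M.form ρ b c k u v + M.form ρ b c k u v' := by
  simp only [form_eq_sum_cellForm]
  rw [Finset.mul_sum, ← Finset.sum_add_distrib]
  exact Finset.sum_congr rfl fun T _ => M.cellForm_smul_add_right hd
    (hb.mono (M.cell_subset_closure T)) (M.integrableOn_cell hΩ T hc) hu hv hv' a

theorem load_smul_add (hΩ : IsPolytopalDomain Ω) {f : Euc d → ℝ} (hf : IntegrableOn f Ω)
    {v v' : M.WeakFun} (hv : v ∈ M.V k q) (hv' : v' ∈ M.V k q) (a : ℝ) :
    M.load f (a • v + v') = a * M.load f v + M.load f v' := by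
  simp only [load]
  rw [Finset.mul_sum, ← Finset.sum_add_distrib]
  refine Finset.sum_congr rfl fun T _ => ?_
  have hfT := M.integrableOn_cell hΩ T hf
  exact M.setIntegral_eq_smul_add T a
    (M.integrableOn_mul_continuousOn T hfT (M.continuousOn_cell hv T))
    (M.integrableOn_mul_continuousOn T hfT (M.continuousOn_cell hv' T)) fun x _ => by
      simp only [Prod.fst_add, Prod.smul_fst, Pi.add_apply, Pi.smul_apply, smul_eq_mul]
      ring

/-- The degrees of freedom are finite in number. -/
theorem finiteDimensional_V (k q : ℕ) : FiniteDimensional ℝ (M.V k q) := by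
  have hpoly : ∀ (S : Set (Euc d)) (m : ℕ), FiniteDimensional ℝ (polySpace S m) := by
    intro S m
    let L : MvPolynomial (Fin d) ℝ →ₗ[ℝ] (Euc d → ℝ) :=
      { toFun := fun p => S.indicator (polyEval p)
        map_add' := fun p p' => by
          funext x
          by_cases hx : x ∈ S <;> simp [hx]
        map_smul' := fun a p => by
          funext x
          by_cases hx : x ∈ S <;> simp [hx] }
    have hle : polySpace S m ≤ (MvPolynomial.restrictTotalDegree (Fin d) ℝ m).map L := by
      rintro g ⟨p, hp, rfl⟩
      exact ⟨p, (MvPolynomial.mem_restrictTotalDegree _ _ _).2 hp, rfl⟩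
    exact Submodule.finiteDimensional_of_le hle
  let A : M.V k q →ₗ[ℝ] ((T : M.cells) → polySpace (T : Set (Euc d)) k) ×
      ((e : M.faces) → polySpace (e : Set (Euc d)) q) :=
    { toFun := fun v => (fun T => ⟨v.1.1 T, v.2.1 T (mem_univ T)⟩,
        fun e => ⟨v.1.2 e, v.2.2 e (mem_univ e)⟩)
      map_add' := fun _ _ => rfl
      map_smul' := fun _ _ => rfl }
  refine Module.Finite.of_injective A fun u v h => Subtype.ext (Prod.ext ?_ ?_)
  · funext T
    exact congrArg Subtype.val (congrFun (congrArg Prod.fst h) T)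
  · funext e
    exact congrArg Subtype.val (congrFun (congrArg Prod.snd h) e)

/-! ### Coercivity -/

/-- The interior values are admissible test functions for the weak divergence. -/
theorem le_degree (hd : 0 < d) (k : ℕ) (T : M.cells) : k ≤ M.degree k T := by
  have h := (M.facesOf_nonempty hd T).card_pos
  unfold degree
  split_ifs <;> omega

/-- Integration by parts turns the diagonal of the convection terms on an element into the
zeroth-order term `½ (∇ · b, v₀²)`, a nonnegative jump term, and half of the flux of `b v_b²`
through the boundary of the element. -/
theorem convection_cell (hd : 2 ≤ d) (hΩ : IsPolytopalDomain Ω)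
    (hb : ∀ i : Fin d, MemWOneInfty Ω fun x => b x i) (hbc : ContinuousOn b (closure Ω))
    {v : M.WeakFun} (hv : v ∈ M.V k q) (T : M.cells) :
    (∫ x in (T : Set (Euc d)), polyEval (M.weakDivergence b (M.degree k T) T v) x * v.1 T x) +
      (M.boundaryIntegral T fun e x =>
        max (inner ℝ (b x) (M.normal T e)) 0 * ((v.1 T x - v.2 e x) * (v.1 T x - v.2 e x))) =
      1 / 2 * (∫ x in (T : Set (Euc d)), divergence Ω b x * (v.1 T x * v.1 T x)) +
      1 / 2 * (M.boundaryIntegral T fun e x =>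
        |inner ℝ (b x) (M.normal T e)| * ((v.1 T x - v.2 e x) * (v.1 T x - v.2 e x))) +
      1 / 2 * (M.boundaryIntegral T fun e x =>
        inner ℝ (b x) (M.normal T e) * (v.2 e x * v.2 e x)) := by
  have hd0 : 0 < d := by omega
  have hTm : MeasurableSet (T : Set (Euc d)) := (M.isCompact_cell T).isClosed.measurableSet
  have hbT := hbc.mono (M.cell_subset_closure T)
  obtain ⟨p, hp, hvp⟩ := M.exists_poly_cell hv T
  have hvx : ∀ x ∈ (T : Set (Euc d)), v.1 T x = polyEval p x := fun x hx => by
    rw [hvp, indicator_of_mem hx]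
  have hD := (M.isWeakDivergence_weakDivergence hd0 hbT hv (M.degree k T)).2 p
    (hp.trans (M.le_degree hd0 k T))
  have hdiv := M.divergence_theorem hd hΩ hb hbc T (p * p)
  have e1 : ∫ x in (T : Set (Euc d)),
      polyEval (M.weakDivergence b (M.degree k T) T v) x * v.1 T x =
      ∫ x in (T : Set (Euc d)), polyEval (M.weakDivergence b (M.degree k T) T v) x * polyEval p x :=
    setIntegral_congr_fun hTm fun x hx => by simp only [hvx x hx]
  have e2 : ∫ x in (T : Set (Euc d)), divergence Ω b x * (v.1 T x * v.1 T x) =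
      ∫ x in (T : Set (Euc d)), divergence Ω b x * polyEval (p * p) x :=
    setIntegral_congr_fun hTm fun x hx => by simp only [hvx x hx, polyEval_mul]
  have e3 : ∫ x in (T : Set (Euc d)), ∑ i, b x i * polyEval (MvPolynomial.pderiv i (p * p)) x =
      2 * ∫ x in (T : Set (Euc d)),
        ∑ i, b x i * v.1 T x * polyEval (MvPolynomial.pderiv i p) x := by
    rw [← integral_const_mul]
    refine setIntegral_congr_fun hTm fun x hx => ?_
    simp only
    rw [Finset.mul_sum]
    refine Finset.sum_congr rfl fun i _ => ?_
    rw [hvx x hx, Derivation.leibniz]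
    simp only [smul_eq_mul, polyEval_add, polyEval_mul]
    ring
  -- the boundary terms
  have hs : ∀ e ∈ M.facesOf T,
      ContinuousOn (fun x => (inner ℝ (b x) (M.normal T e) : ℝ)) (e : Set (Euc d)) := fun e he =>
    (hbT.mono (M.face_subset_cell he)).inner continuousOn_const
  have hv0 : ∀ e ∈ M.facesOf T, ContinuousOn (v.1 T) (e : Set (Euc d)) := fun e he =>
    (M.continuousOn_cell hv T).mono (M.face_subset_cell he)
  have hvb := fun e => M.continuousOn_face hv e
  let F₁ : M.faces → Euc d → ℝ := fun e x =>
    inner ℝ (b x) (M.normal T e) * v.2 e x * polyEval p x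
  let F₂ : M.faces → Euc d → ℝ := fun e x => max (inner ℝ (b x) (M.normal T e)) 0 *
    ((v.1 T x - v.2 e x) * (v.1 T x - v.2 e x))
  let F₃ : M.faces → Euc d → ℝ := fun e x => inner ℝ (b x) (M.normal T e) * polyEval (p * p) x
  let F₄ : M.faces → Euc d → ℝ := fun e x => |inner ℝ (b x) (M.normal T e)| *
    ((v.1 T x - v.2 e x) * (v.1 T x - v.2 e x))
  let F₅ : M.faces → Euc d → ℝ := fun e x =>
    inner ℝ (b x) (M.normal T e) * (v.2 e x * v.2 e x)
  have h1 : ∀ e ∈ M.facesOf T, ContinuousOn (F₁ e) e := fun e he =>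
    M.continuousOn_divBoundaryIntegrand hbT hv p he
  have h2 : ∀ e ∈ M.facesOf T, ContinuousOn (F₂ e) e := fun e he =>
    M.continuousOn_jump hbT hv hv he
  have h3 : ∀ e ∈ M.facesOf T, ContinuousOn (F₃ e) e := fun e he =>
    (hs e he).mul (continuous_polyEval _).continuousOn
  have h4 : ∀ e ∈ M.facesOf T, ContinuousOn (F₄ e) e := fun e he =>
    (hs e he).abs.mul (((hv0 e he).sub (hvb e)).mul ((hv0 e he).sub (hvb e)))
  have h5 : ∀ e ∈ M.facesOf T, ContinuousOn (F₅ e) e := fun e he =>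
    (hs e he).mul ((hvb e).mul (hvb e))
  -- with `s = b · n`: `2 (s v_b v₀ + s⁺ (v₀ - v_b)²) = s v₀² + |s| (v₀ - v_b)² + s v_b²`
  have c1 := M.boundaryIntegral_smul_add hd0 T 1 h1 h2
  have c2 := M.boundaryIntegral_smul_add hd0 T 1 h4 h5
  have c3 := M.boundaryIntegral_eq_smul_add hd0 T 1 h3 (fun e he =>
      continuousOn_const.mul ((h4 e he).add (h5 e he)))
    (H := fun e x => 2 * (1 * F₁ e x + F₂ e x)) (G := fun e x => 1 * (F₄ e x + F₅ e x)) ?_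
  swap
  · intro e he x hx
    have hx' := hvx x (M.face_subset_cell he hx)
    simp only [F₁, F₂, F₃, F₄, F₅, hx', polyEval_mul]
    rcases le_total (inner ℝ (b x) (M.normal T e) : ℝ) 0 with h | h
    · rw [max_eq_right h, abs_of_nonpos h]; ring
    · rw [max_eq_left h, abs_of_nonneg h]; ring
  have c4 : M.boundaryIntegral T (fun e x => 2 * (1 * F₁ e x + F₂ e x)) =
      2 * M.boundaryIntegral T fun e x => 1 * F₁ e x + F₂ e x := by
    simp only [boundaryIntegral, Finset.mul_sum, integral_const_mul]
  have c5 : M.boundaryIntegral T (fun e x => 1 * (F₄ e x + F₅ e x)) =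
      M.boundaryIntegral T fun e x => 1 * F₄ e x + F₅ e x := by
    simp only [one_mul]
  rw [c4, c5, c1, c2] at c3
  rw [e3, ← e2] at hdiv
  rw [e1, hD]
  change -_ + M.boundaryIntegral T F₁ + M.boundaryIntegral T F₂ =
    1 / 2 * _ + 1 / 2 * M.boundaryIntegral T F₄ + 1 / 2 * M.boundaryIntegral T F₅
  change _ = M.boundaryIntegral T F₃ at hdiv
  linarith

theorem boundaryIntegral_nonneg (T : M.cells) {F : M.faces → Euc d → ℝ}
    (h : ∀ e x, 0 ≤ F e x) : 0 ≤ M.boundaryIntegral T F :=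
  Finset.sum_nonneg fun e _ => integral_nonneg (h e)

/-- The bilinear form controls the weak gradients and the interior values. -/
theorem coercivity (hd : 2 ≤ d) (hΩ : IsPolytopalDomain Ω)
    (hb : ∀ i : Fin d, MemWOneInfty Ω fun x => b x i) (hbc : ContinuousOn b (closure Ω))
    (hc : IntegrableOn c Ω) {c₀ : ℝ}
    (hcoer : ∀ᵐ x ∂volume.restrict Ω, c₀ ≤ c x + 1 / 2 * divergence Ω b x)
    {v : M.WeakFun} (hv : v ∈ M.V₀ k q) :
    ∑ T : M.cells, (ρ * (∫ x in (T : Set (Euc d)),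
        ∑ i, polyEval (M.weakGradient (M.degree k T) T v i) x *
          polyEval (M.weakGradient (M.degree k T) T v i) x) +
      c₀ * ∫ x in (T : Set (Euc d)), v.1 T x * v.1 T x) ≤ M.form ρ b c k v v := by
  have hd0 : 0 < d := by omega
  have hflux := M.sum_boundaryIntegral_eq_zero hd0 hΩ (b := b)
    (h := fun e x => v.2 e x * v.2 e x) fun e he => by
      funext x; simp [hv.2 e he]
  rw [form_eq_sum_cellForm, ← sub_nonneg, ← mul_zero (1 / 2 : ℝ), ← hflux, Finset.mul_sum,
    ← Finset.sum_sub_distrib]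
  refine Finset.sum_le_sum fun T _ => ?_
  have hconv := M.convection_cell hd hΩ hb hbc hv.1 T
  have hjump : 0 ≤ M.boundaryIntegral T fun e x =>
      |inner ℝ (b x) (M.normal T e)| * ((v.1 T x - v.2 e x) * (v.1 T x - v.2 e x)) :=
    M.boundaryIntegral_nonneg T fun e x => mul_nonneg (abs_nonneg _) (mul_self_nonneg _)
  have hv0 := M.continuousOn_cell hv.1 T
  have hi1 : IntegrableOn (fun x => c x * (v.1 T x * v.1 T x)) T :=
    M.integrableOn_mul_continuousOn T (M.integrableOn_cell hΩ T hc) (hv0.mul hv0)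
  have hi2 : IntegrableOn (fun x => divergence Ω b x * (v.1 T x * v.1 T x)) T :=
    M.integrableOn_mul_continuousOn T (M.integrableOn_divergence hΩ hb T) (hv0.mul hv0)
  have hlow : c₀ * (∫ x in (T : Set (Euc d)), v.1 T x * v.1 T x) ≤
      (∫ x in (T : Set (Euc d)), c x * (v.1 T x * v.1 T x)) +
        1 / 2 * ∫ x in (T : Set (Euc d)), divergence Ω b x * (v.1 T x * v.1 T x) := by
    rw [← integral_const_mul, ← integral_const_mul, ← integral_add hi1 (hi2.const_mul _)]
    refine integral_mono_ae ((M.integrableOn_of_continuousOn T (hv0.mul hv0)).const_mul c₀)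
      (hi1.add (hi2.const_mul _)) ?_
    have hae : ∀ᵐ x ∂volume.restrict (closure Ω), c₀ ≤ c x + 1 / 2 * divergence Ω b x := by
      rw [← union_sdiff_cancel (subset_closure : Ω ⊆ closure Ω)]
      rw [ae_restrict_union_iff]
      refine ⟨hcoer, ?_⟩
      rw [Measure.restrict_eq_zero.2 (volume_frontier_closure_of_isPolytopalDomain hΩ)]
      simp
    filter_upwards [ae_restrict_of_ae_restrict_of_subset (M.cell_subset_closure T) hae] with x hx
    have := mul_le_mul_of_nonneg_right hx (mul_self_nonneg (v.1 T x))
    linarith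
  unfold cellForm
  linarith

/-! ### Test polynomials for the face values -/

/-- The affine polynomial `y ↦ -n · (y - x)`. For an outward normal `n` at a point `x` of a face it
vanishes on the hyperplane of the face and is positive on the inner side. -/
def facePoly (n x : Euc d) : MvPolynomial (Fin d) ℝ :=
  ∑ i, MvPolynomial.C (-n i) * (MvPolynomial.X i - MvPolynomial.C (x i))

theorem polyEval_facePoly (n x y : Euc d) : polyEval (facePoly n x) y = -inner ℝ n (y - x) := by
  simp only [polyEval, facePoly, map_sum, map_mul, map_sub, MvPolynomial.eval_C,
    MvPolynomial.eval_X, PiLp.inner_apply, RCLike.inner_apply, conj_trivial, PiLp.sub_apply,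
    ← Finset.sum_neg_distrib]
  exact Finset.sum_congr rfl fun i _ => by ring

theorem totalDegree_facePoly_le (n x : Euc d) : (facePoly n x).totalDegree ≤ 1 := by
  refine MvPolynomial.totalDegree_finsetSum_le fun i _ => ?_
  refine (MvPolynomial.totalDegree_mul _ _).trans ?_
  rw [MvPolynomial.totalDegree_C, zero_add]
  refine (MvPolynomial.totalDegree_sub _ _).trans ?_
  rw [MvPolynomial.totalDegree_C, MvPolynomial.totalDegree_X]
  simp

theorem polyEval_prod {ι : Type*} (s : Finset ι) (p : ι → MvPolynomial (Fin d) ℝ) (x : Euc d) :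
    polyEval (∏ i ∈ s, p i) x = ∏ i ∈ s, polyEval (p i) x := by
  simp [polyEval, map_prod]

theorem affineSpan_inf_lt {m : ℕ} {e e' : Set (Euc d)} (he : IsPolytope m e)
    (he' : IsPolytope m e') (hne : affineSpan ℝ e' ≠ affineSpan ℝ e) :
    affineSpan ℝ e ⊓ affineSpan ℝ e' < affineSpan ℝ e := by
  refine lt_of_le_of_ne inf_le_left fun h => hne ?_
  have hle : affineSpan ℝ e ≤ affineSpan ℝ e' := inf_eq_left.1 h
  obtain ⟨x, hx⟩ := he.nonempty_intrinsicInterior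
  have hxe := subset_affineSpan ℝ e (intrinsicInterior_subset hx)
  refine (AffineSubspace.ext_of_direction_eq ?_ ⟨x, hxe, hle hxe⟩).symm
  exact Submodule.eq_of_le_of_finrank_eq (AffineSubspace.direction_le hle)
    (by rw [he.finrank_direction, he'.finrank_direction])

/-- If the interior value and the weak gradient vanish on an element, so does the face value on a
face that is not coplanar with another face of the element. The test field is the product of the
face value, the normal, and polynomials that vanish on the other faces; on a convex element affine
polynomials have a sign, otherwise their squares are taken. This is what the degree is made
for. -/
theorem face_eq_zero (hd : 0 < d) (hqk : q ≤ k) {v : M.WeakFun} (hv : v ∈ M.V k q) {T : M.cells}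
    {e : M.faces} (he : e ∈ M.facesOf T)
    (hnc : ∀ e' ∈ M.facesOf T,
      affineSpan ℝ (e' : Set (Euc d)) = affineSpan ℝ (e : Set (Euc d)) → e' = e)
    (hv0 : v.1 T = 0) (hgrad : M.weakGradient (M.degree k T) T v = 0) : v.2 e = 0 := by
  classical
  obtain ⟨p, hp, hvp⟩ := M.exists_poly_face hv e
  have hPe := M.face_isPolytope e e.2
  have hN := fun e' he' => M.isOutwardUnitNormal_normal hd (T := T) (e := e') he'
  choose x hx using fun e' : M.faces => (M.face_isPolytope e' e'.2).nonempty_intrinsicInterior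
  let l : M.faces → MvPolynomial (Fin d) ℝ := fun e' => facePoly (M.normal T e') (x e')
  let m : ℕ := if Convex ℝ (T : Set (Euc d)) then 1 else 2
  let P : MvPolynomial (Fin d) ℝ := ∏ e' ∈ (M.facesOf T).erase e, l e' ^ m
  have hm1 : m ≠ 0 := by simp only [m]; split_ifs <;> norm_num
  have hl0 : ∀ e' ∈ M.facesOf T, ∀ y,
      polyEval (l e') y = 0 ↔ y ∈ affineSpan ℝ (e' : Set (Euc d)) := by
    intro e' he' y
    rw [(M.face_isPolytope e' e'.2).mem_affineSpan_iff (hN e' he').norm_eq_one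
      (hN e' he').orthogonal (subset_affineSpan ℝ _ (intrinsicInterior_subset (hx e'))),
      polyEval_facePoly, neg_eq_zero]
  have hPeval : ∀ y, polyEval P y = ∏ e' ∈ (M.facesOf T).erase e, polyEval (l e') y ^ m := by
    intro y
    rw [polyEval_prod]
    exact Finset.prod_congr rfl fun e' _ => by simp [polyEval]
  have hPnonneg : ∀ y ∈ (T : Set (Euc d)), 0 ≤ polyEval P y := by
    intro y hy
    rw [hPeval]
    refine Finset.prod_nonneg fun e' he' => ?_
    by_cases hconv : Convex ℝ (T : Set (Euc d))
    · refine pow_nonneg ?_ _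
      rw [polyEval_facePoly]
      have := M.inner_normal_nonpos_of_convex hd (Finset.mem_of_mem_erase he') hconv (hx e') hy
      linarith
    · simp only [m, if_neg hconv]
      exact sq_nonneg _
  have hPdeg : (p * P).totalDegree ≤ M.degree k T := by
    have hcard := Finset.card_erase_of_mem he
    have hpos := (M.facesOf_nonempty hd T).card_pos
    have hPd : P.totalDegree ≤ ((M.facesOf T).card - 1) * m := by
      refine (MvPolynomial.totalDegree_finsetProd _ _).trans ?_
      rw [← hcard, ← smul_eq_mul]
      refine Finset.sum_le_card_nsmul _ _ _ fun e' _ => ?_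
      refine (MvPolynomial.totalDegree_pow _ _).trans ?_
      exact (Nat.mul_le_mul_left m (totalDegree_facePoly_le _ _)).trans (by rw [mul_one])
    refine (MvPolynomial.totalDegree_mul _ _).trans ?_
    unfold degree
    by_cases hconv : Convex ℝ (T : Set (Euc d))
    · simp only [m, if_pos hconv] at hPd ⊢
      omega
    · simp only [m, if_neg hconv] at hPd ⊢
      omega
  have hG := (M.isWeakGradient_weakGradient hd hv (M.degree k T) (T := T)).2
    (fun i => MvPolynomial.C (M.normal T e i) * (p * P)) fun i =>
      (MvPolynomial.totalDegree_mul _ _).trans (by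
        rw [MvPolynomial.totalDegree_C, zero_add]; exact hPdeg)
  rw [hgrad, hv0] at hG
  simp only [Pi.zero_apply, polyEval_zero, zero_mul, Finset.sum_const_zero, integral_zero,
    neg_zero, zero_add, polyEval_mul, polyEval_C] at hG
  -- only the face itself contributes
  rw [boundaryIntegral, Finset.sum_eq_single_of_mem e he fun e' he' hne => by
    refine setIntegral_eq_zero_of_forall_eq_zero fun y hy => ?_
    have : polyEval P y = 0 := by
      rw [hPeval]
      refine Finset.prod_eq_zero (Finset.mem_erase.2 ⟨hne, he'⟩) ?_
      rw [(hl0 e' he' y).2 (subset_affineSpan ℝ _ hy), zero_pow hm1]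
    simp [this]] at hG
  have hnn : ∑ i, M.normal T e i * M.normal T e i = 1 := by
    have h1 := real_inner_self_eq_norm_sq (M.normal T e)
    rw [(hN e he).norm_eq_one, PiLp.inner_apply] at h1
    simpa [pow_two] using h1
  have hint : ∫ y in (e : Set (Euc d)), polyEval p y * polyEval p y * polyEval P y
      ∂(μHE[d - 1] : Measure (Euc d)) = 0 := by
    refine Eq.trans ?_ hG.symm
    refine setIntegral_congr_fun (M.isClosed_face e).measurableSet fun y hy => ?_
    rw [hvp, indicator_of_mem hy]
    have : ∀ i, M.normal T e i * (polyEval p y * polyEval P y) * M.normal T e i =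
        M.normal T e i * M.normal T e i * (polyEval p y * polyEval P y) := fun i => by ring
    simp only [this]
    rw [← Finset.sum_mul, hnn]
    ring
  rw [setIntegral_eq_zero_iff_of_nonneg_ae] at hint
  · have hae : ∀ᵐ y ∂(μHE[d - 1] : Measure (Euc d)).restrict e, ∀ e' ∈ (M.facesOf T).erase e,
        polyEval (l e') y ≠ 0 := by
      rw [Filter.eventually_all_finset]
      intro e' he'
      have hne := Finset.ne_of_mem_erase he'
      have heT' := Finset.mem_of_mem_erase he'
      have hnull := hPe.surfaceMeasure_eq_zero hd
        (affineSpan_inf_lt hPe (M.face_isPolytope e' e'.2) fun h => hne (hnc e' heT' h))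
      filter_upwards [ae_restrict_of_ae (measure_eq_zero_iff_ae_notMem.1 hnull),
        ae_restrict_mem (M.isClosed_face e).measurableSet] with y hy hye h0
      exact hy ⟨subset_affineSpan ℝ _ hye, (hl0 e' heT' y).1 h0⟩
    have hzero : ∀ᵐ y ∂(μHE[d - 1] : Measure (Euc d)).restrict e, polyEval p y = 0 := by
      filter_upwards [hint, hae] with y hy hye
      have hP : polyEval P y ≠ 0 := by
        rw [hPeval]
        exact Finset.prod_ne_zero_iff.2 fun e' he' => pow_ne_zero _ (hye e' he')
      have h0 : polyEval p y * polyEval p y * polyEval P y = 0 := hy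
      exact mul_self_eq_zero.1 ((mul_eq_zero.1 h0).resolve_right hP)
    have hall := hPe.eqOn_zero_of_ae hd (continuous_polyEval p) hzero
    rw [hvp]
    funext y
    by_cases hy : y ∈ (e : Set (Euc d))
    · rw [indicator_of_mem hy, hall y hy]; rfl
    · rw [indicator_of_notMem hy]; rfl
  · filter_upwards [ae_restrict_mem (M.isClosed_face e).measurableSet] with y hy
    exact mul_nonneg (mul_self_nonneg _) (hPnonneg y (M.face_subset_cell he hy))
  · exact M.integrableOn_face hd e (Continuous.continuousOn (by fun_prop))

/-- The bilinear form is definite on the weak functions that vanish on the boundary. -/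
theorem eq_zero_of_form_self_nonpos (hd : 2 ≤ d) (hΩ : IsPolytopalDomain Ω)
    (hM : M.HasNoncoplanarFaces) (hqk : q ≤ k) (hρ : 0 < ρ)
    (hb : ∀ i : Fin d, MemWOneInfty Ω fun x => b x i) (hbc : ContinuousOn b (closure Ω))
    (hc : IntegrableOn c Ω) {c₀ : ℝ} (hc₀ : 0 < c₀)
    (hcoer : ∀ᵐ x ∂volume.restrict Ω, c₀ ≤ c x + 1 / 2 * divergence Ω b x)
    {v : M.WeakFun} (hv : v ∈ M.V₀ k q) (hform : M.form ρ b c k v v ≤ 0) : v = 0 := by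
  have hd0 : 0 < d := by omega
  have hg : ∀ T : M.cells, ∀ i, 0 ≤ ∫ x in (T : Set (Euc d)),
      polyEval (M.weakGradient (M.degree k T) T v i) x *
        polyEval (M.weakGradient (M.degree k T) T v i) x := fun T i =>
    integral_nonneg fun x => mul_self_nonneg _
  have hsplit : ∀ T : M.cells, ∫ x in (T : Set (Euc d)),
      ∑ i, polyEval (M.weakGradient (M.degree k T) T v i) x *
        polyEval (M.weakGradient (M.degree k T) T v i) x =
      ∑ i, ∫ x in (T : Set (Euc d)), polyEval (M.weakGradient (M.degree k T) T v i) x *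
        polyEval (M.weakGradient (M.degree k T) T v i) x := fun T =>
    integral_finsetSum _ fun i _ => M.integrableOn_of_continuousOn T
      (Continuous.continuousOn (by fun_prop))
  have h0 : ∀ T : M.cells, 0 ≤ ∫ x in (T : Set (Euc d)), v.1 T x * v.1 T x := fun T =>
    integral_nonneg fun x => mul_self_nonneg _
  have hle := (M.coercivity hd hΩ hb hbc hc hcoer hv (ρ := ρ)).trans hform
  have hterm : ∀ T : M.cells, 0 ≤ ρ * (∫ x in (T : Set (Euc d)),
        ∑ i, polyEval (M.weakGradient (M.degree k T) T v i) x *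
          polyEval (M.weakGradient (M.degree k T) T v i) x) +
      c₀ * ∫ x in (T : Set (Euc d)), v.1 T x * v.1 T x := fun T => by
    rw [hsplit]
    exact add_nonneg (mul_nonneg hρ.le (Finset.sum_nonneg fun i _ => hg T i))
      (mul_nonneg hc₀.le (h0 T))
  have hzero := (Finset.sum_eq_zero_iff_of_nonneg fun T _ => hterm T).1
    (le_antisymm hle (Finset.sum_nonneg fun T _ => hterm T))
  have hv0 : ∀ T : M.cells, v.1 T = 0 := by
    intro T
    have hT := hzero T (Finset.mem_univ T)
    rw [hsplit] at hT
    have h1 := mul_nonneg hρ.le (Finset.sum_nonneg fun i (_ : i ∈ Finset.univ) => hg T i)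
    have h2 : ∫ x in (T : Set (Euc d)), v.1 T x * v.1 T x = 0 := by
      have h3 := mul_nonneg hc₀.le (h0 T)
      have h4 : c₀ * ∫ x in (T : Set (Euc d)), v.1 T x * v.1 T x = 0 := by linarith
      exact (mul_eq_zero.1 h4).resolve_left hc₀.ne'
    obtain ⟨p, -, hp⟩ := M.exists_poly_cell hv.1 T
    have h5 : p = 0 := (M.cell_isPolytope T T.2).eq_zero_of_setIntegral_sq (by
      rw [← h2]
      refine setIntegral_congr_fun (M.isCompact_cell T).isClosed.measurableSet fun x hx => ?_
      simp only [hp, indicator_of_mem hx])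
    rw [hp, h5]
    funext x
    simp [indicator]
  have hgrad : ∀ T : M.cells, M.weakGradient (M.degree k T) T v = 0 := by
    intro T
    have hT := hzero T (Finset.mem_univ T)
    rw [hsplit] at hT
    have h1 := mul_nonneg hρ.le (Finset.sum_nonneg fun i (_ : i ∈ Finset.univ) => hg T i)
    have h3 := mul_nonneg hc₀.le (h0 T)
    have h4 : ρ * ∑ i, ∫ x in (T : Set (Euc d)),
        polyEval (M.weakGradient (M.degree k T) T v i) x *
          polyEval (M.weakGradient (M.degree k T) T v i) x = 0 := by linarith
    funext i
    exact (M.cell_isPolytope T T.2).eq_zero_of_setIntegral_sq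
      ((Finset.sum_eq_zero_iff_of_nonneg fun i _ => hg T i).1
        ((mul_eq_zero.1 h4).resolve_left hρ.ne') i (Finset.mem_univ i))
  refine Prod.ext (funext hv0) (funext fun e => ?_)
  by_cases he : (e : Set (Euc d)) ⊆ frontier Ω
  · exact hv.2 e he
  · obtain ⟨T, hT, heT, hnc⟩ := hM e e.2 he
    exact M.face_eq_zero hd0 hqk hv.1 (T := ⟨T, hT⟩) (M.mem_facesOf.2 heT)
      (fun e' he' h => Subtype.ext (hnc e' e'.2 (M.mem_facesOf.1 he') h)) (hv0 _) (hgrad _)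

end PolytopalMesh

end Form

end

/-! ### Existence and uniqueness -/

theorem mainTheorem1 {d : ℕ} (hd : d = 2 ∨ d = 3)
    {Ω : Set (Euc d)} (hΩ : IsPolytopalDomain Ω)
    (M : PolytopalMesh Ω) (hM : M.HasNoncoplanarFaces)
    {k q : ℕ} (hqk : q ≤ k)
    {ρ : ℝ} (hρ : 0 < ρ)
    {b : Euc d → Euc d} (hb : ∀ i : Fin d, MemWOneInfty Ω fun x => b x i)
    (hb_cont : ContinuousOn b (closure Ω))
    {c : Euc d → ℝ} (hc : IntegrableOn c Ω)
    {c₀ : ℝ} (hc₀ : 0 < c₀)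
    (hcoer : ∀ᵐ x ∂volume.restrict Ω, c₀ ≤ c x + 1 / 2 * divergence Ω b x)
    {f : Euc d → ℝ} (hf : IntegrableOn f Ω) :
    ∃! u : M.WeakFun, u ∈ M.V₀ k q ∧
      ∀ v ∈ M.V₀ k q, M.form ρ b c k u v = M.load f v := by
  have hd2 : 2 ≤ d := by omega
  have hd0 : 0 < d := by omega
  have hle : M.V₀ k q ≤ M.V k q := fun v hv => hv.1
  have : FiniteDimensional ℝ (M.V k q) := M.finiteDimensional_V k q
  have : FiniteDimensional ℝ (M.V₀ k q) := Submodule.finiteDimensional_of_le hle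
  have hleft := fun {u u' v : M.WeakFun} (hu : u ∈ M.V₀ k q) (hu' : u' ∈ M.V₀ k q)
    (hv : v ∈ M.V₀ k q) =>
    M.form_smul_add_left (ρ := ρ) hd0 hΩ hb_cont hc (hle hu) (hle hu') (hle hv)
  have hright := fun {u v v' : M.WeakFun} (hu : u ∈ M.V₀ k q) (hv : v ∈ M.V₀ k q)
    (hv' : v' ∈ M.V₀ k q) =>
    M.form_smul_add_right (ρ := ρ) hd0 hΩ hb_cont hc (hle hu) (hle hv) (hle hv')
  have hload := fun {v v' : M.WeakFun} (hv : v ∈ M.V₀ k q) (hv' : v' ∈ M.V₀ k q) =>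
    M.load_smul_add hΩ hf (hle hv) (hle hv')
  have hz : (0 : M.WeakFun) ∈ M.V₀ k q := Submodule.zero_mem _
  have hleft0 : ∀ v ∈ M.V₀ k q, M.form ρ b c k 0 v = 0 := fun v hv => by
    have := hleft hz hz hv 1
    rw [smul_zero, add_zero, one_mul] at this
    linarith
  have hright0 : ∀ u ∈ M.V₀ k q, M.form ρ b c k u 0 = 0 := fun u hu => by
    have := hright hu hz hz 1
    rw [smul_zero, add_zero, one_mul] at this
    linarith
  have hload0 : M.load f 0 = 0 := by
    have := hload hz hz 1
    rw [smul_zero, add_zero, one_mul] at this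
    linarith
  let A : M.V₀ k q →ₗ[ℝ] M.V₀ k q →ₗ[ℝ] ℝ := LinearMap.mk₂ ℝ
    (fun u v => M.form ρ b c k u v)
    (fun u u' v => by simpa using hleft u.2 u'.2 v.2 1)
    (fun a u v => by simpa [hleft0 v v.2] using hleft u.2 hz v.2 a)
    (fun u v v' => by simpa using hright u.2 v.2 v'.2 1)
    (fun a u v => by simpa [hright0 u u.2] using hright u.2 v.2 hz a)
  let F : M.V₀ k q →ₗ[ℝ] ℝ :=
    { toFun := fun v => M.load f v
      map_add' := fun v v' => by simpa using hload v.2 v'.2 1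
      map_smul' := fun a v => by simpa [hload0] using hload v.2 hz a }
  have hA : ∀ u, A u u = 0 → u = 0 := fun u hu =>
    Subtype.ext (M.eq_zero_of_form_self_nonpos hd2 hΩ hM hqk hρ hb hb_cont hc hc₀ hcoer u.2
      (le_of_eq hu))
  obtain ⟨u, hu, huniq⟩ := existsUnique_of_definite A hA F
  refine ⟨u, ⟨u.2, fun v hv => LinearMap.congr_fun hu ⟨v, hv⟩⟩, ?_⟩
  rintro w ⟨hw, hw'⟩
  exact congrArg Subtype.val (huniq ⟨w, hw⟩ (LinearMap.ext fun v => hw' v v.2))
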